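/- Let $d_1,d_2\ge 1$ be integers, $d=\min(d_1,d_2)$, $p\in[1,\infty]$ and $s>0$. For a multi-index $\alpha\in\mathbf N^n$ let $h_\alpha$ be the ($L^2$-normalized) Hermite function on $\mathbf R^n$, and let $H=|x|^2-\Delta$ be the harmonic oscillator. Let $\mathcal H_s(\mathbf R^n)$ (resp. $\mathcal H_{0,s}(\mathbf R^n)$) be the set of all functions $f=\sum_{\alpha\in\mathbf N^n}c_\alpha h_\alpha$ such that for some (resp. every) $r>0$ one has $\sup_\alpha |c_\alpha|e^{r|\alpha|^{1/(2s)}}<\infty$. Let $K\in C^\infty(\mathbf R^{d_2}\times\mathbf R^{d_1})$ be complex-valued. For sequences $\{\lambda_j\}_{j\ge1}\subseteq[0,\infty)$ and $\{f_{k,j}\}_{j\ge1}$ of functions on $\mathbf R^{d_k}$, $k=1,2$, consider the expansion $$K(x_2,x_1)=\sum_{j=1}^\infty\lambda_j f_{1,j}(x_1)f_{2,j}(x_2)\tag{A}$$ and, for $r,h>0$, the estimates $$\sup_{j\ge1}\bigl(e^{rj^{1/(2ds)}}\lambda_j\bigr)<\infty,\qquad \sup_{j\ge1,\,N\ge0}\frac{e^{rj^{1/(2ds)}}\|H^Nf_{k,j}\|_{L^p(\mathbf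 R^{d_k})}}{h^N(N!)^{2s}}<\infty,\quad k=1,2,\tag{B}$$ where $H^Nf_{k,j}$ is taken in the sense of distributions and the norm is $\infty$ if $H^Nf_{k,j}\notin L^p$. (1) If $K\in\mathcal H_s(\mathbf R^{d_2}\times\mathbf R^{d_1})$ (resp. $K\in\mathcal H_{0,s}(\mathbf R^{d_2}\times\mathbf R^{d_1})$), then there are $\lambda_j\ge0$ and smooth functions $f_{k,j}$ such that, for $k=1,2$, $\{f_{k,j}\}_{j\ge1}$ is a sequence of nonzero, mutually orthogonal elements of $L^2(\mathbf R^{d_k})$, (A) holds at every point, and (B) holds for some $r,h>0$ (resp. for every $r,h>0$). (2) Conversely, if (A) holds almost everywhere for some $\lambda_j\ge0$ and some locally integrable, not necessarily orthogonal, $f_{k,j}$ for which (B) holds for some $r,h>0$ (resp. for every $r,h>0$), then $K\in\mathcal H_s(\mathbf R^{d_2}\times\mathbf R^{d_1})$ (resp. $K\in\mathcal H_{0,s}(\mathbf R^{d_2}\times\mathbf R^{d_1})$). -/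

import Mathlib

open MeasureTheory
open scoped ContDiff ENNReal

noncomputable section

namespace Pilipovic

/-- The normalized Hermite function of order `n` on `ℝ`. Mathlib's `Polynomial.hermite` is the
probabilists' polynomial `He_n`, and `H_n(t) = 2^(n/2) He_n(√2 t)`, so this is
`π^(-1/4) (2^n n!)^(-1/2) H_n(t) exp(-t²/2)`. -/
def hermiteFun1 (n : ℕ) (t : ℝ) : ℝ :=
  Polynomial.aeval (√2 * t) (Polynomial.hermite n) * Real.exp (-t ^ 2 / 2) /
    (Real.pi ^ (1 / 4 : ℝ) * √(n.factorial : ℝ))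

variable {ι : Type*} [Fintype ι]

/-- The Hermite function `h_α`, `α` a multi-index, on the Euclidean space with index set `ι`. -/
def hermiteFun (α : ι → ℕ) (x : EuclideanSpace ℝ ι) : ℝ :=
  ∏ i, hermiteFun1 (α i) (x i)

/-- The weighted sup bound `|c_α| ≤ C exp(-r |α|^(1/(2s)))` on Hermite coefficients. -/
def CoeffBound (s r : ℝ) (c : (ι → ℕ) → ℂ) : Prop :=
  ∃ C : ℝ, ∀ α : ι → ℕ, ‖c α‖ ≤ C * Real.exp (-r * ((∑ i, α i : ℕ) : ℝ) ^ (1 / (2 * s)))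

/-- `f` is the (pointwise) sum of the Hermite series with coefficients `c`. -/
def IsHermiteSeries (c : (ι → ℕ) → ℂ) (f : EuclideanSpace ℝ ι → ℂ) : Prop :=
  ∀ x, HasSum (fun α : ι → ℕ => c α * (hermiteFun α x : ℂ)) (f x)

/-- The Pilipović space `𝓗_s` of Roumieu type, for real `s > 0`. -/
def roumieuSpace (ι : Type*) [Fintype ι] (s : ℝ) : Set (EuclideanSpace ℝ ι → ℂ) :=
  {f | ∃ c : (ι → ℕ) → ℂ, (∃ r > 0, CoeffBound s r c) ∧ IsHermiteSeries c f}

/-- The Pilipović space `𝓗_{0,s}` of Beurling type, for real `s > 0`. -/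
def beurlingSpace (ι : Type*) [Fintype ι] (s : ℝ) : Set (EuclideanSpace ℝ ι → ℂ) :=
  {f | ∃ c : (ι → ℕ) → ℂ, (∀ r > 0, CoeffBound s r c) ∧ IsHermiteSeries c f}

/-- A function on `ℝ^m × ℝ^n` regarded as a function on `ℝ^(m+n)`. -/
def onSum {m n : ℕ} (K : EuclideanSpace ℝ (Fin m) × EuclideanSpace ℝ (Fin n) → ℂ) :
    EuclideanSpace ℝ (Fin m ⊕ Fin n) → ℂ :=
  fun z => K (WithLp.toLp 2 fun i => z (Sum.inl i), WithLp.toLp 2 fun i => z (Sum.inr i))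

/-- The harmonic oscillator `H = |x|² - Δ`, on smooth functions. -/
def harmOsc (φ : EuclideanSpace ℝ ι → ℂ) : EuclideanSpace ℝ ι → ℂ :=
  fun x => (‖x‖ ^ 2 : ℝ) * φ x - Laplacian.laplacian φ x

/-- `H^N f = g` in the sense of distributions. -/
def IsHarmOscPow (N : ℕ) (f g : EuclideanSpace ℝ ι → ℂ) : Prop :=
  ∀ φ : EuclideanSpace ℝ ι → ℂ, ContDiff ℝ ∞ φ → HasCompactSupport φ →
    ∫ x, g x * φ x = ∫ x, f x * (harmOsc^[N] φ) x

/-- `H^N f` belongs to `L^p` and its `L^p` norm is at most `B`. -/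
def HarmOscPowNormLE (p : ℝ≥0∞) (N : ℕ) (f : EuclideanSpace ℝ ι → ℂ) (B : ℝ) : Prop :=
  ∃ g : EuclideanSpace ℝ ι → ℂ, MemLp g p ∧ IsHarmOscPow N f g ∧ eLpNorm g p ≤ ENNReal.ofReal B

/-- Orthogonal sequences of nonzero elements of `L²`, not necessarily normalized. -/
def IsOG (f : ℕ → EuclideanSpace ℝ ι → ℂ) : Prop :=
  (∀ j, MemLp (f j) 2) ∧ (∀ j, ¬ f j =ᵐ[volume] 0) ∧
    ∀ i j, i ≠ j → ∫ x, f i x * starRingEnd ℂ (f j x) = 0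

/-- The weight `exp(r j^(1/(2ds)))`, `j ≥ 1`. Sequences are indexed by `ℕ`, the entry with index
`j` being the one of number `j + 1`. -/
def expWeight (d : ℕ) (s r : ℝ) (j : ℕ) : ℝ :=
  Real.exp (r * ((j : ℝ) + 1) ^ (1 / (2 * d * s)))

/-- `sup_j exp(r j^(1/(2ds))) l_j < ∞`. -/
def ScalarEstimate (d : ℕ) (s r : ℝ) (l : ℕ → ℝ) : Prop :=
  ∃ C : ℝ, ∀ j, expWeight d s r j * l j ≤ C

/-- `sup_{j,N} exp(r j^(1/(2ds))) ‖H^N f_j‖_{L^p} / (h^N (N!)^(2s)) < ∞`. -/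
def FunctionEstimate (p : ℝ≥0∞) (d : ℕ) (s r h : ℝ) (f : ℕ → EuclideanSpace ℝ ι → ℂ) : Prop :=
  ∃ C : ℝ, ∀ j N : ℕ,
    HarmOscPowNormLE p N (f j)
      (C * (h ^ N * (N.factorial : ℝ) ^ (2 * s)) / expWeight d s r j)

/-- The estimates on `l_j`, `f_{1,j}` and `f_{2,j}` with parameters `r` and `h`. -/
def ExpansionEstimates {d₁ d₂ : ℕ} (p : ℝ≥0∞) (s r h : ℝ) (l : ℕ → ℝ)
    (f₁ : ℕ → EuclideanSpace ℝ (Fin d₁) → ℂ) (f₂ : ℕ → EuclideanSpace ℝ (Fin d₂) → ℂ) : Prop :=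
  ScalarEstimate (min d₁ d₂) s r l ∧
    FunctionEstimate p (min d₁ d₂) s r h f₁ ∧ FunctionEstimate p (min d₁ d₂) s r h f₂

/-- `K = ∑_j l_j f_{1,j} ⊗ f_{2,j}` at the point `z = (x₂, x₁)`. -/
def ExpansionAt {d₁ d₂ : ℕ} (K : EuclideanSpace ℝ (Fin d₂) × EuclideanSpace ℝ (Fin d₁) → ℂ)
    (l : ℕ → ℝ) (f₁ : ℕ → EuclideanSpace ℝ (Fin d₁) → ℂ)
    (f₂ : ℕ → EuclideanSpace ℝ (Fin d₂) → ℂ)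
    (z : EuclideanSpace ℝ (Fin d₂) × EuclideanSpace ℝ (Fin d₁)) : Prop :=
  HasSum (fun j => (l j : ℂ) * (f₁ j z.2 * f₂ j z.1)) (K z)

/-- `K` has an expansion with nonnegative `l_j` and orthogonal sequences of smooth functions,
valid at every point, with property `P` of the sequences. -/
def HasOrthogonalExpansion {d₁ d₂ : ℕ}
    (K : EuclideanSpace ℝ (Fin d₂) × EuclideanSpace ℝ (Fin d₁) → ℂ)
    (P : (ℕ → ℝ) → (ℕ → EuclideanSpace ℝ (Fin d₁) → ℂ) →
      (ℕ → EuclideanSpace ℝ (Fin d₂) → ℂ) → Prop) : Prop :=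
  ∃ (l : ℕ → ℝ) (f₁ : ℕ → EuclideanSpace ℝ (Fin d₁) → ℂ)
    (f₂ : ℕ → EuclideanSpace ℝ (Fin d₂) → ℂ),
    (∀ j, 0 ≤ l j) ∧ IsOG f₁ ∧ IsOG f₂ ∧
    (∀ j, ContDiff ℝ ∞ (f₁ j)) ∧ (∀ j, ContDiff ℝ ∞ (f₂ j)) ∧
    (∀ z, ExpansionAt K l f₁ f₂ z) ∧ P l f₁ f₂

/-- `K` has an expansion with nonnegative `l_j` and locally integrable functions, not necessarily
orthogonal, valid almost everywhere, with property `P` of the sequences. -/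
def HasExpansion {d₁ d₂ : ℕ}
    (K : EuclideanSpace ℝ (Fin d₂) × EuclideanSpace ℝ (Fin d₁) → ℂ)
    (P : (ℕ → ℝ) → (ℕ → EuclideanSpace ℝ (Fin d₁) → ℂ) →
      (ℕ → EuclideanSpace ℝ (Fin d₂) → ℂ) → Prop) : Prop :=
  ∃ (l : ℕ → ℝ) (f₁ : ℕ → EuclideanSpace ℝ (Fin d₁) → ℂ)
    (f₂ : ℕ → EuclideanSpace ℝ (Fin d₂) → ℂ),
    (∀ j, 0 ≤ l j) ∧ (∀ j, LocallyIntegrable (f₁ j)) ∧ (∀ j, LocallyIntegrable (f₂ j)) ∧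
    (∀ᵐ z, ExpansionAt K l f₁ f₂ z) ∧ P l f₁ f₂

end Pilipovic

end

/-!
The Hermite function `h_α` is an eigenfunction of `H` with eigenvalue `2|α| + n`, so bounds
`‖H^N f‖ ≤ C h^N (N!)^(2s)` and `|c_α| ≤ C exp(-r |α|^(1/(2s)))` on a function `f` and its Hermite
coefficients are equivalent up to a change of `h` and `r`: in one direction because the moments of
`H^N f` against `h_α` are `(2|α| + n)^N c_α`, optimizing over `N`, in the other by summing the
Hermite series of `H^N f`, which converges in every weighted norm. Since only a distributional
`H^N f` is given, the moments are computed with Hermite functions that are cut off, and the cutoff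
is removed in the limit.

An expansion with decaying factors therefore gives the Hermite coefficients of `K` by summing over
`j`. Conversely, the Hermite coefficients of `K` form the matrix of a compact operator on `ℓ²`. It
is small on the vectors which vanish at the `j` lowest indices of the smaller dimension `d`, so by
the min-max principle its singular values `σ_j` decay like `exp(-r j^(1/(2ds)))`, while the singular
vectors multiplied by `σ_j` inherit the decay of the matrix. Splitting `σ_j` into roots, one for
`λ_j` and one for each singular vector, gives all factors both kinds of decay. -/

noncomputable section

namespace Pilipovic

/-! ### Hermite functions on the line -/

theorem derivative_hermite (n : ℕ) :
    Polynomial.derivative (Polynomial.hermite n) =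
      (n : Polynomial ℤ) * Polynomial.hermite (n - 1) := by
  suffices h : ∀ n, Polynomial.derivative (Polynomial.hermite (n + 1)) =
      ((n + 1 : ℕ) : Polynomial ℤ) * Polynomial.hermite n by
    cases n with
    | zero => simp
    | succ n => exact h n
  intro n
  induction n with
  | zero => simp
  | succ n ih =>
    rw [Polynomial.hermite_succ (n + 1)]
    simp only [Polynomial.derivative_sub, Polynomial.derivative_mul, Polynomial.derivative_X, ih,
      Polynomial.derivative_natCast]
    rw [Polynomial.hermite_succ n]
    push_cast
    ring

theorem aeval_hermite_succ {R : Type*} [CommRing R] (n : ℕ) (y : R) :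
    Polynomial.aeval y (Polynomial.hermite (n + 1)) =
      y * Polynomial.aeval y (Polynomial.hermite n) -
        n * Polynomial.aeval y (Polynomial.hermite (n - 1)) := by
  rw [Polynomial.hermite_succ, derivative_hermite]
  simp

/-- The matrix entry `√(n/2)` of the creation and annihilation operators between the Hermite
functions of order `n - 1` and `n`. -/
def ladder (n : ℕ) : ℝ := √((n : ℝ) / 2)

theorem ladder_zero : ladder 0 = 0 := by simp [ladder]

theorem ladder_nonneg (n : ℕ) : 0 ≤ ladder n := Real.sqrt_nonneg _

theorem ladder_sq (n : ℕ) : ladder n ^ 2 = (n : ℝ) / 2 := Real.sq_sqrt (by positivity)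

theorem ladder_succ_pos (n : ℕ) : 0 < ladder (n + 1) :=
  Real.sqrt_pos.2 (by positivity)

theorem ladder_le (n : ℕ) : ladder n ≤ n := by
  rcases Nat.eq_zero_or_pos n with rfl | h
  · simp [ladder]
  · have : (1 : ℝ) ≤ n := by exact_mod_cast h
    rw [ladder, Real.sqrt_le_left (by positivity)]
    nlinarith

theorem sqrt_factorial_succ (n : ℕ) :
    √((n + 1).factorial : ℝ) = √2 * ladder (n + 1) * √(n.factorial : ℝ) := by
  rw [ladder, ← Real.sqrt_mul (by positivity), ← Real.sqrt_mul (by positivity),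
    Nat.factorial_succ]
  congr 1
  push_cast
  ring

theorem hermiteFun1_zero (t : ℝ) :
    hermiteFun1 0 t = Real.exp (-t ^ 2 / 2) / Real.pi ^ (1 / 4 : ℝ) := by
  simp [hermiteFun1]

theorem mul_hermiteFun1 (n : ℕ) (t : ℝ) :
    t * hermiteFun1 n t =
      ladder n * hermiteFun1 (n - 1) t + ladder (n + 1) * hermiteFun1 (n + 1) t := by
  have h2 : (√2 : ℝ) ^ 2 = 2 := Real.sq_sqrt (by norm_num)
  have hl := ladder_succ_pos n
  unfold hermiteFun1
  rw [sqrt_factorial_succ, aeval_hermite_succ]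
  cases n with
  | zero =>
    simp only [ladder_zero, Nat.cast_zero]
    field_simp
    ring
  | succ n =>
    have hl' := ladder_succ_pos n
    rw [sqrt_factorial_succ, Nat.add_sub_cancel]
    field_simp
    rw [h2, ladder_sq (n + 1)]
    push_cast
    ring

theorem contDiff_hermiteFun1 (n : ℕ) : ContDiff ℝ ∞ (hermiteFun1 n) := by
  unfold hermiteFun1
  have : ContDiff ℝ ∞ fun t : ℝ => Polynomial.aeval (√2 * t) (Polynomial.hermite n) :=
    (Polynomial.contDiff_aeval _ _).comp (contDiff_const.mul contDiff_id)
  exact (this.mul (by fun_prop)).div_const _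

theorem continuous_hermiteFun1 (n : ℕ) : Continuous (hermiteFun1 n) :=
  (contDiff_hermiteFun1 n).continuous

theorem hasDerivAt_hermiteFun1_lower (n : ℕ) (t : ℝ) :
    HasDerivAt (hermiteFun1 n) (2 * ladder n * hermiteFun1 (n - 1) t - t * hermiteFun1 n t) t := by
  have hpoly : HasDerivAt (fun t : ℝ => Polynomial.aeval (√2 * t) (Polynomial.hermite n))
      (Polynomial.aeval (√2 * t) (Polynomial.derivative (Polynomial.hermite n)) * √2) t :=
    ((Polynomial.hasDerivAt_aeval (Polynomial.hermite n) (√2 * t)).comp t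
      ((hasDerivAt_id t).const_mul √2)).congr_deriv (by rw [mul_one])
  have hgauss : HasDerivAt (fun t : ℝ => Real.exp (-t ^ 2 / 2))
      (Real.exp (-t ^ 2 / 2) * (-t)) t :=
    (((hasDerivAt_pow 2 t).neg.div_const 2).congr_deriv (by norm_num; ring)).exp
  refine ((hpoly.mul hgauss).div_const (Real.pi ^ (1 / 4 : ℝ) * √(n.factorial : ℝ))).congr_deriv ?_
  rw [derivative_hermite]
  unfold hermiteFun1
  cases n with
  | zero => simp [ladder_zero]; ring
  | succ n =>
    have hl := ladder_succ_pos n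
    rw [sqrt_factorial_succ, Nat.add_sub_cancel, map_mul, map_natCast]
    field_simp
    rw [ladder_sq]
    push_cast
    ring

theorem hasDerivAt_hermiteFun1_raise (n : ℕ) (t : ℝ) :
    HasDerivAt (hermiteFun1 n)
      (t * hermiteFun1 n t - 2 * ladder (n + 1) * hermiteFun1 (n + 1) t) t :=
  (hasDerivAt_hermiteFun1_lower n t).congr_deriv (by linear_combination -2 * mul_hermiteFun1 n t)

theorem deriv_hermiteFun1 (n : ℕ) (t : ℝ) :
    deriv (hermiteFun1 n) t =
      ladder n * hermiteFun1 (n - 1) t - ladder (n + 1) * hermiteFun1 (n + 1) t := by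
  rw [(hasDerivAt_hermiteFun1_lower n t).deriv, mul_hermiteFun1]
  ring

theorem deriv_deriv_hermiteFun1 (n : ℕ) (t : ℝ) :
    deriv (deriv (hermiteFun1 n)) t = (t ^ 2 - (2 * n + 1)) * hermiteFun1 n t := by
  have hraise : HasDerivAt (fun t => 2 * ladder n * hermiteFun1 (n - 1) t)
      (2 * ladder n * (t * hermiteFun1 (n - 1) t - 2 * ladder n * hermiteFun1 n t)) t := by
    cases n with
    | zero => simpa [ladder_zero] using hasDerivAt_const t (0 : ℝ)
    | succ n => exact (hasDerivAt_hermiteFun1_raise n t).const_mul _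
  rw [funext fun t => (hasDerivAt_hermiteFun1_lower n t).deriv,
    (hraise.fun_sub ((hasDerivAt_id' t).fun_mul (hasDerivAt_hermiteFun1_lower n t))).deriv]
  linear_combination (-4 * hermiteFun1 n t) * ladder_sq n

theorem exists_abs_pow_mul_hermiteFun1_le (n k : ℕ) :
    ∃ C : ℝ, ∀ t, |t ^ k * hermiteFun1 n t| ≤ C := by
  induction n using Nat.strong_induction_on generalizing k with
  | _ n ih =>
    cases n with
    | zero =>
      refine ⟨k.factorial * Real.exp (1 / 2) / Real.pi ^ (1 / 4 : ℝ), fun t => ?_⟩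
      have hpow : |t| ^ k ≤ k.factorial * Real.exp |t| := by
        have := Real.pow_div_factorial_le_exp |t| (abs_nonneg t) k
        rwa [div_le_iff₀' (by positivity)] at this
      rw [hermiteFun1_zero, mul_div_assoc', abs_div, abs_mul, Real.abs_exp, abs_pow,
        abs_of_pos (by positivity : (0 : ℝ) < Real.pi ^ (1 / 4 : ℝ))]
      refine div_le_div_of_nonneg_right ?_ (by positivity)
      calc |t| ^ k * Real.exp (-t ^ 2 / 2)
          ≤ k.factorial * Real.exp |t| * Real.exp (-t ^ 2 / 2) := by gcongr
        _ = k.factorial * Real.exp (|t| + -t ^ 2 / 2) := by rw [Real.exp_add]; ring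
        _ ≤ k.factorial * Real.exp (1 / 2) := by
          gcongr
          nlinarith [sq_nonneg (|t| - 1), sq_abs t]
    | succ n =>
      obtain ⟨C₁, h₁⟩ := ih n (by omega) (k + 1)
      obtain ⟨C₂, h₂⟩ := ih (n - 1) (by omega) k
      have hl := ladder_succ_pos n
      refine ⟨(C₁ + ladder n * C₂) / ladder (n + 1), fun t => ?_⟩
      have hrec : t ^ k * hermiteFun1 (n + 1) t = (t ^ (k + 1) * hermiteFun1 n t -
          ladder n * (t ^ k * hermiteFun1 (n - 1) t)) / ladder (n + 1) := by
        field_simp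
        linear_combination -t ^ k * mul_hermiteFun1 n t
      rw [hrec, abs_div, abs_of_pos hl]
      gcongr
      refine (abs_sub _ _).trans (add_le_add (h₁ t) ?_)
      rw [abs_mul, abs_of_nonneg (ladder_nonneg n)]
      exact mul_le_mul_of_nonneg_left (h₂ t) (ladder_nonneg n)

theorem integrable_pow_mul_hermiteFun1_mul (k m n : ℕ) :
    Integrable fun t => t ^ k * hermiteFun1 m t * hermiteFun1 n t := by
  obtain ⟨C₀, h₀⟩ := exists_abs_pow_mul_hermiteFun1_le m k
  obtain ⟨C₂, h₂⟩ := exists_abs_pow_mul_hermiteFun1_le m (k + 2)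
  obtain ⟨C, h⟩ := exists_abs_pow_mul_hermiteFun1_le n 0
  have hcont := continuous_hermiteFun1
  refine (integrable_inv_one_add_sq.const_mul ((C₀ + C₂) * C)).mono'
    (by fun_prop) (.of_forall fun t => ?_)
  have hm : |t ^ k * hermiteFun1 m t| ≤ (C₀ + C₂) * (1 + t ^ 2)⁻¹ := by
    rw [← div_eq_mul_inv, le_div_iff₀ (by positivity)]
    have hsplit : |t ^ k * hermiteFun1 m t| * (1 + t ^ 2) =
        |t ^ k * hermiteFun1 m t| + |t ^ (k + 2) * hermiteFun1 m t| := by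
      simp only [abs_mul, abs_pow, pow_add, sq_abs]
      ring
    linarith [h₀ t, h₂ t]
  have hn : |hermiteFun1 n t| ≤ C := by simpa using h t
  calc ‖t ^ k * hermiteFun1 m t * hermiteFun1 n t‖
      = |t ^ k * hermiteFun1 m t| * |hermiteFun1 n t| := by rw [Real.norm_eq_abs, abs_mul]
    _ ≤ (C₀ + C₂) * (1 + t ^ 2)⁻¹ * C :=
      mul_le_mul hm hn (abs_nonneg _) ((abs_nonneg _).trans hm)
    _ = _ := by ring

theorem integrable_hermiteFun1_mul (m n : ℕ) :
    Integrable fun t => hermiteFun1 m t * hermiteFun1 n t := by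
  simpa using integrable_pow_mul_hermiteFun1_mul 0 m n

theorem integral_hermiteFun1_mul_succ (m n : ℕ) :
    ladder (n + 1) * ∫ t, hermiteFun1 m t * hermiteFun1 (n + 1) t =
      ladder m * ∫ t, hermiteFun1 (m - 1) t * hermiteFun1 n t := by
  have hI := integrable_hermiteFun1_mul
  -- Lowering one factor and raising the other, the terms with `t` cancel.
  have hderiv : ∀ t, HasDerivAt (fun t => hermiteFun1 m t * hermiteFun1 n t)
      (2 * ladder m * (hermiteFun1 (m - 1) t * hermiteFun1 n t) -
        2 * ladder (n + 1) * (hermiteFun1 m t * hermiteFun1 (n + 1) t)) t := fun t =>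
    ((hasDerivAt_hermiteFun1_lower m t).mul (hasDerivAt_hermiteFun1_raise n t)).congr_deriv
      (by ring)
  have h := integral_eq_zero_of_hasDerivAt_of_integrable hderiv
    (((hI _ _).const_mul _).sub ((hI _ _).const_mul _)) (hI m n)
  rw [integral_sub ((hI _ _).const_mul _) ((hI _ _).const_mul _), integral_const_mul,
    integral_const_mul] at h
  linarith

theorem integral_hermiteFun1_zero_mul_zero : ∫ t, hermiteFun1 0 t * hermiteFun1 0 t = 1 := by
  have hgauss : ∀ t, hermiteFun1 0 t * hermiteFun1 0 t =
      (√Real.pi)⁻¹ * Real.exp (-1 * t ^ 2) := fun t => by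
    rw [hermiteFun1_zero, div_mul_div_comm, ← Real.exp_add, ← Real.rpow_add Real.pi_pos,
      Real.sqrt_eq_rpow, div_eq_inv_mul]
    congr 2
    · norm_num
    · ring
  simp_rw [hgauss]
  rw [integral_const_mul, integral_gaussian]
  simp [Real.sqrt_ne_zero'.2 Real.pi_pos]

theorem integral_hermiteFun1_mul (m n : ℕ) :
    ∫ t, hermiteFun1 m t * hermiteFun1 n t = if m = n then 1 else 0 := by
  have zero_succ : ∀ n, ∫ t, hermiteFun1 0 t * hermiteFun1 (n + 1) t = 0 := fun n => by
    have h := integral_hermiteFun1_mul_succ 0 n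
    rw [ladder_zero, zero_mul] at h
    exact (mul_eq_zero.1 h).resolve_left (ladder_succ_pos n).ne'
  induction n generalizing m with
  | zero =>
    cases m with
    | zero => simpa using integral_hermiteFun1_zero_mul_zero
    | succ m => simpa [mul_comm] using zero_succ m
  | succ n ih =>
    cases m with
    | zero => simpa using zero_succ n
    | succ m =>
      have h := integral_hermiteFun1_mul_succ (m + 1) n
      have hl := (ladder_succ_pos n).ne'
      rw [Nat.add_sub_cancel, ih m] at h
      by_cases hmn : m = n
      · subst hmn
        simpa [hl] using h
      · simpa [hmn, hl] using h

theorem integral_deriv_hermiteFun1_sq (n : ℕ) :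
    Integrable (fun t => deriv (hermiteFun1 n) t ^ 2) ∧
      ∫ t, deriv (hermiteFun1 n) t ^ 2 = n + 1 / 2 := by
  have hI := integrable_hermiteFun1_mul
  have hexp : (fun t => deriv (hermiteFun1 n) t ^ 2) = fun t =>
      ladder n ^ 2 * (hermiteFun1 (n - 1) t * hermiteFun1 (n - 1) t) +
      ladder (n + 1) ^ 2 * (hermiteFun1 (n + 1) t * hermiteFun1 (n + 1) t) -
      2 * ladder n * ladder (n + 1) * (hermiteFun1 (n - 1) t * hermiteFun1 (n + 1) t) := by
    funext t
    rw [deriv_hermiteFun1]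
    ring
  have hsum := ((hI (n - 1) (n - 1)).const_mul (ladder n ^ 2)).fun_add
    ((hI (n + 1) (n + 1)).const_mul (ladder (n + 1) ^ 2))
  have hcross := (hI (n - 1) (n + 1)).const_mul (2 * ladder n * ladder (n + 1))
  rw [hexp]
  refine ⟨hsum.sub hcross, ?_⟩
  rw [integral_sub hsum hcross, integral_add ((hI _ _).const_mul _) ((hI _ _).const_mul _)]
  have hne : n - 1 ≠ n + 1 := by omega
  simp only [integral_const_mul, integral_hermiteFun1_mul, ladder_sq, hne, if_true, if_false]
  push_cast
  ring

theorem sq_le_integral_sq_add_integral_sq_deriv {u : ℝ → ℝ} (hu : Differentiable ℝ u)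
    (hu2 : Integrable fun t => u t ^ 2) (hu'2 : Integrable fun t => deriv u t ^ 2) (t : ℝ) :
    u t ^ 2 ≤ (∫ x, u x ^ 2) + ∫ x, deriv u x ^ 2 := by
  have hderiv : ∀ x, HasDerivAt (fun x => u x ^ 2) (2 * (u x * deriv u x)) x := fun x =>
    ((hu x).hasDerivAt.pow 2).congr_deriv (by simp; ring)
  have habs : ∀ x, ‖2 * (u x * deriv u x)‖ ≤ u x ^ 2 + deriv u x ^ 2 := fun x => by
    rw [Real.norm_eq_abs, abs_le]
    constructor <;> nlinarith [sq_nonneg (u x + deriv u x), sq_nonneg (u x - deriv u x)]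
  have integrable_deriv_sq : Integrable fun x => 2 * (u x * deriv u x) := by
    refine (hu2.add hu'2).mono' ?_ (.of_forall habs)
    exact ((hu.continuous.measurable.mul (measurable_deriv u)).const_mul 2).aestronglyMeasurable
  have hlim : Filter.Tendsto (fun x => u x ^ 2) Filter.atBot (nhds 0) :=
    tendsto_zero_of_hasDerivAt_of_integrableOn_Iic (a := 0) (fun x _ => hderiv x)
      integrable_deriv_sq.integrableOn hu2.integrableOn
  calc u t ^ 2 = ∫ x in Set.Iic t, 2 * (u x * deriv u x) := by
        rw [integral_Iic_of_hasDerivAt_of_tendsto' (fun x _ => hderiv x)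
          integrable_deriv_sq.integrableOn hlim, sub_zero]
    _ ≤ ∫ x in Set.Iic t, (u x ^ 2 + deriv u x ^ 2) :=
        integral_mono integrable_deriv_sq.integrableOn (hu2.fun_add hu'2).integrableOn
          fun x => (le_abs_self _).trans (habs x)
    _ ≤ ∫ x, (u x ^ 2 + deriv u x ^ 2) :=
        setIntegral_le_integral (hu2.add hu'2) (.of_forall fun x => by positivity)
    _ = _ := integral_add hu2 hu'2

theorem abs_hermiteFun1_le (n : ℕ) (t : ℝ) : |hermiteFun1 n t| ≤ 2 * ((n : ℝ) + 1) := by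
  have hu2 : (fun t => hermiteFun1 n t ^ 2) = fun t => hermiteFun1 n t * hermiteFun1 n t :=
    funext fun t => sq _
  have h := sq_le_integral_sq_add_integral_sq_deriv
    (fun t => (hasDerivAt_hermiteFun1_lower n t).differentiableAt)
    (hu2 ▸ integrable_hermiteFun1_mul n n) (integral_deriv_hermiteFun1_sq n).1 t
  rw [(integral_deriv_hermiteFun1_sq n).2, hu2, integral_hermiteFun1_mul, if_pos rfl] at h
  refine abs_le_of_sq_le_sq (h.trans ?_) (by positivity)
  nlinarith [sq_nonneg (n : ℝ), Nat.cast_nonneg (α := ℝ) n]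

theorem abs_id_mul_mul_hermiteFun1_le {B : ℝ} {k : ℕ} {t : ℝ} {u : ℝ → ℝ}
    (h : ∀ n, |u t * hermiteFun1 n t| ≤ B * ((n : ℝ) + 1) ^ k) (n : ℕ) :
    |t * u t * hermiteFun1 n t| ≤ 2 ^ (k + 1) * B * ((n : ℝ) + 1) ^ (k + 1) := by
  have hB : 0 ≤ B := by simpa using (abs_nonneg _).trans (h 0)
  have hrec : t * u t * hermiteFun1 n t = ladder n * (u t * hermiteFun1 (n - 1) t) +
      ladder (n + 1) * (u t * hermiteFun1 (n + 1) t) := by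
    linear_combination u t * mul_hermiteFun1 n t
  have hneighbour : ∀ l m : ℕ, l ≤ n + 1 → m ≤ n + 1 →
      |ladder l * (u t * hermiteFun1 m t)| ≤ ((n : ℝ) + 1) * (B * (2 * ((n : ℝ) + 1)) ^ k) := by
    intro l m hl hm
    have hl' : ladder l ≤ n + 1 := (ladder_le l).trans (by exact_mod_cast hl)
    have hm' : (m : ℝ) ≤ n + 1 := by exact_mod_cast hm
    rw [abs_mul, abs_of_nonneg (ladder_nonneg l)]
    gcongr
    refine (h m).trans ?_
    gcongr
    linarith [Nat.cast_nonneg (α := ℝ) n]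
  calc |t * u t * hermiteFun1 n t|
      ≤ ((n : ℝ) + 1) * (B * (2 * ((n : ℝ) + 1)) ^ k) +
        ((n : ℝ) + 1) * (B * (2 * ((n : ℝ) + 1)) ^ k) := by
        rw [hrec]
        exact (abs_add_le _ _).trans
          (add_le_add (hneighbour _ _ (by omega) (by omega)) (hneighbour _ _ le_rfl le_rfl))
    _ = 2 ^ (k + 1) * B * ((n : ℝ) + 1) ^ (k + 1) := by rw [mul_pow]; ring

theorem abs_hermiteFun1_le_inv (n : ℕ) (t : ℝ) :
    |hermiteFun1 n t| ≤ 100 * ((n : ℝ) + 1) ^ 3 * (1 + t ^ 2)⁻¹ := by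
  have h₀ := abs_hermiteFun1_le n t
  have h₁ := abs_id_mul_mul_hermiteFun1_le (u := fun _ => 1) (B := 2) (k := 1) (t := t)
    fun n => by simpa using abs_hermiteFun1_le n t
  have h₂ := abs_id_mul_mul_hermiteFun1_le (u := fun t => t * 1) h₁ n
  have hsplit : |hermiteFun1 n t| * (1 + t ^ 2) =
      |hermiteFun1 n t| + |t * (t * 1) * hermiteFun1 n t| := by
    rw [mul_one, abs_mul (t * t), abs_mul_self]
    ring
  have hpow : (n : ℝ) + 1 ≤ (n + 1) ^ 3 := le_self_pow₀ (by simp) (by norm_num)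
  rw [← div_eq_mul_inv, le_div_iff₀ (by positivity), hsplit]
  norm_num only at h₂
  linarith

section HermiteFunctions

/-! ### Tensor products of functions of one variable -/

variable {ι : Type*} [Fintype ι]

/-- The tensor product `⨂ u_i` of functions of one variable, as a function on Euclidean space. -/
def tensor (u : ι → ℝ → ℝ) (x : EuclideanSpace ℝ ι) : ℝ := ∏ i, u i (x i)

theorem contDiff_tensor {n : WithTop ℕ∞} {u : ι → ℝ → ℝ} (hu : ∀ i, ContDiff ℝ n (u i)) :
    ContDiff ℝ n (tensor u) :=
  contDiff_prod fun i _ => (hu i).comp (by fun_prop)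

theorem continuous_tensor {u : ι → ℝ → ℝ} (hu : ∀ i, Continuous (u i)) : Continuous (tensor u) :=
  continuous_finsetProd _ fun i _ => (hu i).comp (by fun_prop)

theorem integrable_tensor {u : ι → ℝ → ℝ} (hu : ∀ i, Integrable (u i)) :
    Integrable (tensor u) :=
  (PiLp.volume_preserving_ofLp ι).integrable_comp_of_integrable
    (Integrable.fintype_prod_dep (μ := fun _ : ι => (volume : Measure ℝ)) hu)

theorem integral_tensor (u : ι → ℝ → ℝ) : ∫ x, tensor u x = ∏ i, ∫ t, u i t := by
  rw [← integral_fintype_prod_volume_eq_prod]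
  exact (PiLp.volume_preserving_ofLp ι).integral_comp
    (MeasurableEquiv.toLp 2 (ι → ℝ)).symm.measurableEmbedding (fun x : ι → ℝ => ∏ i, u i (x i))

section Update

variable [DecidableEq ι]

theorem tensor_eq_mul (u : ι → ℝ → ℝ) (i : ι) (x : EuclideanSpace ℝ ι) :
    tensor u x = u i (x i) * ∏ j ∈ Finset.univ.erase i, u j (x j) :=
  (Finset.mul_prod_erase _ _ (Finset.mem_univ i)).symm

theorem tensor_update (u : ι → ℝ → ℝ) (i : ι) (v : ℝ → ℝ) (x : EuclideanSpace ℝ ι) :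
    tensor (Function.update u i v) x = v (x i) * ∏ j ∈ Finset.univ.erase i, u j (x j) := by
  rw [tensor_eq_mul _ i, Function.update_self]
  congr 1
  refine Finset.prod_congr rfl fun j hj => ?_
  rw [Function.update_of_ne (Finset.ne_of_mem_erase hj)]

theorem hasFDerivAt_tensor {u : ι → ℝ → ℝ} (hu : ∀ i, Differentiable ℝ (u i))
    (x : EuclideanSpace ℝ ι) :
    HasFDerivAt (tensor u) (∑ i, tensor (Function.update u i (deriv (u i))) x •
      (EuclideanSpace.proj i : EuclideanSpace ℝ ι →L[ℝ] ℝ)) x := by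
  have hasFDerivAt_factor : ∀ i ∈ Finset.univ,
      HasFDerivAt (fun x : EuclideanSpace ℝ ι => u i (x i))
        (deriv (u i) (x i) • (EuclideanSpace.proj i : EuclideanSpace ℝ ι →L[ℝ] ℝ)) x :=
    fun i _ => (hu i (x i)).hasDerivAt.comp_hasFDerivAt x
      (EuclideanSpace.proj i : EuclideanSpace ℝ ι →L[ℝ] ℝ).hasFDerivAt
  refine (HasFDerivAt.finsetProd hasFDerivAt_factor).congr_fderiv ?_
  refine Finset.sum_congr rfl fun i _ => ?_
  rw [smul_smul, tensor_update, mul_comm]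

theorem fderiv_tensor_single {u : ι → ℝ → ℝ} (hu : ∀ i, Differentiable ℝ (u i))
    (x : EuclideanSpace ℝ ι) (i : ι) :
    fderiv ℝ (tensor u) x (EuclideanSpace.single i 1) =
      tensor (Function.update u i (deriv (u i))) x := by
  rw [(hasFDerivAt_tensor hu x).fderiv]
  simp

theorem laplacian_eq_sum_fderiv {F : Type*} [NormedAddCommGroup F] [NormedSpace ℝ F]
    {f : EuclideanSpace ℝ ι → F} (hf : ContDiff ℝ 2 f) (x : EuclideanSpace ℝ ι) :
    Laplacian.laplacian f x = ∑ i, fderiv ℝ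
      (fun y => fderiv ℝ f y (EuclideanSpace.single i 1)) x (EuclideanSpace.single i 1) := by
  rw [InnerProductSpace.laplacian_eq_iteratedFDeriv_orthonormalBasis f
    (EuclideanSpace.basisFun ι ℝ)]
  refine Finset.sum_congr rfl fun i _ => ?_
  have hd : DifferentiableAt ℝ (fderiv ℝ f) x :=
    ((hf.fderiv_right (m := 1) (by norm_num)).differentiable (by norm_num)) x
  rw [iteratedFDeriv_two_apply, fderiv_clm_apply hd (differentiableAt_const _)]
  simp

theorem laplacian_tensor {u : ι → ℝ → ℝ} (hu : ∀ i, ContDiff ℝ 2 (u i))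
    (x : EuclideanSpace ℝ ι) :
    Laplacian.laplacian (tensor u) x =
      ∑ i, tensor (Function.update u i (deriv (deriv (u i)))) x := by
  rw [laplacian_eq_sum_fderiv (contDiff_tensor hu)]
  refine Finset.sum_congr rfl fun i _ => ?_
  have hd : ∀ j, Differentiable ℝ (u j) := fun j => (hu j).differentiable (by norm_num)
  have hd' : ∀ j, Differentiable ℝ (Function.update u i (deriv (u i)) j) := by
    intro j
    rcases eq_or_ne j i with rfl | hj
    · rw [Function.update_self]
      exact (hu j).differentiable_deriv_two
    · rw [Function.update_of_ne hj]
      exact hd j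
  rw [funext fun y => fderiv_tensor_single hd y i, fderiv_tensor_single hd']
  simp

end Update

/-! ### Hermite functions on Euclidean space -/

/-- The length `|α|` of a multi-index, as a real number. -/
abbrev len (α : ι → ℕ) : ℝ := ((∑ i, α i : ℕ) : ℝ)

/-- The eigenvalue `2|α| + n` of the harmonic oscillator on `ℝⁿ` at the Hermite function `h_α`. -/
def eigenvalue (α : ι → ℕ) : ℝ := 2 * len α + Fintype.card ι

theorem len_nonneg (α : ι → ℕ) : 0 ≤ len α := Nat.cast_nonneg _

theorem coord_le_len (α : ι → ℕ) (i : ι) : (α i : ℝ) ≤ len α := by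
  exact_mod_cast Finset.single_le_sum (fun j _ => Nat.zero_le (α j)) (Finset.mem_univ i)

theorem len_update_le [DecidableEq ι] (α : ι → ℕ) (i : ι) {n : ℕ} (hn : n ≤ α i + 1) :
    len (Function.update α i n) ≤ len α + 1 := by
  have h : ∑ j, Function.update α i n j ≤ ∑ j, α j + 1 := by
    rw [Finset.sum_update_of_mem (Finset.mem_univ i),
      ← Finset.add_sum_erase _ α (Finset.mem_univ i), Finset.sdiff_singleton_eq_erase]
    omega
  exact_mod_cast h

theorem eigenvalue_nonneg (α : ι → ℕ) : 0 ≤ eigenvalue α := by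
  unfold eigenvalue
  positivity

theorem eigenvalue_le (α : ι → ℕ) : eigenvalue α ≤ (2 + Fintype.card ι) * (len α + 1) := by
  have hl := len_nonneg α
  have : (0 : ℝ) ≤ Fintype.card ι := Nat.cast_nonneg _
  unfold eigenvalue
  nlinarith

theorem hermiteFun_eq_tensor (α : ι → ℕ) :
    hermiteFun α = tensor fun i => hermiteFun1 (α i) := rfl

theorem contDiff_hermiteFun (α : ι → ℕ) : ContDiff ℝ ∞ (hermiteFun α) :=
  contDiff_tensor fun _ => contDiff_hermiteFun1 _

theorem continuous_hermiteFun (α : ι → ℕ) : Continuous (hermiteFun α) :=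
  (contDiff_hermiteFun α).continuous

theorem integral_hermiteFun_mul_self (α : ι → ℕ) :
    ∫ x, hermiteFun α x * hermiteFun α x = 1 := by
  simp only [hermiteFun, ← Finset.prod_mul_distrib]
  refine (integral_tensor fun i t => hermiteFun1 (α i) t * hermiteFun1 (α i) t).trans ?_
  simp [integral_hermiteFun1_mul]

theorem integral_hermiteFun_mul_of_ne {α β : ι → ℕ} (h : α ≠ β) :
    ∫ x, hermiteFun α x * hermiteFun β x = 0 := by
  simp only [hermiteFun, ← Finset.prod_mul_distrib]
  refine (integral_tensor fun i t => hermiteFun1 (α i) t * hermiteFun1 (β i) t).trans ?_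
  obtain ⟨i, hi⟩ := Function.ne_iff.1 h
  exact Finset.prod_eq_zero (Finset.mem_univ i) (by rw [integral_hermiteFun1_mul, if_neg hi])

theorem laplacian_hermiteFun (α : ι → ℕ) (x : EuclideanSpace ℝ ι) :
    Laplacian.laplacian (hermiteFun α) x =
      (‖x‖ ^ 2 - eigenvalue α) * hermiteFun α x := by
  classical
  rw [hermiteFun_eq_tensor,
    laplacian_tensor fun i => contDiff_infty.1 (contDiff_hermiteFun1 (α i)) 2]
  have eigen_factor : ∀ i, tensor (Function.update (fun i => hermiteFun1 (α i)) i
      (deriv (deriv (hermiteFun1 (α i))))) x =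
      (x i ^ 2 - (2 * (α i : ℝ) + 1)) * tensor (fun i => hermiteFun1 (α i)) x := by
    intro i
    rw [tensor_update, tensor_eq_mul _ i, deriv_deriv_hermiteFun1]
    ring
  rw [Finset.sum_congr rfl fun i _ => eigen_factor i, ← Finset.sum_mul,
    EuclideanSpace.norm_sq_eq]
  congr 1
  rw [Finset.sum_sub_distrib, Finset.sum_add_distrib, ← Finset.mul_sum]
  simp [eigenvalue]

section Ladder

variable [DecidableEq ι]

theorem hermiteFun_update (α : ι → ℕ) (i : ι) (n : ℕ) (x : EuclideanSpace ℝ ι) :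
    hermiteFun (Function.update α i n) x =
      hermiteFun1 n (x i) * ∏ j ∈ Finset.univ.erase i, hermiteFun1 (α j) (x j) := by
  rw [← tensor_update (fun j => hermiteFun1 (α j)), hermiteFun_eq_tensor]
  congr 1
  ext1 j
  rcases eq_or_ne j i with rfl | hj
  · simp only [Function.update_self]
  · simp only [Function.update_of_ne hj]

theorem coord_mul_hermiteFun (α : ι → ℕ) (i : ι) (x : EuclideanSpace ℝ ι) :
    x i * hermiteFun α x =
      ladder (α i) * hermiteFun (Function.update α i (α i - 1)) x +
        ladder (α i + 1) * hermiteFun (Function.update α i (α i + 1)) x := by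
  rw [hermiteFun_update, hermiteFun_update, hermiteFun_eq_tensor, tensor_eq_mul _ i,
    ← mul_assoc, mul_hermiteFun1]
  ring

theorem fderiv_hermiteFun (α : ι → ℕ) :
    fderiv ℝ (hermiteFun α) = fun x => ∑ i,
      (ladder (α i) * hermiteFun (Function.update α i (α i - 1)) x -
        ladder (α i + 1) * hermiteFun (Function.update α i (α i + 1)) x) •
      (EuclideanSpace.proj i : EuclideanSpace ℝ ι →L[ℝ] ℝ) := by
  ext1 x
  rw [hermiteFun_eq_tensor, (hasFDerivAt_tensor (fun i =>
    (contDiff_hermiteFun1 (α i)).differentiable (by norm_num)) x).fderiv]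
  refine Finset.sum_congr rfl fun i _ => ?_
  congr 1
  rw [tensor_update, hermiteFun_update, hermiteFun_update, deriv_hermiteFun1]
  ring

end Ladder

/-! ### Decay of Hermite functions -/

/-- The weight `∏ (1 + x_i²)⁻¹`, which is integrable and bounded and dominates every Hermite
function up to a constant. -/
def weight (x : EuclideanSpace ℝ ι) : ℝ := ∏ i, (1 + x i ^ 2)⁻¹

/-- A constant of polynomial growth in `α` with `|h_α| ≤ hermiteBound α * weight`. -/
def hermiteBound (α : ι → ℕ) : ℝ := ∏ i, (100 * ((α i : ℝ) + 1) ^ 3)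

theorem weight_pos (x : EuclideanSpace ℝ ι) : 0 < weight x :=
  Finset.prod_pos fun i _ => by positivity

theorem weight_le_one (x : EuclideanSpace ℝ ι) : weight x ≤ 1 :=
  Finset.prod_le_one (fun i _ => by positivity) fun i _ =>
    inv_le_one_of_one_le₀ (by nlinarith [sq_nonneg (x i)])

theorem continuous_weight : Continuous (weight : EuclideanSpace ℝ ι → ℝ) :=
  continuous_tensor (u := fun _ t => (1 + t ^ 2)⁻¹) fun _ =>
    Continuous.inv₀ (by fun_prop) fun t => by positivity

theorem integrable_weight : Integrable (weight : EuclideanSpace ℝ ι → ℝ) :=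
  integrable_tensor fun _ => integrable_inv_one_add_sq

theorem hermiteBound_pos (α : ι → ℕ) : 0 < hermiteBound α :=
  Finset.prod_pos fun i _ => by positivity

theorem hermiteBound_le (α : ι → ℕ) :
    hermiteBound α ≤ 100 ^ Fintype.card ι * (len α + 1) ^ (3 * Fintype.card ι) := by
  calc hermiteBound α ≤ ∏ _i : ι, (100 * (len α + 1) ^ 3) := by
        refine Finset.prod_le_prod (fun i _ => by positivity) fun i _ => ?_
        gcongr
        exact coord_le_len α i
    _ = _ := by rw [Finset.prod_const, mul_pow, ← pow_mul, Finset.card_univ]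

theorem abs_hermiteFun_le (α : ι → ℕ) (x : EuclideanSpace ℝ ι) :
    |hermiteFun α x| ≤ hermiteBound α * weight x := by
  rw [hermiteFun, hermiteBound, weight, ← Finset.prod_mul_distrib, Finset.abs_prod]
  exact Finset.prod_le_prod (fun i _ => abs_nonneg _) fun i _ => abs_hermiteFun1_le_inv _ _

theorem abs_hermiteFun_le_hermiteBound (α : ι → ℕ) (x : EuclideanSpace ℝ ι) :
    |hermiteFun α x| ≤ hermiteBound α :=
  (abs_hermiteFun_le α x).trans
    (mul_le_of_le_one_right (hermiteBound_pos α).le (weight_le_one x))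

theorem memLp_of_integrable_of_norm_le_one {Ω E : Type*} {mΩ : MeasurableSpace Ω} {μ : Measure Ω}
    [NormedAddCommGroup E] {f : Ω → E} (hf : Integrable f μ) (hb : ∀ᵐ x ∂μ, ‖f x‖ ≤ 1)
    {p : ℝ≥0∞} (hp : 1 ≤ p) : MemLp f p μ := by
  rcases eq_or_ne p ⊤ with rfl | htop
  · exact memLp_top_of_bound hf.1 1 hb
  have hp1 : 1 ≤ p.toReal := by
    rw [← ENNReal.toReal_one]
    exact ENNReal.toReal_mono htop hp
  rw [← integrable_norm_rpow_iff hf.1 (zero_lt_one.trans_le hp).ne' htop]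
  refine hf.norm.mono' (hf.1.norm.aemeasurable.pow_const _).aestronglyMeasurable ?_
  filter_upwards [hb] with x hx
  rw [Real.norm_of_nonneg (by positivity)]
  rcases (norm_nonneg (f x)).eq_or_lt with h0 | h0
  · rw [← h0, Real.zero_rpow (by linarith)]
  · simpa using Real.rpow_le_rpow_of_exponent_ge h0 hx hp1

theorem memLp_weight {p : ℝ≥0∞} (hp : 1 ≤ p) : MemLp (weight : EuclideanSpace ℝ ι → ℝ) p :=
  memLp_of_integrable_of_norm_le_one integrable_weight (.of_forall fun x => by
    rw [Real.norm_eq_abs, abs_of_pos (weight_pos x)]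
    exact weight_le_one x) hp

theorem exists_integral_norm_mul_weight_le {p : ℝ≥0∞} (hp : 1 ≤ p) :
    ∃ W : ℝ, 0 ≤ W ∧ ∀ (g : EuclideanSpace ℝ ι → ℂ), MemLp g p → ∀ B : ℝ, 0 ≤ B →
      eLpNorm g p ≤ ENNReal.ofReal B →
      Integrable (fun x => ‖g x‖ * weight x) ∧ ∫ x, ‖g x‖ * weight x ≤ W * B := by
  have hpq := ENNReal.HolderConjugate.conjExponent hp
  set q := ENNReal.conjExponent p
  have hw := memLp_weight (ι := ι) (ENNReal.HolderConjugate.one_le q p)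
  refine ⟨(eLpNorm (weight : EuclideanSpace ℝ ι → ℝ) q).toReal, ENNReal.toReal_nonneg,
    fun g hg B hB hgB => ?_⟩
  have hI : Integrable (fun x => ‖g x‖ * weight x) := hg.norm.integrable_mul hw
  refine ⟨hI, ?_⟩
  have hölder := eLpNorm_smul_le_mul_eLpNorm (r := 1) (p := p) (q := q) hw.1 hg.norm.1
  rw [eLpNorm_norm] at hölder
  have integral_le : ENNReal.ofReal (∫ x, ‖g x‖ * weight x) ≤
      ENNReal.ofReal B * eLpNorm (weight : EuclideanSpace ℝ ι → ℝ) q := by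
    refine le_trans ?_ (hölder.trans (mul_le_mul_left hgB _))
    rw [eLpNorm_one_eq_lintegral_enorm, ofReal_integral_eq_lintegral_ofReal hI
      (.of_forall fun x => mul_nonneg (norm_nonneg _) (weight_pos x).le)]
    refine lintegral_mono fun x => ?_
    rw [← ofReal_norm]
    exact ENNReal.ofReal_le_ofReal (le_abs_self _)
  rw [← ENNReal.ofReal_toReal hw.2.ne, ← ENNReal.ofReal_mul hB,
    ENNReal.ofReal_le_ofReal_iff (by positivity)] at integral_le
  rwa [mul_comm]

end HermiteFunctions

section HermiteSeries

variable {ι : Type*} [Fintype ι]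

/-! ### Rapidly decreasing Hermite series -/

/-- The operator `z ↦ (z a) dx_i`, through which the derivative of a Hermite function is expressed
by other Hermite functions. -/
def smulCoordForm (i : ι) (a : ℝ) : ℝ →L[ℝ] (EuclideanSpace ℝ ι →L[ℝ] ℝ) :=
  ContinuousLinearMap.toSpanSingleton ℝ (a • (EuclideanSpace.proj i : EuclideanSpace ℝ ι →L[ℝ] ℝ))

theorem norm_smulCoordForm (i : ι) (a : ℝ) :
    ‖smulCoordForm i a‖ = |a| * ‖(EuclideanSpace.proj i : EuclideanSpace ℝ ι →L[ℝ] ℝ)‖ := by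
  rw [smulCoordForm, ContinuousLinearMap.norm_toSpanSingleton, norm_smul, Real.norm_eq_abs]

theorem contDiff_smulCoordForm_comp_hermiteFun (k : ℕ) (i : ι) (a : ℝ) (α : ι → ℕ) :
    ContDiff ℝ k (smulCoordForm i a ∘ hermiteFun α) :=
  (smulCoordForm i a).contDiff.comp (contDiff_infty.1 (contDiff_hermiteFun α) k)

theorem fderiv_hermiteFun_eq_sum_comp [DecidableEq ι] (α : ι → ℕ) :
    fderiv ℝ (hermiteFun α) = fun x => ∑ i,
      (smulCoordForm i (ladder (α i)) ∘ hermiteFun (Function.update α i (α i - 1)) +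
        smulCoordForm i (-ladder (α i + 1)) ∘ hermiteFun (Function.update α i (α i + 1))) x := by
  rw [fderiv_hermiteFun]
  ext1 x
  refine Finset.sum_congr rfl fun i _ => ?_
  simp only [smulCoordForm, Pi.add_apply, Function.comp_apply,
    ContinuousLinearMap.toSpanSingleton_apply, smul_smul, ← add_smul]
  congr 1
  ring

theorem norm_iteratedFDeriv_smulCoordForm_comp_le [DecidableEq ι] {k m : ℕ} {C : ℝ} (hC : 0 ≤ C)
    (h : ∀ (β : ι → ℕ) (x : EuclideanSpace ℝ ι),
      ‖iteratedFDeriv ℝ k (hermiteFun β) x‖ ≤ C * (len β + 1) ^ m)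
    (α : ι → ℕ) (i : ι) {a : ℝ} (ha : |a| ≤ len α + 1) {n : ℕ} (hn : n ≤ α i + 1)
    (x : EuclideanSpace ℝ ι) :
    ‖iteratedFDeriv ℝ k (smulCoordForm i a ∘ hermiteFun (Function.update α i n)) x‖ ≤
      ‖(EuclideanSpace.proj i : EuclideanSpace ℝ ι →L[ℝ] ℝ)‖ *
        (C * 2 ^ m) * (len α + 1) ^ (m + 1) := by
  have hα := len_nonneg α
  have := len_nonneg (Function.update α i n)
  have hlen : len (Function.update α i n) + 1 ≤ 2 * (len α + 1) := by
    linarith [len_update_le α i hn]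
  calc _ ≤ ‖smulCoordForm i a‖ * ‖iteratedFDeriv ℝ k (hermiteFun (Function.update α i n)) x‖ :=
        (smulCoordForm i a).norm_iteratedFDeriv_comp_left
          (contDiff_infty.1 (contDiff_hermiteFun _) k).contDiffAt le_rfl
    _ ≤ (len α + 1) * ‖(EuclideanSpace.proj i : EuclideanSpace ℝ ι →L[ℝ] ℝ)‖ *
          (C * (2 * (len α + 1)) ^ m) := by
        rw [norm_smulCoordForm]
        gcongr
        exact (h _ _).trans (by gcongr)
    _ = _ := by
        rw [mul_pow]
        ring

theorem exists_norm_iteratedFDeriv_hermiteFun_le (ι : Type*) [Fintype ι] (k : ℕ) :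
    ∃ (C : ℝ) (m : ℕ), 0 ≤ C ∧ ∀ (α : ι → ℕ) (x : EuclideanSpace ℝ ι),
      ‖iteratedFDeriv ℝ k (hermiteFun α) x‖ ≤ C * (len α + 1) ^ m := by
  classical
  induction k with
  | zero =>
    refine ⟨100 ^ Fintype.card ι, 3 * Fintype.card ι, by positivity, fun α x => ?_⟩
    rw [norm_iteratedFDeriv_zero]
    exact (abs_hermiteFun_le_hermiteBound α x).trans (hermiteBound_le α)
  | succ k ih =>
    obtain ⟨C, m, hC, h⟩ := ih
    refine ⟨(∑ i, ‖(EuclideanSpace.proj i : EuclideanSpace ℝ ι →L[ℝ] ℝ)‖) * (2 * C * 2 ^ m),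
      m + 1, by positivity, fun α x => ?_⟩
    have hsmooth := contDiff_smulCoordForm_comp_hermiteFun (ι := ι) k
    have hsmooth_add : ∀ i ∈ Finset.univ, ContDiff ℝ k
        (smulCoordForm i (ladder (α i)) ∘ hermiteFun (Function.update α i (α i - 1)) +
          smulCoordForm i (-ladder (α i + 1)) ∘ hermiteFun (Function.update α i (α i + 1))) :=
      fun i _ => (hsmooth _ _ _).add (hsmooth _ _ _)
    rw [← norm_iteratedFDeriv_fderiv, fderiv_hermiteFun_eq_sum_comp,
      iteratedFDeriv_sum hsmooth_add, Finset.sum_apply]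
    refine (norm_sum_le _ _).trans ?_
    rw [Finset.sum_mul, Finset.sum_mul]
    refine Finset.sum_le_sum fun i _ => ?_
    rw [iteratedFDeriv_add_apply (hsmooth _ _ _).contDiffAt (hsmooth _ _ _).contDiffAt]
    have abs_lower_le : |ladder (α i)| ≤ len α + 1 := by
      rw [abs_of_nonneg (ladder_nonneg _)]
      linarith [ladder_le (α i), coord_le_len α i]
    have abs_raise_le : |-ladder (α i + 1)| ≤ len α + 1 := by
      rw [abs_neg, abs_of_nonneg (ladder_nonneg _)]
      refine (ladder_le _).trans ?_
      rw [Nat.cast_add, Nat.cast_one]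
      linarith [coord_le_len α i]
    refine (norm_add_le_of_le
      (norm_iteratedFDeriv_smulCoordForm_comp_le hC h α i abs_lower_le (by omega) x)
      (norm_iteratedFDeriv_smulCoordForm_comp_le hC h α i abs_raise_le le_rfl x)).trans_eq ?_
    ring

/-- Coefficients which are summable against every power of `1 + |α|`; they are the Hermite
coefficients of Schwartz functions. -/
def RapidDecay (c : (ι → ℕ) → ℂ) : Prop :=
  ∀ m : ℕ, Summable fun α => ‖c α‖ * (len α + 1) ^ m

/-- The sum of the Hermite series with coefficients `c`. -/
def hermiteSeries (c : (ι → ℕ) → ℂ) (x : EuclideanSpace ℝ ι) : ℂ :=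
  ∑' α, c α * (hermiteFun α x : ℂ)

theorem norm_hermiteFun_le (α : ι → ℕ) (x : EuclideanSpace ℝ ι) :
    ‖(hermiteFun α x : ℂ)‖ ≤ hermiteBound α * weight x := by
  rw [Complex.norm_real]
  exact abs_hermiteFun_le α x

theorem norm_coeff_mul_hermiteFun_le (c : (ι → ℕ) → ℂ) (α : ι → ℕ) (x : EuclideanSpace ℝ ι) :
    ‖c α * (hermiteFun α x : ℂ)‖ ≤ ‖c α‖ * hermiteBound α * weight x := by
  rw [norm_mul, mul_assoc]
  exact mul_le_mul_of_nonneg_left (norm_hermiteFun_le α x) (norm_nonneg _)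

theorem conj_hermiteSeries (c : (ι → ℕ) → ℂ) (x : EuclideanSpace ℝ ι) :
    starRingEnd ℂ (hermiteSeries c x) = hermiteSeries (fun α => starRingEnd ℂ (c α)) x := by
  rw [hermiteSeries, Complex.conj_tsum]
  simp [hermiteSeries]

variable {c : (ι → ℕ) → ℂ}

theorem RapidDecay.conj (hc : RapidDecay c) : RapidDecay fun α => starRingEnd ℂ (c α) := by
  intro m
  simpa using hc m

theorem RapidDecay.eigenvalue_pow_mul (hc : RapidDecay c) (N : ℕ) :
    RapidDecay fun α => (eigenvalue α ^ N : ℝ) * c α := by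
  intro m
  have hl := len_nonneg (ι := ι)
  refine Summable.of_nonneg_of_le (fun α => by have := hl α; positivity) (fun α => ?_)
    ((hc (N + m)).mul_left ((2 + Fintype.card ι : ℝ) ^ N))
  have := hl α
  have hE := eigenvalue_nonneg α
  rw [norm_mul, Complex.norm_real, Real.norm_of_nonneg (by positivity)]
  calc eigenvalue α ^ N * ‖c α‖ * (len α + 1) ^ m
      ≤ ((2 + Fintype.card ι) * (len α + 1)) ^ N * ‖c α‖ * (len α + 1) ^ m := by
        gcongr
        exact eigenvalue_le α
    _ = _ := by
        rw [mul_pow, pow_add]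
        ring

theorem RapidDecay.summable_mul_hermiteBound (hc : RapidDecay c) :
    Summable fun α => ‖c α‖ * hermiteBound α := by
  refine Summable.of_nonneg_of_le (fun α => by have := hermiteBound_pos α; positivity) (fun α => ?_)
    ((hc (3 * Fintype.card ι)).mul_left (100 ^ Fintype.card ι))
  calc ‖c α‖ * hermiteBound α
      ≤ ‖c α‖ * (100 ^ Fintype.card ι * (len α + 1) ^ (3 * Fintype.card ι)) := by
        gcongr
        exact hermiteBound_le α
    _ = _ := by ring

theorem RapidDecay.isHermiteSeries (hc : RapidDecay c) : IsHermiteSeries c (hermiteSeries c) :=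
  fun x => (Summable.of_norm_bounded (hc.summable_mul_hermiteBound.mul_right (weight x))
    fun α => norm_coeff_mul_hermiteFun_le c α x).hasSum

theorem RapidDecay.norm_hermiteSeries_le (hc : RapidDecay c) (x : EuclideanSpace ℝ ι) :
    ‖hermiteSeries c x‖ ≤ (∑' α, ‖c α‖ * hermiteBound α) * weight x := by
  rw [← tsum_mul_right]
  exact tsum_of_norm_bounded (hc.summable_mul_hermiteBound.mul_right _).hasSum
    fun α => norm_coeff_mul_hermiteFun_le c α x

theorem RapidDecay.contDiff_hermiteSeries (hc : RapidDecay c) : ContDiff ℝ ∞ (hermiteSeries c) := by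
  choose C m _ h using exists_norm_iteratedFDeriv_hermiteFun_le ι
  let L : ℂ → ℝ →L[ℝ] ℂ := fun z => ContinuousLinearMap.toSpanSingleton ℝ z
  have term_eq_comp : ∀ α, (fun x => c α * (hermiteFun α x : ℂ)) = L (c α) ∘ hermiteFun α := by
    intro α
    ext x
    simp [L, mul_comm]
  refine contDiff_tsum (v := fun k α => ‖c α‖ * (C k * (len α + 1) ^ m k)) (fun α => ?_)
    (fun k _ => ?_) (fun k α x _ => ?_)
  · rw [term_eq_comp]
    exact (L (c α)).contDiff.comp (contDiff_hermiteFun α)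
  · refine ((hc (m k)).mul_left (C k)).congr fun α => ?_
    ring
  · rw [term_eq_comp]
    refine ((L (c α)).norm_iteratedFDeriv_comp_left
      (contDiff_infty.1 (contDiff_hermiteFun α) k).contDiffAt le_rfl).trans ?_
    rw [ContinuousLinearMap.norm_toSpanSingleton]
    gcongr
    exact h k α x

theorem RapidDecay.continuous_hermiteSeries (hc : RapidDecay c) : Continuous (hermiteSeries c) :=
  hc.contDiff_hermiteSeries.continuous

theorem RapidDecay.memLp (hc : RapidDecay c) {p : ℝ≥0∞} (hp : 1 ≤ p) :
    MemLp (hermiteSeries c) p :=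
  (memLp_weight hp).of_le_mul hc.continuous_hermiteSeries.aestronglyMeasurable
    (c := ∑' α, ‖c α‖ * hermiteBound α) (.of_forall fun x => by
      rw [Real.norm_of_nonneg (weight_pos x).le]
      exact hc.norm_hermiteSeries_le x)

theorem RapidDecay.eLpNorm_le (hc : RapidDecay c) {p : ℝ≥0∞} {B : ℝ}
    (hB : ∑' α, ‖c α‖ * hermiteBound α ≤ B) :
    eLpNorm (hermiteSeries c) p ≤
      ENNReal.ofReal B * eLpNorm (weight : EuclideanSpace ℝ ι → ℝ) p := by
  refine eLpNorm_le_mul_eLpNorm_of_ae_le_mul (.of_forall fun x => ?_) p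
  rw [Real.norm_of_nonneg (weight_pos x).le]
  exact (hc.norm_hermiteSeries_le x).trans (by have := weight_pos x; gcongr)

/-! ### Integration against Hermite series -/

/-- Measurable functions which are integrable against the weight, and hence against every Hermite
function. -/
def WeightIntegrable (g : EuclideanSpace ℝ ι → ℂ) : Prop :=
  AEStronglyMeasurable g ∧ Integrable fun x => ‖g x‖ * weight x

variable {g : EuclideanSpace ℝ ι → ℂ}

theorem WeightIntegrable.sub {f : EuclideanSpace ℝ ι → ℂ} (hf : WeightIntegrable f)
    (hg : WeightIntegrable g) : WeightIntegrable (f - g) := by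
  refine ⟨hf.1.sub hg.1, (hf.2.add hg.2).mono' ?_ (.of_forall fun x => ?_)⟩
  · exact (hf.1.sub hg.1).norm.mul continuous_weight.aestronglyMeasurable
  · have := weight_pos x
    rw [Real.norm_of_nonneg (by positivity), Pi.add_apply, ← add_mul]
    gcongr
    exact norm_sub_le _ _

theorem weightIntegrable_of_norm_le (hg : AEStronglyMeasurable g) {C : ℝ} (hC : ∀ x, ‖g x‖ ≤ C) :
    WeightIntegrable g := by
  refine ⟨hg, (integrable_weight.const_mul C).mono'
    (hg.norm.mul continuous_weight.aestronglyMeasurable) (.of_forall fun x => ?_)⟩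
  have := weight_pos x
  rw [Real.norm_of_nonneg (by positivity)]
  gcongr
  exact hC x

theorem RapidDecay.weightIntegrable (hc : RapidDecay c) : WeightIntegrable (hermiteSeries c) := by
  refine weightIntegrable_of_norm_le hc.continuous_hermiteSeries.aestronglyMeasurable
    (C := ∑' α, ‖c α‖ * hermiteBound α) fun x => ?_
  refine (hc.norm_hermiteSeries_le x).trans (mul_le_of_le_one_right ?_ (weight_le_one x))
  exact tsum_nonneg fun α => mul_nonneg (norm_nonneg _) (hermiteBound_pos α).le

theorem aestronglyMeasurable_hermiteFun (α : ι → ℕ) :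
    AEStronglyMeasurable (fun x => (hermiteFun α x : ℂ)) :=
  (Complex.continuous_ofReal.comp (continuous_hermiteFun α)).aestronglyMeasurable

theorem weightIntegrable_hermiteFun (α : ι → ℕ) :
    WeightIntegrable fun x => (hermiteFun α x : ℂ) :=
  weightIntegrable_of_norm_le (aestronglyMeasurable_hermiteFun α) (C := hermiteBound α) fun x => by
    rw [Complex.norm_real]
    exact abs_hermiteFun_le_hermiteBound α x

theorem WeightIntegrable.integrable_mul {u : EuclideanSpace ℝ ι → ℂ} (hg : WeightIntegrable g)
    (hu : AEStronglyMeasurable u) {C : ℝ} (hC : ∀ x, ‖u x‖ ≤ C * weight x) :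
    Integrable fun x => g x * u x := by
  refine (hg.2.const_mul C).mono' (hg.1.mul hu) (.of_forall fun x => ?_)
  rw [norm_mul]
  calc ‖g x‖ * ‖u x‖ ≤ ‖g x‖ * (C * weight x) := by gcongr; exact hC x
    _ = _ := by ring

theorem WeightIntegrable.integrable_mul_hermiteFun (hg : WeightIntegrable g) (α : ι → ℕ) :
    Integrable fun x => g x * (hermiteFun α x : ℂ) :=
  hg.integrable_mul (aestronglyMeasurable_hermiteFun α) (norm_hermiteFun_le α)

/-- The Hermite coefficient `∫ g h_α` of a function `g`. -/
def hermiteCoeff (g : EuclideanSpace ℝ ι → ℂ) (α : ι → ℕ) : ℂ :=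
  ∫ x, g x * (hermiteFun α x : ℂ)

theorem WeightIntegrable.norm_hermiteCoeff_le (hg : WeightIntegrable g) (α : ι → ℕ) :
    ‖hermiteCoeff g α‖ ≤ hermiteBound α * ∫ x, ‖g x‖ * weight x := by
  rw [hermiteCoeff, ← integral_const_mul]
  refine norm_integral_le_of_norm_le (hg.2.const_mul _) (.of_forall fun x => ?_)
  rw [norm_mul]
  calc ‖g x‖ * ‖(hermiteFun α x : ℂ)‖ ≤ ‖g x‖ * (hermiteBound α * weight x) := by
        gcongr; exact norm_hermiteFun_le α x
    _ = _ := by ring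

theorem RapidDecay.hasSum_integral_mul (hc : RapidDecay c) (hg : WeightIntegrable g) :
    HasSum (fun α => c α * hermiteCoeff g α) (∫ x, g x * hermiteSeries c x) := by
  have term_eq : (fun α => c α * hermiteCoeff g α) =
      fun α => ∫ x, g x * (c α * (hermiteFun α x : ℂ)) := by
    ext α
    rw [hermiteCoeff, ← integral_const_mul]
    congr 1
    ext x
    ring
  rw [term_eq]
  refine hasSum_integral_of_dominated_convergence
    (fun α x => ‖c α‖ * hermiteBound α * (‖g x‖ * weight x))
    (fun α => hg.1.mul ((aestronglyMeasurable_hermiteFun α).const_mul _))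
    (fun α => .of_forall fun x => ?_)
    (.of_forall fun x => hc.summable_mul_hermiteBound.mul_right _)
    (by simp_rw [tsum_mul_right]; exact hg.2.const_mul _)
    (.of_forall fun x => (hc.isHermiteSeries x).mul_left _)
  rw [norm_mul]
  calc _ ≤ ‖g x‖ * (‖c α‖ * hermiteBound α * weight x) := by
        gcongr; exact norm_coeff_mul_hermiteFun_le c α x
    _ = _ := by ring

theorem RapidDecay.hermiteCoeff_hermiteSeries (hc : RapidDecay c) :
    hermiteCoeff (hermiteSeries c) = c := by
  ext β
  have hermiteCoeff_hermiteFun (α : ι → ℕ) : hermiteCoeff (fun x => (hermiteFun β x : ℂ)) α =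
      ((∫ x, hermiteFun β x * hermiteFun α x : ℝ) : ℂ) := by
    simp only [hermiteCoeff, ← Complex.ofReal_mul, integral_complex_ofReal]
  have hsum := hc.hasSum_integral_mul (weightIntegrable_hermiteFun β)
  simp only [hermiteCoeff_hermiteFun] at hsum
  simp only [hermiteCoeff, mul_comm (hermiteSeries c _)]
  refine hsum.unique ?_
  convert hasSum_single β fun α hα => ?_ using 1
  · rw [integral_hermiteFun_mul_self, Complex.ofReal_one, mul_one]
  · rw [integral_hermiteFun_mul_of_ne hα.symm, Complex.ofReal_zero, mul_zero]

theorem RapidDecay.hasSum_mul_conj {b : (ι → ℕ) → ℂ} (hc : RapidDecay c) (hb : RapidDecay b) :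
    HasSum (fun α => c α * starRingEnd ℂ (b α))
      (∫ x, hermiteSeries c x * starRingEnd ℂ (hermiteSeries b x)) := by
  have h := hb.conj.hasSum_integral_mul hc.weightIntegrable
  simp only [hc.hermiteCoeff_hermiteSeries, ← conj_hermiteSeries] at h
  simpa only [mul_comm] using h

end HermiteSeries

section HarmonicOscillator

variable {ι : Type*} [Fintype ι]

/-! ### The harmonic oscillator on test functions -/

theorem contDiff_fderiv_apply {φ : EuclideanSpace ℝ ι → ℂ} (hφ : ContDiff ℝ ∞ φ)
    (v : EuclideanSpace ℝ ι) : ContDiff ℝ ∞ fun x => fderiv ℝ φ x v :=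
  (hφ.fderiv_right (m := ∞) (by simp)).clm_apply contDiff_const

theorem contDiff_laplacian {φ : EuclideanSpace ℝ ι → ℂ} (hφ : ContDiff ℝ ∞ φ) :
    ContDiff ℝ ∞ (Laplacian.laplacian φ) := by
  classical
  rw [funext fun x => laplacian_eq_sum_fderiv (contDiff_infty.1 hφ 2) x]
  exact ContDiff.sum fun i _ => contDiff_fderiv_apply (contDiff_fderiv_apply hφ _) _

theorem contDiff_harmOsc {φ : EuclideanSpace ℝ ι → ℂ} (hφ : ContDiff ℝ ∞ φ) :
    ContDiff ℝ ∞ (harmOsc φ) :=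
  ((Complex.ofRealCLM.contDiff.comp (contDiff_norm_sq ℝ)).mul hφ).sub (contDiff_laplacian hφ)

theorem hasCompactSupport_laplacian {φ : EuclideanSpace ℝ ι → ℂ}
    (hc : HasCompactSupport φ) : HasCompactSupport (Laplacian.laplacian φ) := by
  refine hc.mono' fun x hx => ?_
  by_contra hxs
  refine hx ?_
  have eventually_zero : φ =ᶠ[nhds x] fun _ => 0 := notMem_tsupport_iff_eventuallyEq.1 hxs
  rw [(InnerProductSpace.laplacian_congr_nhds eventually_zero).eq_of_nhds]
  simp

theorem hasCompactSupport_harmOsc {φ : EuclideanSpace ℝ ι → ℂ}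
    (hc : HasCompactSupport φ) : HasCompactSupport (harmOsc φ) :=
  HasCompactSupport.sub hc.mul_left (hasCompactSupport_laplacian hc)

theorem harmOsc_iterate {φ : EuclideanSpace ℝ ι → ℂ} (hφ : ContDiff ℝ ∞ φ)
    (hc : HasCompactSupport φ) (N : ℕ) :
    ContDiff ℝ ∞ (harmOsc^[N] φ) ∧ HasCompactSupport (harmOsc^[N] φ) := by
  induction N with
  | zero => exact ⟨hφ, hc⟩
  | succ N ih =>
    rw [Function.iterate_succ_apply']
    exact ⟨contDiff_harmOsc ih.1, hasCompactSupport_harmOsc ih.2⟩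

theorem integral_mul_fderiv_eq_neg {u φ : EuclideanSpace ℝ ι → ℂ} (hu : ContDiff ℝ ∞ u)
    (hφ : ContDiff ℝ ∞ φ) (hc : HasCompactSupport φ) (v : EuclideanSpace ℝ ι) :
    ∫ x, u x * fderiv ℝ φ x v = -∫ x, fderiv ℝ u x v * φ x := by
  refine integral_mul_fderiv_eq_neg_fderiv_mul_of_integrable ?_ ?_ ?_
    (fun x _ => hu.differentiable (by norm_num) x) (fun x _ => hφ.differentiable (by norm_num) x)
  · exact ((contDiff_fderiv_apply hu v).continuous.mul
      hφ.continuous).integrable_of_hasCompactSupport hc.mul_left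
  · exact (hu.continuous.mul
      (contDiff_fderiv_apply hφ v).continuous).integrable_of_hasCompactSupport
      (hc.fderiv_apply ℝ v).mul_left
  · exact (hu.continuous.mul hφ.continuous).integrable_of_hasCompactSupport hc.mul_left

theorem integral_mul_laplacian {u φ : EuclideanSpace ℝ ι → ℂ} (hu : ContDiff ℝ ∞ u)
    (hφ : ContDiff ℝ ∞ φ) (hc : HasCompactSupport φ) :
    ∫ x, u x * Laplacian.laplacian φ x = ∫ x, Laplacian.laplacian u x * φ x := by
  classical
  simp only [laplacian_eq_sum_fderiv (contDiff_infty.1 hu 2),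
    laplacian_eq_sum_fderiv (contDiff_infty.1 hφ 2), Finset.mul_sum, Finset.sum_mul]
  have contDiff_partial {f : EuclideanSpace ℝ ι → ℂ} (hf : ContDiff ℝ ∞ f) (i : ι) :=
    contDiff_fderiv_apply hf (EuclideanSpace.single i 1)
  rw [integral_finsetSum, integral_finsetSum]
  · refine Finset.sum_congr rfl fun i _ => ?_
    rw [integral_mul_fderiv_eq_neg hu (contDiff_partial hφ i) (hc.fderiv_apply ℝ _),
      integral_mul_fderiv_eq_neg (contDiff_partial hu i) hφ hc, neg_neg]
  · intro i _
    exact ((contDiff_partial (contDiff_partial hu i) i).continuous.mul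
      hφ.continuous).integrable_of_hasCompactSupport hc.mul_left
  · intro i _
    exact (hu.continuous.mul
      (contDiff_partial (contDiff_partial hφ i) i).continuous).integrable_of_hasCompactSupport
      ((hc.fderiv_apply ℝ _).fderiv_apply ℝ _).mul_left

theorem integral_mul_harmOsc {u φ : EuclideanSpace ℝ ι → ℂ} (hu : ContDiff ℝ ∞ u)
    (hφ : ContDiff ℝ ∞ φ) (hc : HasCompactSupport φ) :
    ∫ x, u x * harmOsc φ x = ∫ x, harmOsc u x * φ x := by
  have integrable_potential : Integrable fun x => u x * ((‖x‖ ^ 2 : ℝ) * φ x) :=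
    (hu.continuous.mul ((show Continuous fun x : EuclideanSpace ℝ ι => ((‖x‖ ^ 2 : ℝ) : ℂ) by
      fun_prop).mul hφ.continuous)).integrable_of_hasCompactSupport hc.mul_left.mul_left
  calc ∫ x, u x * harmOsc φ x
      = ∫ x, (u x * ((‖x‖ ^ 2 : ℝ) * φ x) - u x * Laplacian.laplacian φ x) := by
        simp only [harmOsc, mul_sub]
    _ = ∫ x, (u x * ((‖x‖ ^ 2 : ℝ) * φ x) - Laplacian.laplacian u x * φ x) := by
        rw [integral_sub integrable_potential, integral_sub integrable_potential,
          integral_mul_laplacian hu hφ hc]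
        · exact ((contDiff_laplacian hu).continuous.mul
            hφ.continuous).integrable_of_hasCompactSupport hc.mul_left
        · exact (hu.continuous.mul
            (contDiff_laplacian hφ).continuous).integrable_of_hasCompactSupport
            (hasCompactSupport_laplacian hc).mul_left
    _ = ∫ x, harmOsc u x * φ x := by
        refine integral_congr_ae (.of_forall fun x => ?_)
        simp only [harmOsc]
        ring

theorem harmOsc_ofReal {f : EuclideanSpace ℝ ι → ℝ} (hf : ContDiff ℝ ∞ f)
    (x : EuclideanSpace ℝ ι) :
    harmOsc (fun y => (f y : ℂ)) x = ((‖x‖ ^ 2 * f x - Laplacian.laplacian f x : ℝ) : ℂ) := by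
  have laplacian_ofReal : Laplacian.laplacian (fun y => (f y : ℂ)) x =
      Complex.ofRealCLM (Laplacian.laplacian f x) :=
    (contDiff_infty.1 hf 2).contDiffAt.laplacian_CLM_comp_left (l := Complex.ofRealCLM)
  rw [harmOsc, laplacian_ofReal]
  simp

theorem contDiff_hermiteFun_complex (α : ι → ℕ) :
    ContDiff ℝ ∞ fun x : EuclideanSpace ℝ ι => (hermiteFun α x : ℂ) :=
  Complex.ofRealCLM.contDiff.comp (contDiff_hermiteFun α)

theorem harmOsc_hermiteFun (α : ι → ℕ) (x : EuclideanSpace ℝ ι) :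
    harmOsc (fun y => (hermiteFun α y : ℂ)) x =
      (eigenvalue α : ℂ) * (hermiteFun α x : ℂ) := by
  rw [harmOsc_ofReal (contDiff_hermiteFun α), laplacian_hermiteFun, ← Complex.ofReal_mul]
  congr 1
  ring

theorem hermiteCoeff_harmOsc (α : ι → ℕ) {φ : EuclideanSpace ℝ ι → ℂ}
    (hφ : ContDiff ℝ ∞ φ) (hc : HasCompactSupport φ) :
    hermiteCoeff (harmOsc φ) α = eigenvalue α * hermiteCoeff φ α := by
  simp only [hermiteCoeff, mul_comm _ (hermiteFun α _ : ℂ)]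
  rw [integral_mul_harmOsc (contDiff_hermiteFun_complex α) hφ hc, ← integral_const_mul]
  simp only [harmOsc_hermiteFun, mul_assoc]

theorem hermiteCoeff_harmOsc_iterate (α : ι → ℕ) {φ : EuclideanSpace ℝ ι → ℂ}
    (hφ : ContDiff ℝ ∞ φ) (hc : HasCompactSupport φ) (N : ℕ) :
    hermiteCoeff (harmOsc^[N] φ) α = (eigenvalue α ^ N : ℝ) * hermiteCoeff φ α := by
  induction N with
  | zero => simp
  | succ N ih =>
    obtain ⟨hN, hcN⟩ := harmOsc_iterate hφ hc N
    rw [Function.iterate_succ_apply', hermiteCoeff_harmOsc α hN hcN, ih, pow_succ]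
    push_cast
    ring

theorem weightIntegrable_of_hasCompactSupport {φ : EuclideanSpace ℝ ι → ℂ} (hφ : Continuous φ)
    (hc : HasCompactSupport φ) : WeightIntegrable φ := by
  obtain ⟨C, hC⟩ := hc.exists_bound_of_continuous hφ
  exact weightIntegrable_of_norm_le hφ.aestronglyMeasurable hC

theorem RapidDecay.isHarmOscPow {c : (ι → ℕ) → ℂ} (hc : RapidDecay c) (N : ℕ) :
    IsHarmOscPow N (hermiteSeries c) (hermiteSeries fun α => (eigenvalue α ^ N : ℝ) * c α) := by
  intro φ hφ hs
  obtain ⟨hN, hsN⟩ := harmOsc_iterate hφ hs N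
  have hasSum_left := (hc.eigenvalue_pow_mul N).hasSum_integral_mul
    (weightIntegrable_of_hasCompactSupport hφ.continuous hs)
  have hasSum_right := hc.hasSum_integral_mul
    (weightIntegrable_of_hasCompactSupport hN.continuous hsN)
  simp only [hermiteCoeff_harmOsc_iterate _ hφ hs N] at hasSum_right
  simp only [mul_comm (hermiteSeries _ _)]
  refine hasSum_left.unique (hasSum_right.congr_fun fun α => ?_)
  ring

/-! ### Cutting off Hermite functions -/

/-- A smooth cutoff function on the line, equal to `1` on `[-1, 1]` and supported in `[-2, 2]`. -/
def cutoff : ContDiffBump (0 : ℝ) := ⟨1, 2, by norm_num, by norm_num⟩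

/-- The Hermite function of order `n` cut off outside `[-2 (R + 1), 2 (R + 1)]`. -/
def cutHermite (n R : ℕ) (t : ℝ) : ℝ := cutoff (t * ((R : ℝ) + 1)⁻¹) * hermiteFun1 n t

theorem contDiff_cutHermite (n R : ℕ) : ContDiff ℝ ∞ (cutHermite n R) :=
  (cutoff.contDiff.comp (contDiff_id.mul contDiff_const)).mul (contDiff_hermiteFun1 n)

theorem cutHermite_eq_zero {n R : ℕ} {t : ℝ} (ht : 2 * ((R : ℝ) + 1) ≤ |t|) :
    cutHermite n R t = 0 := by
  have hR : (0 : ℝ) < R + 1 := by positivity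
  rw [cutHermite, cutoff.zero_of_le_dist, zero_mul]
  change (2 : ℝ) ≤ _
  rw [Real.dist_eq, sub_zero, abs_mul, abs_inv, abs_of_pos hR, ← div_eq_mul_inv, le_div_iff₀ hR]
  exact ht

theorem cutHermite_eventuallyEq (n : ℕ) {R : ℕ} {t : ℝ} (ht : |t| < (R : ℝ) + 1) :
    cutHermite n R =ᶠ[nhds t] hermiteFun1 n := by
  have hR : (0 : ℝ) < R + 1 := by positivity
  filter_upwards [(continuous_abs.tendsto t).eventually_lt_const ht] with y hy
  rw [cutHermite, cutoff.one_of_mem_closedBall, one_mul]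
  rw [Metric.mem_closedBall, Real.dist_eq, sub_zero, abs_mul, abs_inv, abs_of_pos hR,
    ← div_eq_mul_inv, div_le_iff₀ hR]
  change _ ≤ (1 : ℝ) * _
  linarith

theorem deriv_deriv_comp_mul_const_mul {χ f : ℝ → ℝ} (hχ : ContDiff ℝ 2 χ) (hf : ContDiff ℝ 2 f)
    (ε t : ℝ) :
    deriv (deriv fun t => χ (t * ε) * f t) t =
      deriv (deriv χ) (t * ε) * ε ^ 2 * f t + 2 * (deriv χ (t * ε) * ε) * deriv f t +
        χ (t * ε) * deriv (deriv f) t := by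
  have hasDerivAt_dilation {g : ℝ → ℝ} (hg : Differentiable ℝ g) (t : ℝ) :
      HasDerivAt (fun t => g (t * ε)) (deriv g (t * ε) * ε) t :=
    (hg (t * ε)).hasDerivAt.comp t (by simpa using (hasDerivAt_id t).mul_const ε)
  have dχ : Differentiable ℝ χ := hχ.differentiable (by norm_num)
  have df : Differentiable ℝ f := hf.differentiable (by norm_num)
  have deriv_mul : (deriv fun t => χ (t * ε) * f t) =
      fun t => deriv χ (t * ε) * ε * f t + χ (t * ε) * deriv f t :=
    funext fun t => ((hasDerivAt_dilation dχ t).fun_mul (df t).hasDerivAt).deriv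
  rw [deriv_mul, ((((hasDerivAt_dilation hχ.differentiable_deriv_two t).mul_const ε).fun_mul
    (df t).hasDerivAt).fun_add ((hasDerivAt_dilation dχ t).fun_mul
      (hf.differentiable_deriv_two t).hasDerivAt)).deriv]
  ring

theorem exists_abs_cutoff_derivs_le : ∃ D : ℝ, 1 ≤ D ∧ ∀ t, |cutoff t| ≤ D ∧
    |deriv cutoff t| ≤ D ∧ |deriv (deriv cutoff) t| ≤ D := by
  have smooth : ContDiff ℝ ∞ (cutoff : ℝ → ℝ) := cutoff.contDiff
  have smooth' : ContDiff ℝ ∞ (deriv (cutoff : ℝ → ℝ)) := (contDiff_infty_iff_deriv.1 smooth).2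
  have smooth'' := (contDiff_infty_iff_deriv.1 smooth').2
  obtain ⟨D₁, hD₁⟩ := cutoff.hasCompactSupport.deriv.exists_bound_of_continuous smooth'.continuous
  obtain ⟨D₂, hD₂⟩ := cutoff.hasCompactSupport.deriv.deriv.exists_bound_of_continuous
    smooth''.continuous
  refine ⟨max 1 (max D₁ D₂), le_max_left _ _, fun t => ⟨?_, ?_, ?_⟩⟩
  · rw [abs_of_nonneg cutoff.nonneg]
    exact cutoff.le_one.trans (le_max_left _ _)
  · exact (hD₁ t).trans ((le_max_left _ _).trans (le_max_right _ _))
  · exact (hD₂ t).trans ((le_max_right _ _).trans (le_max_right _ _))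

theorem exists_abs_deriv_hermiteFun1_le (n : ℕ) :
    ∃ B : ℝ, ∀ t, |deriv (hermiteFun1 n) t| ≤ B * (1 + t ^ 2)⁻¹ := by
  have lower_nonneg := ladder_nonneg n
  have raise_nonneg := ladder_nonneg (n + 1)
  refine ⟨ladder n * (100 * ((n - 1 : ℕ) + 1) ^ 3) +
    ladder (n + 1) * (100 * ((n + 1 : ℕ) + 1) ^ 3), fun t => ?_⟩
  rw [deriv_hermiteFun1]
  refine (abs_sub _ _).trans ?_
  rw [abs_mul, abs_mul, abs_of_nonneg lower_nonneg, abs_of_nonneg raise_nonneg, add_mul,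
    mul_assoc (ladder n), mul_assoc (ladder (n + 1))]
  exact add_le_add (mul_le_mul_of_nonneg_left (abs_hermiteFun1_le_inv _ t) lower_nonneg)
    (mul_le_mul_of_nonneg_left (abs_hermiteFun1_le_inv _ t) raise_nonneg)

theorem sq_mul_cutHermite_sub_deriv_deriv (n : ℕ) (R : ℕ) (t : ℝ) :
    t ^ 2 * cutHermite n R t - deriv (deriv (cutHermite n R)) t =
      cutoff (t * ((R : ℝ) + 1)⁻¹) * ((2 * n + 1) * hermiteFun1 n t) -
      2 * (deriv cutoff (t * ((R : ℝ) + 1)⁻¹) * ((R : ℝ) + 1)⁻¹) * deriv (hermiteFun1 n) t -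
      deriv (deriv cutoff) (t * ((R : ℝ) + 1)⁻¹) * ((R : ℝ) + 1)⁻¹ ^ 2 * hermiteFun1 n t := by
  have deriv_deriv_eq := deriv_deriv_comp_mul_const_mul cutoff.contDiff
    (contDiff_infty.1 (contDiff_hermiteFun1 n) 2) ((R : ℝ) + 1)⁻¹ t
  have cutHermite_eq :
      cutHermite n R = fun t => cutoff (t * ((R : ℝ) + 1)⁻¹) * hermiteFun1 n t := rfl
  rw [cutHermite_eq, deriv_deriv_eq, deriv_deriv_hermiteFun1]
  ring

theorem exists_cutHermite_bounds (n : ℕ) : ∃ C : ℝ, ∀ R t,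
    |cutHermite n R t| ≤ C * (1 + t ^ 2)⁻¹ ∧
    |t ^ 2 * cutHermite n R t - deriv (deriv (cutHermite n R)) t| ≤ C * (1 + t ^ 2)⁻¹ := by
  obtain ⟨D, hD1, hD⟩ := exists_abs_cutoff_derivs_le
  obtain ⟨B, hB⟩ := exists_abs_deriv_hermiteFun1_le n
  set A : ℝ := 100 * ((n : ℝ) + 1) ^ 3
  have hB0 : 0 ≤ B := by simpa using (abs_nonneg _).trans (hB 0)
  refine ⟨D * ((2 * n + 1) * A) + 2 * (D * 1) * B + D * 1 ^ 2 * A, fun R t => ?_⟩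
  have hA : |hermiteFun1 n t| ≤ A * (1 + t ^ 2)⁻¹ := abs_hermiteFun1_le_inv n t
  have hBt := hB t
  set ε := ((R : ℝ) + 1)⁻¹
  have hε0 : 0 ≤ ε := by positivity
  have hε1 : ε ≤ 1 := inv_le_one_of_one_le₀ (by linarith [(Nat.cast_nonneg R : (0 : ℝ) ≤ R)])
  obtain ⟨hχ, hχ', hχ''⟩ := hD (t * ε)
  constructor
  · rw [cutHermite, abs_mul]
    calc _ ≤ D * (A * (1 + t ^ 2)⁻¹) := by gcongr
      _ ≤ _ := by
        rw [← mul_assoc]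
        gcongr
        have : 0 ≤ 2 * n * (D * A) + 2 * (D * 1) * B + D * 1 ^ 2 * A := by positivity
        linarith
  · rw [sq_mul_cutHermite_sub_deriv_deriv]
    have abs_main_le : |cutoff (t * ε) * ((2 * n + 1) * hermiteFun1 n t)| ≤
        D * ((2 * n + 1) * (A * (1 + t ^ 2)⁻¹)) := by
      rw [abs_mul, abs_mul, abs_of_nonneg (by positivity : (0 : ℝ) ≤ 2 * n + 1)]
      gcongr
    have abs_cross_le : |2 * (deriv cutoff (t * ε) * ε) * deriv (hermiteFun1 n) t| ≤
        2 * (D * 1) * (B * (1 + t ^ 2)⁻¹) := by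
      rw [abs_mul, abs_mul, abs_mul, abs_of_nonneg hε0, abs_of_pos (two_pos : (0 : ℝ) < 2)]
      gcongr
    have abs_last_le : |deriv (deriv cutoff) (t * ε) * ε ^ 2 * hermiteFun1 n t| ≤
        D * 1 ^ 2 * (A * (1 + t ^ 2)⁻¹) := by
      rw [abs_mul, abs_mul, abs_pow, abs_of_nonneg hε0]
      gcongr
    refine (abs_sub _ _).trans
      ((add_le_add ((abs_sub _ _).trans (add_le_add abs_main_le abs_cross_le))
        abs_last_le).trans_eq ?_)
    ring

theorem abs_tensor_le {u : ι → ℝ → ℝ} {C : ℝ} (h : ∀ i t, |u i t| ≤ C * (1 + t ^ 2)⁻¹)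
    (x : EuclideanSpace ℝ ι) : |tensor u x| ≤ C ^ Fintype.card ι * weight x := by
  rw [tensor, Finset.abs_prod, weight]
  refine (Finset.prod_le_prod (fun i _ => abs_nonneg _) fun i _ => h i (x i)).trans_eq ?_
  rw [Finset.prod_mul_distrib, Finset.prod_const, Finset.card_univ]

theorem harmOsc_tensor [DecidableEq ι] {u : ι → ℝ → ℝ} (hu : ∀ i, ContDiff ℝ ∞ (u i))
    (x : EuclideanSpace ℝ ι) :
    harmOsc (fun y => (tensor u y : ℂ)) x = ((∑ i, tensor (Function.update u i
      fun t => t ^ 2 * u i t - deriv (deriv (u i)) t) x : ℝ) : ℂ) := by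
  rw [harmOsc_ofReal (contDiff_tensor hu),
    laplacian_tensor fun i => contDiff_infty.1 (hu i) 2, EuclideanSpace.norm_sq_eq]
  congr 1
  rw [Finset.sum_mul, ← Finset.sum_sub_distrib]
  refine Finset.sum_congr rfl fun i _ => ?_
  rw [tensor_update, tensor_update, tensor_eq_mul u i, Real.norm_eq_abs, sq_abs]
  ring

/-- The Hermite function `h_α` with each factor cut off at distance of order `R`, as a test
function. -/
def cutHermiteFun (α : ι → ℕ) (R : ℕ) (x : EuclideanSpace ℝ ι) : ℂ :=
  (tensor (fun i => cutHermite (α i) R) x : ℂ)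

theorem contDiff_cutHermiteFun (α : ι → ℕ) (R : ℕ) : ContDiff ℝ ∞ (cutHermiteFun α R) :=
  Complex.ofRealCLM.contDiff.comp (contDiff_tensor fun i => contDiff_cutHermite (α i) R)

theorem hasCompactSupport_cutHermiteFun (α : ι → ℕ) (R : ℕ) :
    HasCompactSupport (cutHermiteFun α R) := by
  have bounded_cube :
      Bornology.IsBounded {x : EuclideanSpace ℝ ι | ∀ i, |x i| ≤ 2 * ((R : ℝ) + 1)} := by
    rw [isBounded_iff_forall_norm_le]
    refine ⟨√(∑ _i : ι, (2 * ((R : ℝ) + 1)) ^ 2), fun x hx => ?_⟩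
    rw [EuclideanSpace.norm_eq]
    refine Real.sqrt_le_sqrt (Finset.sum_le_sum fun i _ => ?_)
    gcongr
    exact hx i
  refine HasCompactSupport.of_support_subset_isCompact bounded_cube.isCompact_closure
    (fun x hx => subset_closure fun i => ?_)
  by_contra! h
  refine hx ?_
  rw [cutHermiteFun, tensor, Finset.prod_eq_zero (Finset.mem_univ i) (cutHermite_eq_zero h.le),
    Complex.ofReal_zero]

theorem eventually_cutHermiteFun_eventuallyEq (α : ι → ℕ) (x : EuclideanSpace ℝ ι) :
    ∀ᶠ R : ℕ in Filter.atTop, cutHermiteFun α R =ᶠ[nhds x] fun y => (hermiteFun α y : ℂ) := by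
  filter_upwards [tendsto_natCast_atTop_atTop.eventually_gt_atTop ‖x‖] with R hR
  have factor_eq (i : ι) : ∀ᶠ y : EuclideanSpace ℝ ι in nhds x,
      cutHermite (α i) R (y i) = hermiteFun1 (α i) (y i) := by
    have hcoord : ContinuousAt (fun y : EuclideanSpace ℝ ι => y i) x := by fun_prop
    refine hcoord.eventually (cutHermite_eventuallyEq (α i) ?_)
    have := PiLp.norm_apply_le x i
    rw [Real.norm_eq_abs] at this
    linarith
  filter_upwards [Filter.eventually_all.2 factor_eq] with y hy
  simp only [cutHermiteFun, tensor, hermiteFun, hy]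

theorem exists_norm_cutHermiteFun_le (α : ι → ℕ) : ∃ C : ℝ, ∀ R x,
    ‖cutHermiteFun α R x‖ ≤ C * weight x ∧ ‖harmOsc (cutHermiteFun α R) x‖ ≤ C * weight x := by
  classical
  choose C hC using exists_cutHermite_bounds
  have hC0 : ∀ n, 0 ≤ C n := fun n => by simpa using (abs_nonneg _).trans (hC n 0 0).1
  set D := ∑ i, C (α i)
  have hCD : ∀ i, C (α i) ≤ D := fun i =>
    Finset.single_le_sum (fun j _ => hC0 (α j)) (Finset.mem_univ i)
  have hD0 : 0 ≤ D := Finset.sum_nonneg fun i _ => hC0 (α i)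
  refine ⟨(Fintype.card ι + 1) * D ^ Fintype.card ι, fun R x => ?_⟩
  have := weight_pos x
  have abs_factor_le (i : ι) (t : ℝ) : |cutHermite (α i) R t| ≤ D * (1 + t ^ 2)⁻¹ :=
    (hC (α i) R t).1.trans (by gcongr; exact hCD i)
  constructor
  · rw [cutHermiteFun, Complex.norm_real]
    refine (abs_tensor_le abs_factor_le x).trans ?_
    gcongr
    exact le_mul_of_one_le_left (by positivity) (by simp)
  · have abs_term_le (i : ι) : ‖tensor (Function.update (fun i => cutHermite (α i) R) i fun t =>
        t ^ 2 * cutHermite (α i) R t - deriv (deriv (cutHermite (α i) R)) t) x‖ ≤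
        D ^ Fintype.card ι * weight x := by
      refine abs_tensor_le (fun j t => ?_) x
      rcases eq_or_ne j i with rfl | hj
      · rw [Function.update_self]
        exact (hC (α j) R t).2.trans (by gcongr; exact hCD j)
      · rw [Function.update_of_ne hj]
        exact abs_factor_le j t
    unfold cutHermiteFun
    rw [harmOsc_tensor fun i => contDiff_cutHermite (α i) R, Complex.norm_real]
    refine (norm_sum_le_of_le _ fun i _ => abs_term_le i).trans ?_
    rw [Finset.sum_const, Finset.card_univ, nsmul_eq_mul, ← mul_assoc]
    gcongr
    linarith

theorem WeightIntegrable.tendsto_integral_mul {g : EuclideanSpace ℝ ι → ℂ}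
    (hg : WeightIntegrable g) {u : ℕ → EuclideanSpace ℝ ι → ℂ} (hu : ∀ R, Continuous (u R))
    {C : ℝ} (hC : ∀ R x, ‖u R x‖ ≤ C * weight x) {v : EuclideanSpace ℝ ι → ℂ}
    (huv : ∀ x, ∀ᶠ R in Filter.atTop, u R x = v x) :
    Filter.Tendsto (fun R => ∫ x, g x * u R x) Filter.atTop (nhds (∫ x, g x * v x)) := by
  refine tendsto_integral_of_dominated_convergence (fun x => C * (‖g x‖ * weight x))
    (fun R => hg.1.mul (hu R).aestronglyMeasurable) (hg.2.const_mul _)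
    (fun R => .of_forall fun x => ?_) (.of_forall fun x => ?_)
  · rw [norm_mul]
    calc ‖g x‖ * ‖u R x‖ ≤ ‖g x‖ * (C * weight x) := by gcongr; exact hC R x
      _ = _ := by ring
  · refine tendsto_const_nhds.congr' ?_
    filter_upwards [huv x] with R hR
    rw [hR]

theorem hermiteCoeff_of_weak {g g' : EuclideanSpace ℝ ι → ℂ}
    (hg : WeightIntegrable g) (hg' : WeightIntegrable g')
    (h : ∀ φ : EuclideanSpace ℝ ι → ℂ, ContDiff ℝ ∞ φ → HasCompactSupport φ →
      ∫ x, g' x * φ x = ∫ x, g x * harmOsc φ x) (α : ι → ℕ) :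
    hermiteCoeff g' α = eigenvalue α * hermiteCoeff g α := by
  obtain ⟨C, hC⟩ := exists_norm_cutHermiteFun_le α
  have smooth := contDiff_cutHermiteFun α
  have tendsto_left := hg'.tendsto_integral_mul (fun R => (smooth R).continuous)
    (fun R x => (hC R x).1) (v := fun x => (hermiteFun α x : ℂ)) fun x => by
      filter_upwards [eventually_cutHermiteFun_eventuallyEq α x] with R hR
      exact hR.eq_of_nhds
  have tendsto_right := hg.tendsto_integral_mul (fun R => (contDiff_harmOsc (smooth R)).continuous)
    (fun R x => (hC R x).2) (v := harmOsc fun y => (hermiteFun α y : ℂ)) fun x => by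
      filter_upwards [eventually_cutHermiteFun_eventuallyEq α x] with R hR
      rw [harmOsc, harmOsc, hR.eq_of_nhds,
        (InnerProductSpace.laplacian_congr_nhds hR).eq_of_nhds]
  have limits_eq : ∫ x, g' x * (hermiteFun α x : ℂ) =
      ∫ x, g x * harmOsc (fun y => (hermiteFun α y : ℂ)) x :=
    tendsto_nhds_unique tendsto_left (tendsto_right.congr fun R =>
      (h _ (smooth R) (hasCompactSupport_cutHermiteFun α R)).symm)
  rw [hermiteCoeff, limits_eq, hermiteCoeff, ← integral_const_mul]
  refine integral_congr_ae (.of_forall fun x => ?_)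
  simp only [harmOsc_hermiteFun]
  ring

end HarmonicOscillator

section Completeness

variable {ι : Type*} [Fintype ι]

/-! ### Completeness of the Hermite functions -/

open scoped FourierTransform in
theorem ae_eq_zero_of_fourier_eq_zero {V : Type*} [NormedAddCommGroup V] [InnerProductSpace ℝ V]
    [FiniteDimensional ℝ V] [MeasurableSpace V] [BorelSpace V] {G : V → ℂ} (hG : Integrable G)
    (h : ∀ ξ, 𝓕 G ξ = 0) : G =ᵐ[volume] 0 := by
  refine ae_eq_zero_of_integral_contDiff_smul_eq_zero hG.locallyIntegrable fun ψ hψ hc => ?_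
  have hcC : HasCompactSupport (Complex.ofRealCLM ∘ ψ) := hc.comp_left rfl
  have hψC : ContDiff ℝ ∞ (Complex.ofRealCLM ∘ ψ) := by fun_prop
  set Ψ : SchwartzMap V ℂ := hcC.toSchwartzMap hψC
  set Φ : SchwartzMap V ℂ := 𝓕⁻ Ψ with hΦ
  have fourier_Φ (x : V) : 𝓕 ⇑Φ x = ψ x := by
    rw [← SchwartzMap.fourier_coe, hΦ, FourierTransform.fourier_fourierInv_eq]
    rfl
  have integral_flip : ∫ x, 𝓕 ⇑Φ x * G x = ∫ x, Φ x * 𝓕 G x := by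
    simpa using! (VectorFourier.integral_fourierIntegral_smul_eq_flip (L := innerₗ V)
      (μ := volume) (ν := volume) (e := Real.fourierChar) (f := ⇑Φ) (g := G)
      Real.continuous_fourierChar continuous_inner Φ.integrable hG)
  calc ∫ x, ψ x • G x = ∫ x, 𝓕 ⇑Φ x * G x := by
        simp only [fourier_Φ, Complex.real_smul]
    _ = 0 := by simp only [integral_flip, h, mul_zero, integral_zero]

/-- The complex span of the Hermite functions; it contains every polynomial times `h_0`. -/
def hermiteSpan (ι : Type*) [Fintype ι] : Submodule ℂ (EuclideanSpace ℝ ι → ℂ) :=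
  Submodule.span ℂ (Set.range fun (α : ι → ℕ) x => (hermiteFun α x : ℂ))

theorem hermiteFun_mem_hermiteSpan (α : ι → ℕ) :
    (fun x => (hermiteFun α x : ℂ)) ∈ hermiteSpan ι :=
  Submodule.subset_span ⟨α, rfl⟩

theorem coord_mul_mem_hermiteSpan {u : EuclideanSpace ℝ ι → ℂ} (hu : u ∈ hermiteSpan ι) (i : ι) :
    (fun x => (x i : ℂ) * u x) ∈ hermiteSpan ι := by
  classical
  induction hu using Submodule.span_induction with
  | mem u hu =>
    obtain ⟨α, rfl⟩ := hu
    have ladder_expansion : (fun x : EuclideanSpace ℝ ι => (x i : ℂ) * (hermiteFun α x : ℂ)) =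
        (ladder (α i) : ℂ) • (fun x => (hermiteFun (Function.update α i (α i - 1)) x : ℂ)) +
        (ladder (α i + 1) : ℂ) • (fun x => (hermiteFun (Function.update α i (α i + 1)) x : ℂ)) := by
      ext x
      simp only [Pi.add_apply, Pi.smul_apply, smul_eq_mul]
      exact_mod_cast coord_mul_hermiteFun α i x
    rw [ladder_expansion]
    exact add_mem (Submodule.smul_mem _ _ (hermiteFun_mem_hermiteSpan _))
      (Submodule.smul_mem _ _ (hermiteFun_mem_hermiteSpan _))
  | zero =>
    convert (hermiteSpan ι).zero_mem using 1
    ext x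
    simp
  | add u v _ _ hu hv =>
    convert add_mem hu hv using 1
    ext x
    simp only [Pi.add_apply]
    ring
  | smul a u _ hu =>
    convert Submodule.smul_mem _ a hu using 1
    ext x
    simp only [Pi.smul_apply, smul_eq_mul]
    ring

theorem inner_pow_mul_mem_hermiteSpan (ξ : EuclideanSpace ℝ ι) (k : ℕ) :
    (fun x => ((inner ℝ x ξ : ℝ) : ℂ) ^ k * (hermiteFun (0 : ι → ℕ) x : ℂ)) ∈ hermiteSpan ι := by
  induction k with
  | zero => simpa using hermiteFun_mem_hermiteSpan (0 : ι → ℕ)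
  | succ k ih =>
    have coord_expansion :
        (fun x => ((inner ℝ x ξ : ℝ) : ℂ) ^ (k + 1) * (hermiteFun (0 : ι → ℕ) x : ℂ)) =
          ∑ i, (ξ i : ℂ) • (fun x : EuclideanSpace ℝ ι => (x i : ℂ) *
            (((inner ℝ x ξ : ℝ) : ℂ) ^ k * (hermiteFun (0 : ι → ℕ) x : ℂ))) := by
      ext x
      have inner_eq_sum : ((inner ℝ x ξ : ℝ) : ℂ) = ∑ i, (ξ i : ℂ) * (x i : ℂ) := by
        rw [PiLp.inner_apply]
        push_cast
        refine Finset.sum_congr rfl fun i _ => ?_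
        simp
      rw [Finset.sum_apply]
      simp only [Pi.smul_apply, smul_eq_mul]
      rw [pow_succ', mul_assoc]
      nth_rewrite 1 [inner_eq_sum]
      rw [Finset.sum_mul]
      exact Finset.sum_congr rfl fun i _ => by ring
    rw [coord_expansion]
    exact Submodule.sum_mem _ fun i _ => Submodule.smul_mem _ _ (coord_mul_mem_hermiteSpan ih i)

theorem hermiteFun1_zero_pos (t : ℝ) : 0 < hermiteFun1 0 t := by
  rw [hermiteFun1_zero]
  positivity

theorem hermiteFun_zero_pos (x : EuclideanSpace ℝ ι) : 0 < hermiteFun (0 : ι → ℕ) x :=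
  Finset.prod_pos fun i _ => hermiteFun1_zero_pos (x i)

theorem exp_abs_mul_hermiteFun1_zero_le (a t : ℝ) :
    Real.exp |a * t| * hermiteFun1 0 t ≤ 4 * Real.exp (a ^ 2) * (1 + t ^ 2)⁻¹ := by
  have pi_rpow_ge : (1 : ℝ) ≤ Real.pi ^ (1 / 4 : ℝ) :=
    Real.one_le_rpow (by linarith [Real.pi_gt_three]) (by norm_num)
  have hermite_le_gaussian : hermiteFun1 0 t ≤ Real.exp (-t ^ 2 / 2) := by
    rw [hermiteFun1_zero]
    exact div_le_self (Real.exp_pos _).le pi_rpow_ge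
  rw [← div_eq_mul_inv, le_div_iff₀ (by positivity)]
  have poly_le_exp : 1 + t ^ 2 ≤ 4 * Real.exp (t ^ 2 / 4) := by
    have := Real.add_one_le_exp (t ^ 2 / 4)
    linarith
  have abs_mul_le : |a * t| ≤ a ^ 2 + t ^ 2 / 4 := by
    rw [abs_le]
    constructor <;> nlinarith [sq_nonneg (a - t / 2), sq_nonneg (a + t / 2)]
  have := hermiteFun1_zero_pos t
  calc Real.exp |a * t| * hermiteFun1 0 t * (1 + t ^ 2)
      ≤ Real.exp (a ^ 2 + t ^ 2 / 4) * Real.exp (-t ^ 2 / 2) * (4 * Real.exp (t ^ 2 / 4)) := by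
        gcongr
    _ = 4 * Real.exp (a ^ 2 + t ^ 2 / 4 + -t ^ 2 / 2 + t ^ 2 / 4) := by
        simp only [Real.exp_add]
        ring
    _ = _ := by
        congr 2
        ring

theorem exists_exp_inner_mul_hermiteFun_zero_le (ξ : EuclideanSpace ℝ ι) :
    ∃ C : ℝ, ∀ x, Real.exp |inner ℝ x ξ| * hermiteFun (0 : ι → ℕ) x ≤ C * weight x := by
  refine ⟨∏ i, (4 * Real.exp (ξ i ^ 2)), fun x => ?_⟩
  have abs_inner_le : |inner ℝ x ξ| ≤ ∑ i, |ξ i * x i| := by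
    rw [PiLp.inner_apply]
    refine (Finset.abs_sum_le_sum_abs _ _).trans (Finset.sum_le_sum fun i _ => ?_)
    simp
  rw [weight, ← Finset.prod_mul_distrib]
  calc _ ≤ Real.exp (∑ i, |ξ i * x i|) * hermiteFun (0 : ι → ℕ) x := by
        gcongr
        exact (hermiteFun_zero_pos x).le
    _ = ∏ i, (Real.exp |ξ i * x i| * hermiteFun1 0 (x i)) := by
        rw [Real.exp_sum, Finset.prod_mul_distrib]
        rfl
    _ ≤ _ := Finset.prod_le_prod
        (fun i _ => mul_nonneg (Real.exp_pos _).le (hermiteFun1_zero_pos _).le)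
        fun i _ => exp_abs_mul_hermiteFun1_zero_le _ _

theorem integral_mul_eq_zero_of_mem_hermiteSpan {g : EuclideanSpace ℝ ι → ℂ}
    (hg : WeightIntegrable g) (h : ∀ α : ι → ℕ, hermiteCoeff g α = 0)
    {u : EuclideanSpace ℝ ι → ℂ} (hu : u ∈ hermiteSpan ι) :
    Integrable (fun x => g x * u x) ∧ ∫ x, g x * u x = 0 := by
  induction hu using Submodule.span_induction with
  | mem u hu =>
    obtain ⟨α, rfl⟩ := hu
    exact ⟨hg.integrable_mul_hermiteFun α, h α⟩
  | zero => simp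
  | add u v _ _ hu hv =>
    simp only [Pi.add_apply, mul_add]
    exact ⟨hu.1.add hv.1, by rw [integral_add hu.1 hv.1, hu.2, hv.2, add_zero]⟩
  | smul a u _ hu =>
    simp only [Pi.smul_apply, smul_eq_mul, mul_left_comm _ a]
    exact ⟨hu.1.const_mul a, by rw [integral_const_mul, hu.2, mul_zero]⟩

theorem WeightIntegrable.integrable_norm_mul_exp_inner {g : EuclideanSpace ℝ ι → ℂ}
    (hg : WeightIntegrable g) (ξ : EuclideanSpace ℝ ι) :
    Integrable fun x => Real.exp |inner ℝ x ξ| * (‖g x‖ * hermiteFun (0 : ι → ℕ) x) := by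
  obtain ⟨C, hC⟩ := exists_exp_inner_mul_hermiteFun_zero_le ξ
  refine (hg.2.const_mul C).mono' ?_ (.of_forall fun x => ?_)
  · refine AEStronglyMeasurable.mul ?_ (hg.1.norm.mul
      (continuous_hermiteFun _).aestronglyMeasurable)
    exact Continuous.aestronglyMeasurable (by fun_prop)
  · have := hermiteFun_zero_pos x
    rw [Real.norm_eq_abs, abs_of_nonneg (by positivity)]
    calc _ = ‖g x‖ * (Real.exp |inner ℝ x ξ| * hermiteFun (0 : ι → ℕ) x) := by ring
      _ ≤ ‖g x‖ * (C * weight x) := mul_le_mul_of_nonneg_left (hC x) (norm_nonneg _)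
      _ = _ := by ring

theorem hasSum_pow_div_factorial_complex (z : ℂ) :
    HasSum (fun k : ℕ => z ^ k / k.factorial) (Complex.exp z) := by
  rw [Complex.exp_eq_exp_ℂ]
  exact NormedSpace.expSeries_div_hasSum_exp z

theorem hasSum_pow_div_factorial_real (r : ℝ) :
    HasSum (fun k : ℕ => r ^ k / k.factorial) (Real.exp r) := by
  rw [Real.exp_eq_exp_ℝ]
  exact NormedSpace.expSeries_div_hasSum_exp r

theorem integral_exp_mul_hermiteFun_zero_eq_zero {g : EuclideanSpace ℝ ι → ℂ}
    (hg : WeightIntegrable g) (h : ∀ α : ι → ℕ, hermiteCoeff g α = 0)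
    (ξ : EuclideanSpace ℝ ι) :
    ∫ x, Complex.exp (((inner ℝ x ξ : ℝ) : ℂ) * Complex.I) *
      (g x * (hermiteFun (0 : ι → ℕ) x : ℂ)) = 0 := by
  have term_integral_eq_zero (k : ℕ) :
      ∫ x, (((inner ℝ x ξ : ℝ) : ℂ) * Complex.I) ^ k / k.factorial *
        (g x * (hermiteFun (0 : ι → ℕ) x : ℂ)) = 0 := by
    calc _ = ∫ x, (Complex.I ^ k / k.factorial) * (g x * (((inner ℝ x ξ : ℝ) : ℂ) ^ k *
          (hermiteFun (0 : ι → ℕ) x : ℂ))) := by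
          congr 1 with x
          rw [mul_pow]
          ring
      _ = 0 := by
          rw [integral_const_mul, (integral_mul_eq_zero_of_mem_hermiteSpan hg h
            (inner_pow_mul_mem_hermiteSpan ξ k)).2, mul_zero]
  have hasSum_integral := hasSum_integral_of_dominated_convergence (μ := volume)
    (F := fun (k : ℕ) x => (((inner ℝ x ξ : ℝ) : ℂ) * Complex.I) ^ k / k.factorial *
      (g x * (hermiteFun (0 : ι → ℕ) x : ℂ)))
    (f := fun x => Complex.exp (((inner ℝ x ξ : ℝ) : ℂ) * Complex.I) *
      (g x * (hermiteFun (0 : ι → ℕ) x : ℂ)))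
    (fun k x => |inner ℝ x ξ| ^ k / k.factorial * (‖g x‖ * hermiteFun (0 : ι → ℕ) x))
    (fun k => ?_) (fun k => .of_forall fun x => ?_)
    (.of_forall fun x => (hasSum_pow_div_factorial_real _).summable.mul_right _) ?_
    (.of_forall fun x => (hasSum_pow_div_factorial_complex _).mul_right _)
  · simp only [term_integral_eq_zero] at hasSum_integral
    exact hasSum_integral.unique hasSum_zero
  · refine AEStronglyMeasurable.mul ?_ (hg.1.mul (aestronglyMeasurable_hermiteFun _))
    exact Continuous.aestronglyMeasurable (by fun_prop)
  · simp [abs_of_pos (hermiteFun_zero_pos x)]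
  · simp_rw [tsum_mul_right, (hasSum_pow_div_factorial_real _).tsum_eq]
    exact hg.integrable_norm_mul_exp_inner ξ

theorem ae_eq_zero_of_hermiteCoeff_eq_zero {g : EuclideanSpace ℝ ι → ℂ}
    (hg : WeightIntegrable g) (h : ∀ α : ι → ℕ, hermiteCoeff g α = 0) :
    g =ᵐ[volume] 0 := by
  have mul_hermite_ae_zero := ae_eq_zero_of_fourier_eq_zero (hg.integrable_mul_hermiteFun 0)
      fun ξ => by
    rw [Real.fourier_eq', ← integral_exp_mul_hermiteFun_zero_eq_zero hg h ((-2 * Real.pi) • ξ)]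
    congr 1 with x
    rw [inner_smul_right]
    rfl
  filter_upwards [mul_hermite_ae_zero] with x hx
  simpa [(hermiteFun_zero_pos x).ne'] using hx

theorem ae_eq_hermiteSeries {g : EuclideanSpace ℝ ι → ℂ} (hg : WeightIntegrable g)
    (hc : RapidDecay (hermiteCoeff g)) : g =ᵐ[volume] hermiteSeries (hermiteCoeff g) := by
  have sub_ae_zero := ae_eq_zero_of_hermiteCoeff_eq_zero
      (hg.sub hc.weightIntegrable) fun α => by
    simp only [hermiteCoeff, Pi.sub_apply, sub_mul]
    rw [integral_sub (hg.integrable_mul_hermiteFun α)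
      (hc.weightIntegrable.integrable_mul_hermiteFun α), ← hermiteCoeff, ← hermiteCoeff,
      hc.hermiteCoeff_hermiteSeries, sub_self]
  filter_upwards [sub_ae_zero] with x hx
  exact sub_eq_zero.1 hx

end Completeness

section StretchedExponentials

variable {ι : Type*} [Fintype ι]

/-! ### Stretched exponentials -/

theorem exists_pow_mul_exp_neg_rpow_le {r a : ℝ} (hr : 0 < r) (ha : 0 < a) (k : ℕ) :
    ∃ C : ℝ, ∀ x : ℝ, 0 ≤ x → (x + 1) ^ k * Real.exp (-r * x ^ a) ≤ C := by
  obtain ⟨n, hn⟩ := exists_nat_ge ((k : ℝ) / a)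
  refine ⟨2 ^ k * (1 + n.factorial / r ^ n), fun x hx => ?_⟩
  set y := x ^ a with hy
  have hy0 : 0 ≤ y := Real.rpow_nonneg hx a
  have exp_le_one : Real.exp (-r * y) ≤ 1 := Real.exp_le_one_iff.2 (by nlinarith)
  rcases le_total x 1 with hx1 | hx1
  · calc (x + 1) ^ k * Real.exp (-r * y) ≤ (1 + 1) ^ k * 1 := by gcongr
      _ ≤ _ := by
        norm_num
        positivity
  · have pow_le_pow : x ^ k ≤ y ^ n := by
      rw [hy, ← Real.rpow_natCast, ← Real.rpow_natCast, ← Real.rpow_mul hx]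
      refine Real.rpow_le_rpow_of_exponent_le hx1 ?_
      rw [div_le_iff₀ ha] at hn
      linarith
    have pow_mul_exp_le : y ^ n * Real.exp (-r * y) ≤ n.factorial / r ^ n := by
      have := Real.pow_div_factorial_le_exp (r * y) (by positivity) n
      rw [div_le_iff₀ (by positivity), mul_pow] at this
      rw [le_div_iff₀ (by positivity), neg_mul, Real.exp_neg, ← div_eq_mul_inv,
        div_mul_eq_mul_div, div_le_iff₀ (Real.exp_pos _)]
      linarith
    calc (x + 1) ^ k * Real.exp (-r * y) ≤ (2 * x) ^ k * Real.exp (-r * y) := by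
          gcongr
          linarith
      _ = 2 ^ k * (x ^ k * Real.exp (-r * y)) := by ring
      _ ≤ 2 ^ k * (y ^ n * Real.exp (-r * y)) := by gcongr
      _ ≤ 2 ^ k * (1 + n.factorial / r ^ n) := by
          gcongr
          linarith

theorem summable_inv_succ_sq : Summable fun n : ℕ => (((n : ℝ) + 1) ^ 2)⁻¹ := by
  simpa using (summable_nat_add_iff 1).2 (Real.summable_nat_pow_inv.2 one_lt_two)

theorem summable_prod_of_nonneg {f : ℕ → ℝ} (hf : Summable f) (hf0 : ∀ n, 0 ≤ f n) (ι : Type*)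
    [Fintype ι] : Summable fun α : ι → ℕ => ∏ i, f (α i) := by
  classical
  refine summable_of_sum_le (c := (∑' n : ℕ, f n) ^ Fintype.card ι)
    (fun α => Finset.prod_nonneg fun i _ => hf0 _) fun S => ?_
  set N := S.sup fun α => ∑ i, α i
  have subset_cube : S ⊆ Fintype.piFinset fun _ : ι => Finset.range (N + 1) := fun α hα => by
    refine Fintype.mem_piFinset.2 fun i => Finset.mem_range_succ_iff.2 ?_
    exact (Finset.single_le_sum (fun j _ => Nat.zero_le (α j)) (Finset.mem_univ i)).trans
      (Finset.le_sup (f := fun α : ι → ℕ => ∑ i, α i) hα)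
  refine (Finset.sum_le_sum_of_subset_of_nonneg subset_cube fun α _ _ =>
    Finset.prod_nonneg fun i _ => hf0 _).trans ?_
  rw [← Finset.prod_univ_sum (fun _ : ι => Finset.range (N + 1)) (fun _ n => f n),
    Finset.prod_const, Finset.card_univ]
  exact pow_le_pow_left₀ (Finset.sum_nonneg fun n _ => hf0 n) (hf.sum_le_tsum _ fun n _ => hf0 n) _

theorem summable_pow_mul_exp_neg_len {r a : ℝ} (hr : 0 < r) (ha : 0 < a) (m : ℕ) :
    Summable fun α : ι → ℕ => (len α + 1) ^ m * Real.exp (-r * len α ^ a) := by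
  obtain ⟨C, hC⟩ := exists_pow_mul_exp_neg_rpow_le hr ha (m + 2 * Fintype.card ι)
  have majorant_summable :=
    (summable_prod_of_nonneg summable_inv_succ_sq (fun n => by positivity) ι).mul_left C
  refine majorant_summable.of_nonneg_of_le (fun α => by have := len_nonneg α; positivity)
    fun α => ?_
  have prod_le : ∏ i, ((α i : ℝ) + 1) ^ 2 ≤ (len α + 1) ^ (2 * Fintype.card ι) := by
    calc _ ≤ ∏ _i : ι, (len α + 1) ^ 2 := by
          gcongr with i
          exact coord_le_len α i
      _ = _ := by rw [Finset.prod_const, Finset.card_univ, ← pow_mul]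
  have := len_nonneg α
  have prod_pos : 0 < ∏ i, ((α i : ℝ) + 1) ^ 2 := Finset.prod_pos fun i _ => by positivity
  rw [Finset.prod_inv_distrib, ← div_eq_mul_inv, le_div_iff₀ prod_pos]
  calc _ ≤ (len α + 1) ^ m * Real.exp (-r * len α ^ a) *
        (len α + 1) ^ (2 * Fintype.card ι) := by gcongr
    _ = (len α + 1) ^ (m + 2 * Fintype.card ι) * Real.exp (-r * len α ^ a) := by ring
    _ ≤ C := hC _ (len_nonneg α)

theorem summable_exp_neg_succ_rpow {r a : ℝ} (hr : 0 < r) (ha : 0 < a) :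
    Summable fun j : ℕ => Real.exp (-r * ((j : ℝ) + 1) ^ a) := by
  obtain ⟨C, hC⟩ := exists_pow_mul_exp_neg_rpow_le hr ha 2
  refine Summable.of_nonneg_of_le (fun j => (Real.exp_pos _).le) (fun j => ?_)
    (summable_inv_succ_sq.mul_left C)
  rw [← div_eq_mul_inv, le_div_iff₀ (by positivity)]
  refine le_trans ?_ (hC ((j : ℝ) + 1) (by positivity))
  rw [mul_comm]
  gcongr
  linarith

theorem rpow_add_le_mul {x y a : ℝ} (hx : 0 ≤ x) (hy : 0 ≤ y) (ha : 0 ≤ a) :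
    (x + y) ^ a ≤ 2 ^ a * (x ^ a + y ^ a) := by
  wlog h : x ≤ y generalizing x y
  · rw [add_comm x, add_comm (x ^ a)]
    exact this hy hx (le_of_not_ge h)
  calc (x + y) ^ a ≤ (2 * y) ^ a := Real.rpow_le_rpow (by positivity) (by linarith) ha
    _ = 2 ^ a * y ^ a := Real.mul_rpow zero_le_two hy
    _ ≤ _ := by
      gcongr
      exact le_add_of_nonneg_left (Real.rpow_nonneg hx a)

theorem rpow_add_rpow_le {x y a : ℝ} (hx : 0 ≤ x) (hy : 0 ≤ y) (ha : 0 ≤ a) :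
    x ^ a + y ^ a ≤ 2 * (x + y) ^ a := by
  linarith [Real.rpow_le_rpow hx (le_add_of_nonneg_right hy) ha,
    Real.rpow_le_rpow hy (le_add_of_nonneg_left hx) ha]

theorem pow_rpow_le_factorial_mul_exp {p r y : ℝ} (hp : 0 < p) (hr : 0 < r) (hy : 0 ≤ y) (N : ℕ) :
    (y ^ p) ^ N ≤ ((p / r) ^ p) ^ N * (N.factorial : ℝ) ^ p * Real.exp (r * y) := by
  have pow_le : y ^ N ≤ (p / r) ^ N * N.factorial * Real.exp (r * y / p) := by
    have taylor := Real.pow_div_factorial_le_exp (r * y / p) (by positivity) N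
    rw [div_le_iff₀ (by positivity)] at taylor
    calc y ^ N = (p / r) ^ N * (r * y / p) ^ N := by
          rw [← mul_pow]
          congr 1
          field_simp
      _ ≤ (p / r) ^ N * (Real.exp (r * y / p) * N.factorial) := by gcongr
      _ = _ := by ring
  rw [Real.rpow_pow_comm hy, Real.rpow_pow_comm (by positivity)]
  refine (Real.rpow_le_rpow (by positivity) pow_le hp.le).trans_eq ?_
  rw [Real.mul_rpow (by positivity) (by positivity), Real.mul_rpow (by positivity) (by positivity),
    ← Real.exp_mul, div_mul_cancel₀ _ hp.ne']

theorem pow_mul_exp_neg_le_factorial {p r b h x : ℝ} (hp : 0 < p) (hr : 0 < r) (hb : 0 ≤ b)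
    (hh : 2 * b * (p / r) ^ p ≤ h) (hx : 0 ≤ x) (N : ℕ) :
    (b * (x + 1)) ^ N * Real.exp (-r * x ^ (1 / p)) ≤
      (1 + Real.exp r) * (h ^ N * (N.factorial : ℝ) ^ p) := by
  set q := (p / r) ^ p
  set F := (N.factorial : ℝ) ^ p
  set y := x ^ (1 / p) with hy
  have : 0 < q := by positivity
  have : 0 < F := by positivity
  have hy0 : 0 ≤ y := Real.rpow_nonneg hx _
  have pow_x_le : x ^ N ≤ q ^ N * F * Real.exp (r * y) := by
    have := pow_rpow_le_factorial_mul_exp hp hr hy0 N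
    rwa [hy, one_div, Real.rpow_inv_rpow hx hp.ne', ← one_div, ← hy] at this
  have one_le : 1 ≤ q ^ N * F * Real.exp r := by
    simpa using pow_rpow_le_factorial_mul_exp hp hr zero_le_one N
  have pow_succ_le : (x + 1) ^ N ≤ 2 ^ N * (x ^ N + 1) := by
    calc (x + 1) ^ N ≤ 2 ^ (N - 1) * (x ^ N + 1 ^ N) := add_pow_le hx zero_le_one N
      _ ≤ 2 ^ N * (x ^ N + 1) := by
        rw [one_pow]
        gcongr
        · norm_num
        · exact Nat.sub_le N 1
  have exp_le_one : Real.exp (-r * y) ≤ 1 := Real.exp_le_one_iff.2 (by nlinarith)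
  have exp_mul_exp_neg : Real.exp (r * y) * Real.exp (-r * y) = 1 := by
    rw [← Real.exp_add]
    simp
  calc (b * (x + 1)) ^ N * Real.exp (-r * y)
      ≤ b ^ N * (2 ^ N * (x ^ N + 1)) * Real.exp (-r * y) := by
        rw [mul_pow]
        gcongr
    _ = b ^ N * 2 ^ N * (x ^ N * Real.exp (-r * y) + 1 * Real.exp (-r * y)) := by ring
    _ ≤ b ^ N * 2 ^ N * (q ^ N * F * Real.exp (r * y) * Real.exp (-r * y) +
          (q ^ N * F * Real.exp r) * 1) := by gcongr
    _ = (1 + Real.exp r) * ((2 * b * q) ^ N * F) := by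
        rw [mul_assoc (q ^ N * F), exp_mul_exp_neg]
        ring
    _ ≤ _ := by gcongr

theorem le_two_mul_exp_neg_of_forall_mul_pow_le_factorial {y z : ℝ}
    (h : ∀ N : ℕ, z * y ^ N ≤ N.factorial) : z ≤ 2 * Real.exp (-(y / 2)) := by
  rw [Real.exp_neg, ← div_eq_mul_inv, le_div_iff₀ (Real.exp_pos _)]
  refine hasSum_le (fun N => ?_) ((hasSum_pow_div_factorial_real (y / 2)).mul_left z)
    hasSum_geometric_two
  calc z * ((y / 2) ^ N / N.factorial) = (z * y ^ N) / N.factorial * (1 / 2) ^ N := by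
        rw [div_pow, div_pow, one_pow]
        ring
    _ ≤ 1 * (1 / 2) ^ N := by
        gcongr
        exact div_le_one_of_le₀ (h N) (by positivity)
    _ = _ := one_mul _

theorem le_exp_neg_of_forall_mul_pow_le {p h X A q : ℝ} (hp : 0 < p) (hh : 0 < h) (hX : 0 ≤ X)
    (hA : 0 ≤ A) (hq : 0 ≤ q)
    (H : ∀ N : ℕ, q * X ^ N ≤ A * (h ^ N * (N.factorial : ℝ) ^ p)) :
    q ≤ A * 2 ^ p * Real.exp (-(p / 2 * (X / h) ^ (1 / p))) := by
  rcases hA.eq_or_lt with rfl | hA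
  · simpa using H 0
  set y := (X / h) ^ (1 / p)
  have rpow_y : y ^ p = X / h := by
    rw [← Real.rpow_inv_rpow (by positivity : 0 ≤ X / h) hp.ne', ← one_div]
  set z := (q / A) ^ (1 / p)
  have rpow_z : z ^ p = q / A := by
    rw [← Real.rpow_inv_rpow (by positivity : 0 ≤ q / A) hp.ne', ← one_div]
  have hy0 : 0 ≤ y := by positivity
  have hz0 : 0 ≤ z := by positivity
  have mul_pow_le (N : ℕ) : z * y ^ N ≤ N.factorial := by
    rw [← Real.rpow_le_rpow_iff (by positivity) (by positivity) hp,
      Real.mul_rpow hz0 (by positivity), ← Real.rpow_pow_comm hy0, rpow_y, rpow_z, div_pow,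
      div_mul_div_comm, div_le_iff₀ (by positivity)]
    linarith [H N]
  have div_le : q / A ≤ 2 ^ p * Real.exp (-(p / 2 * y)) := by
    rw [← rpow_z]
    refine (Real.rpow_le_rpow hz0
      (le_two_mul_exp_neg_of_forall_mul_pow_le_factorial mul_pow_le) hp.le).trans_eq ?_
    rw [Real.mul_rpow zero_le_two (Real.exp_pos _).le, ← Real.exp_mul]
    congr 2
    ring
  rw [div_le_iff₀ hA] at div_le
  linarith

theorem exists_hermiteBound_mul_exp_le (ι : Type*) [Fintype ι] {r a : ℝ} (hr : 0 < r)
    (ha : 0 < a) :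
    ∃ C : ℝ, 0 ≤ C ∧ ∀ α : ι → ℕ, hermiteBound α * Real.exp (-r * len α ^ a) ≤ C := by
  obtain ⟨C, hC⟩ := exists_pow_mul_exp_neg_rpow_le hr ha (3 * Fintype.card ι)
  have bound (α : ι → ℕ) : hermiteBound α * Real.exp (-r * len α ^ a) ≤
      100 ^ Fintype.card ι * C := by
    calc _ ≤ (100 ^ Fintype.card ι * (len α + 1) ^ (3 * Fintype.card ι)) *
          Real.exp (-r * len α ^ a) := by
          gcongr
          exact hermiteBound_le α
      _ = 100 ^ Fintype.card ι * ((len α + 1) ^ (3 * Fintype.card ι) *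
          Real.exp (-r * len α ^ a)) := by ring
      _ ≤ _ := by
          gcongr
          exact hC _ (len_nonneg α)
  exact ⟨_, (mul_nonneg (hermiteBound_pos _).le (Real.exp_pos _).le).trans (bound 0), bound⟩

theorem rapidDecay_of_coeffBound {s r : ℝ} (hs : 0 < s) (hr : 0 < r) {c : (ι → ℕ) → ℂ}
    (hc : CoeffBound s r c) : RapidDecay c := by
  obtain ⟨C, hC⟩ := hc
  intro m
  refine Summable.of_nonneg_of_le (fun α => by have := len_nonneg α; positivity) (fun α => ?_)
    ((summable_pow_mul_exp_neg_len (ι := ι) hr (a := 1 / (2 * s)) (by positivity) m).mul_left C)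
  have := len_nonneg α
  calc ‖c α‖ * (len α + 1) ^ m ≤
      (C * Real.exp (-r * len α ^ (1 / (2 * s)))) * (len α + 1) ^ m := by
        gcongr
        exact hC α
    _ = _ := by ring

end StretchedExponentials

section CoefficientEstimates

variable {ι : Type*} [Fintype ι]

/-! ### Estimates of functions and of their Hermite coefficients -/

/-- The factor `exp(-ρ |α|^(1/(2s)))` by which the coefficients of elements of `𝓗_s` decay. -/
def expDecay (s ρ : ℝ) (α : ι → ℕ) : ℝ :=
  Real.exp (-ρ * len α ^ (1 / (2 * s)))

theorem expDecay_pos (s ρ : ℝ) (α : ι → ℕ) : 0 < expDecay s ρ α := Real.exp_pos _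

theorem expDecay_mul_expDecay (s ρ ρ' : ℝ) (α : ι → ℕ) :
    expDecay s ρ α * expDecay s ρ' α = expDecay s (ρ + ρ') α := by
  rw [expDecay, expDecay, expDecay, ← Real.exp_add]
  congr 1
  ring

theorem expDecay_half_mul_self (s ρ : ℝ) (α : ι → ℕ) :
    expDecay s (ρ / 2) α * expDecay s (ρ / 2) α = expDecay s ρ α := by
  rw [expDecay_mul_expDecay, add_halves]

/-- Bounds for the Hermite coefficients `a j α` of a sequence of functions that decay in `α` and,
as in the estimates of the expansion, in the number `j` of the function. -/
def SeqCoeffBound (d : ℕ) (s r ρ : ℝ) (a : ℕ → (ι → ℕ) → ℂ) : Prop :=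
  ∃ C : ℝ, ∀ j α, ‖a j α‖ ≤ C / expWeight d s r j * expDecay s ρ α

theorem expWeight_pos (d : ℕ) (s r : ℝ) (j : ℕ) : 0 < expWeight d s r j := Real.exp_pos _

theorem one_le_expWeight (d : ℕ) (s : ℝ) {r : ℝ} (hr : 0 ≤ r) (j : ℕ) : 1 ≤ expWeight d s r j :=
  Real.one_le_exp (mul_nonneg hr (Real.rpow_nonneg (by positivity) _))

theorem expWeight_mono (d : ℕ) (s : ℝ) {r r' : ℝ} (hr : r ≤ r') (j : ℕ) :
    expWeight d s r j ≤ expWeight d s r' j := by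
  unfold expWeight
  gcongr

theorem summable_inv_expWeight {d : ℕ} {s r : ℝ} (hd : 0 < d) (hs : 0 < s) (hr : 0 < r) :
    Summable fun j => (expWeight d s r j)⁻¹ := by
  have : (0 : ℝ) < d := by exact_mod_cast hd
  refine (summable_exp_neg_succ_rpow hr (a := 1 / (2 * d * s)) (by positivity)).congr fun j => ?_
  rw [expWeight, neg_mul, Real.exp_neg]

variable {d : ℕ} {s r ρ h : ℝ} {p : ℝ≥0∞} {a : ℕ → (ι → ℕ) → ℂ}
  {f : ℕ → EuclideanSpace ℝ ι → ℂ}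

theorem SeqCoeffBound.exists_nonneg (ha : SeqCoeffBound d s r ρ a) :
    ∃ C : ℝ, 0 ≤ C ∧ ∀ j α, ‖a j α‖ ≤ C / expWeight d s r j * expDecay s ρ α := by
  obtain ⟨C, hC⟩ := ha
  refine ⟨|C|, abs_nonneg C, fun j α => (hC j α).trans ?_⟩
  have := expWeight_pos d s r j
  have := expDecay_pos s ρ α
  gcongr
  exact le_abs_self C

theorem SeqCoeffBound.coeffBound (ha : SeqCoeffBound d s r ρ a) (j : ℕ) :
    CoeffBound s ρ (a j) := by
  obtain ⟨C, hC⟩ := ha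
  exact ⟨C / expWeight d s r j, hC j⟩

theorem SeqCoeffBound.rapidDecay (ha : SeqCoeffBound d s r ρ a) (hs : 0 < s) (hρ : 0 < ρ) (j : ℕ) :
    RapidDecay (a j) :=
  rapidDecay_of_coeffBound hs hρ (ha.coeffBound j)

theorem expDecay_mul_hermiteBound_nonneg (s ρ : ℝ) (α : ι → ℕ) :
    0 ≤ expDecay s ρ α * hermiteBound α :=
  (mul_pos (expDecay_pos s ρ α) (hermiteBound_pos α)).le

theorem summable_expDecay_mul_hermiteBound (hs : 0 < s) (hρ : 0 < ρ) :
    Summable fun α : ι → ℕ => expDecay s ρ α * hermiteBound α := by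
  refine Summable.of_nonneg_of_le (expDecay_mul_hermiteBound_nonneg s ρ) (fun α => ?_)
    ((summable_pow_mul_exp_neg_len (ι := ι) hρ (a := 1 / (2 * s)) (by positivity)
      (3 * Fintype.card ι)).mul_left (100 ^ Fintype.card ι))
  calc expDecay s ρ α * hermiteBound α
      ≤ expDecay s ρ α * (100 ^ Fintype.card ι * (len α + 1) ^ (3 * Fintype.card ι)) := by
        gcongr
        · exact (expDecay_pos s ρ α).le
        · exact hermiteBound_le α
    _ = _ := by
        rw [expDecay]
        ring

/-- Half of the exponential decay absorbs the powers of the eigenvalue; the other half is left for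
the sum over `α`. -/
theorem eigenvalue_pow_mul_expDecay_le (hs : 0 < s) (hρ : 0 < ρ)
    (hh : 2 * (2 + Fintype.card ι) * (2 * s / (ρ / 2)) ^ (2 * s) ≤ h) (N : ℕ) (α : ι → ℕ) :
    eigenvalue α ^ N * expDecay s ρ α ≤
      (1 + Real.exp (ρ / 2)) * (h ^ N * (N.factorial : ℝ) ^ (2 * s)) * expDecay s (ρ / 2) α := by
  have := expDecay_pos s (ρ / 2) α
  have := eigenvalue_nonneg α
  calc eigenvalue α ^ N * expDecay s ρ α
      ≤ ((2 + Fintype.card ι) * (len α + 1)) ^ N * expDecay s ρ α := by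
        rw [← expDecay_half_mul_self]
        gcongr
        exact eigenvalue_le α
    _ = ((2 + Fintype.card ι) * (len α + 1)) ^ N * expDecay s (ρ / 2) α *
          expDecay s (ρ / 2) α := by
        rw [mul_assoc, expDecay_half_mul_self]
    _ ≤ _ := mul_le_mul_of_nonneg_right (pow_mul_exp_neg_le_factorial (by positivity)
        (by positivity) (by positivity) hh (len_nonneg α) N) (expDecay_pos s _ α).le

theorem exists_harmOscPowNormLE_hermiteSeries (hp : 1 ≤ p) (hs : 0 < s) (hρ : 0 < ρ)
    (hh : 2 * (2 + Fintype.card ι) * (2 * s / (ρ / 2)) ^ (2 * s) ≤ h) :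
    ∃ C : ℝ, 0 ≤ C ∧ ∀ (c : (ι → ℕ) → ℂ) (B : ℝ), 0 ≤ B → (∀ α, ‖c α‖ ≤ B * expDecay s ρ α) →
      ∀ N : ℕ, HarmOscPowNormLE p N (hermiteSeries c)
        (B * C * (h ^ N * (N.factorial : ℝ) ^ (2 * s))) := by
  have : 0 ≤ h := le_trans (by positivity) hh
  have summable_bound := summable_expDecay_mul_hermiteBound (ι := ι) hs (half_pos hρ)
  set S := ∑' α : ι → ℕ, expDecay s (ρ / 2) α * hermiteBound α
  have S_nonneg : 0 ≤ S :=
    tsum_nonneg (expDecay_mul_hermiteBound_nonneg s _)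
  refine ⟨(1 + Real.exp (ρ / 2)) * S * (eLpNorm (weight : EuclideanSpace ℝ ι → ℝ) p).toReal,
    by positivity, fun c B hB hc N => ?_⟩
  have hrd : RapidDecay c := rapidDecay_of_coeffBound hs hρ ⟨B, hc⟩
  refine ⟨_, (hrd.eigenvalue_pow_mul N).memLp hp, hrd.isHarmOscPow N, ?_⟩
  set A := B * ((1 + Real.exp (ρ / 2)) * (h ^ N * (N.factorial : ℝ) ^ (2 * s))) with hA
  have coeff_le (α : ι → ℕ) :
      ‖((eigenvalue α ^ N : ℝ) : ℂ) * c α‖ ≤ A * expDecay s (ρ / 2) α := by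
    have := eigenvalue_nonneg α
    rw [norm_mul, Complex.norm_real, Real.norm_of_nonneg (pow_nonneg this N)]
    calc eigenvalue α ^ N * ‖c α‖ ≤ B * (eigenvalue α ^ N * expDecay s ρ α) := by
          rw [mul_left_comm]
          gcongr
          exact hc α
      _ ≤ B * ((1 + Real.exp (ρ / 2)) * (h ^ N * (N.factorial : ℝ) ^ (2 * s)) *
            expDecay s (ρ / 2) α) :=
          mul_le_mul_of_nonneg_left (eigenvalue_pow_mul_expDecay_le hs hρ hh N α) hB
      _ = _ := by ring
  have tsum_le : ∑' α : ι → ℕ, ‖((eigenvalue α ^ N : ℝ) : ℂ) * c α‖ * hermiteBound α ≤ A * S := by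
    rw [← tsum_mul_left]
    refine (hrd.eigenvalue_pow_mul N).summable_mul_hermiteBound.tsum_le_tsum (fun α => ?_)
      (summable_bound.mul_left A)
    rw [← mul_assoc]
    gcongr
    · exact (hermiteBound_pos α).le
    · exact coeff_le α
  refine ((hrd.eigenvalue_pow_mul N).eLpNorm_le tsum_le).trans_eq ?_
  rw [← ENNReal.ofReal_toReal (memLp_weight (ι := ι) hp).2.ne,
    ← ENNReal.ofReal_mul (by positivity), ENNReal.toReal_ofReal ENNReal.toReal_nonneg, hA]
  ring_nf

theorem SeqCoeffBound.functionEstimate (ha : SeqCoeffBound d s r ρ a) (hp : 1 ≤ p) (hs : 0 < s)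
    (hρ : 0 < ρ) (hh : 2 * (2 + Fintype.card ι) * (2 * s / (ρ / 2)) ^ (2 * s) ≤ h) :
    FunctionEstimate p d s r h fun j => hermiteSeries (a j) := by
  obtain ⟨A, hA0, hA⟩ := ha.exists_nonneg
  obtain ⟨C, -, hC⟩ := exists_harmOscPowNormLE_hermiteSeries (ι := ι) hp hs hρ hh
  refine ⟨A * C, fun j N => ?_⟩
  convert hC (a j) _ (div_nonneg hA0 (expWeight_pos d s r j).le) (hA j) N using 1
  ring

theorem FunctionEstimate.exists_nonneg (hf : FunctionEstimate p d s r h f) (hh : 0 ≤ h) :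
    ∃ C : ℝ, 0 ≤ C ∧ ∀ j N : ℕ, HarmOscPowNormLE p N (f j)
      (C / expWeight d s r j * (h ^ N * (N.factorial : ℝ) ^ (2 * s))) := by
  obtain ⟨C, hC⟩ := hf
  refine ⟨|C|, abs_nonneg C, fun j N => ?_⟩
  obtain ⟨g, memLp, isPow, norm_le⟩ := hC j N
  refine ⟨g, memLp, isPow, norm_le.trans (ENNReal.ofReal_le_ofReal ?_)⟩
  rw [div_mul_eq_mul_div]
  have := expWeight_pos d s r j
  gcongr
  exact le_abs_self C

theorem IsHarmOscPow.succ {u g g' : EuclideanSpace ℝ ι → ℂ} {N : ℕ} (hg : IsHarmOscPow N u g)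
    (hg' : IsHarmOscPow (N + 1) u g') (φ : EuclideanSpace ℝ ι → ℂ) (hφ : ContDiff ℝ ∞ φ)
    (hc : HasCompactSupport φ) : ∫ x, g' x * φ x = ∫ x, g x * harmOsc φ x := by
  rw [hg' φ hφ hc, hg (harmOsc φ) (contDiff_harmOsc hφ) (hasCompactSupport_harmOsc hc),
    Function.iterate_succ_apply]

theorem IsHarmOscPow.ae_eq {u g : EuclideanSpace ℝ ι → ℂ} (hg : IsHarmOscPow 0 u g)
    (hu : LocallyIntegrable u) (hgl : LocallyIntegrable g) : u =ᵐ[volume] g := by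
  refine ae_eq_of_integral_contDiff_smul_eq hu hgl fun ψ hψ hc => ?_
  have := hg (fun x => (ψ x : ℂ)) (Complex.ofRealCLM.contDiff.comp hψ)
    (hc.comp_left (g := fun t : ℝ => (t : ℂ)) (by simp))
  simp only [Function.iterate_zero, id_eq] at this
  simp only [Complex.real_smul, mul_comm ((ψ _ : ℝ) : ℂ)]
  exact this.symm

theorem hermiteCoeff_isHarmOscPow {u : EuclideanSpace ℝ ι → ℂ}
    {g : ℕ → EuclideanSpace ℝ ι → ℂ} (hg : ∀ N, IsHarmOscPow N u (g N)) (hu : u =ᵐ[volume] g 0)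
    (hgw : ∀ N, WeightIntegrable (g N)) (N : ℕ) (α : ι → ℕ) :
    hermiteCoeff (g N) α = (eigenvalue α : ℂ) ^ N * hermiteCoeff u α := by
  induction N with
  | zero =>
    rw [pow_zero, one_mul, hermiteCoeff]
    refine integral_congr_ae ?_
    filter_upwards [hu] with x hx
    rw [hx]
  | succ N ih =>
    rw [hermiteCoeff_of_weak (hgw N) (hgw (N + 1)) ((hg N).succ (hg (N + 1))), ih,
      pow_succ]
    ring

theorem WeightIntegrable.congr_ae {u g : EuclideanSpace ℝ ι → ℂ} (hg : WeightIntegrable g)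
    (h : u =ᵐ[volume] g) : WeightIntegrable u := by
  refine ⟨hg.1.congr h.symm, hg.2.congr ?_⟩
  filter_upwards [h] with x hx
  rw [hx]

theorem expDecay_of_eigenvalue_rpow_le (hs : 0 < s) (hh : 0 < h) (α : ι → ℕ) :
    Real.exp (-(2 * s / 2 * (eigenvalue α / h) ^ (1 / (2 * s)))) ≤
      expDecay s (s * h⁻¹ ^ (1 / (2 * s))) α := by
  have rpow_le : (len α * h⁻¹) ^ (1 / (2 * s)) ≤ (eigenvalue α / h) ^ (1 / (2 * s)) := by
    rw [← div_eq_mul_inv]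
    have := len_nonneg α
    gcongr
    rw [eigenvalue]
    linarith [(Nat.cast_nonneg (Fintype.card ι) : (0 : ℝ) ≤ Fintype.card ι)]
  rw [Real.mul_rpow (len_nonneg α) (by positivity)] at rpow_le
  rw [expDecay, Real.exp_le_exp, neg_mul, neg_le_neg_iff, mul_div_cancel_left₀ _ two_ne_zero,
    mul_assoc, mul_comm (h⁻¹ ^ _)]
  gcongr

/-- The moments of `H^N u` against `h_α` are those of `u` times the `N`-th power of the eigenvalue,
so bounds for all `N` force the latter to decay. -/
theorem exists_norm_hermiteCoeff_le (hp : 1 ≤ p) (hs : 0 < s) (hh : 0 < h) :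
    ∃ D : ℝ, ∀ (u : EuclideanSpace ℝ ι → ℂ) (B : ℝ), LocallyIntegrable u → 0 ≤ B →
      (∀ N : ℕ, HarmOscPowNormLE p N u (B * (h ^ N * (N.factorial : ℝ) ^ (2 * s)))) →
      WeightIntegrable u ∧ ∀ α : ι → ℕ, ‖hermiteCoeff u α‖ ≤
        D * B * expDecay s (s * h⁻¹ ^ (1 / (2 * s)) / 2) α := by
  obtain ⟨W, hW0, hW⟩ := exists_integral_norm_mul_weight_le (ι := ι) hp
  set ρ := s * h⁻¹ ^ (1 / (2 * s))
  obtain ⟨D, -, hD⟩ := exists_hermiteBound_mul_exp_le ι (r := ρ / 2) (a := 1 / (2 * s))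
    (by positivity) (by positivity)
  refine ⟨W * 2 ^ (2 * s) * D, fun u B hu hB hN => ?_⟩
  choose g memLp isPow norm_le using hN
  have hg (N : ℕ) := hW (g N) (memLp N) _ (by positivity) (norm_le N)
  have hgw (N : ℕ) : WeightIntegrable (g N) := ⟨(memLp N).1, (hg N).1⟩
  have ae_eq : u =ᵐ[volume] g 0 := (isPow 0).ae_eq hu ((memLp 0).locallyIntegrable hp)
  refine ⟨(hgw 0).congr_ae ae_eq, fun α => ?_⟩
  have := hermiteBound_pos α
  have moment_le (N : ℕ) : ‖hermiteCoeff u α‖ * eigenvalue α ^ N ≤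
      hermiteBound α * (W * B) * (h ^ N * (N.factorial : ℝ) ^ (2 * s)) := by
    have := (hgw N).norm_hermiteCoeff_le α
    rw [hermiteCoeff_isHarmOscPow isPow ae_eq hgw, norm_mul, norm_pow,
      Complex.norm_real, Real.norm_of_nonneg (eigenvalue_nonneg α)] at this
    calc _ ≤ hermiteBound α * ∫ x, ‖g N x‖ * weight x := by rwa [mul_comm]
      _ ≤ hermiteBound α * (W * (B * (h ^ N * (N.factorial : ℝ) ^ (2 * s)))) := by
          gcongr
          exact (hg N).2
      _ = _ := by ring
  have := expDecay_pos s (ρ / 2) α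
  calc _ ≤ hermiteBound α * (W * B) * 2 ^ (2 * s) *
        Real.exp (-(2 * s / 2 * (eigenvalue α / h) ^ (1 / (2 * s)))) :=
        le_exp_neg_of_forall_mul_pow_le (by positivity) hh (eigenvalue_nonneg α) (by positivity)
          (norm_nonneg _) moment_le
    _ ≤ hermiteBound α * (W * B) * 2 ^ (2 * s) *
          (expDecay s (ρ / 2) α * expDecay s (ρ / 2) α) := by
        rw [expDecay_half_mul_self]
        gcongr
        exact expDecay_of_eigenvalue_rpow_le hs hh α
    _ = W * B * 2 ^ (2 * s) * (hermiteBound α * expDecay s (ρ / 2) α) * expDecay s (ρ / 2) α := by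
        ring
    _ ≤ W * B * 2 ^ (2 * s) * D * expDecay s (ρ / 2) α := by
        gcongr
        exact hD α
    _ = _ := by ring

theorem FunctionEstimate.seqCoeffBound (hf : FunctionEstimate p d s r h f) (hp : 1 ≤ p)
    (hs : 0 < s) (hh : 0 < h) (hloc : ∀ j, LocallyIntegrable (f j)) :
    (∀ j, WeightIntegrable (f j)) ∧ SeqCoeffBound d s r (s * h⁻¹ ^ (1 / (2 * s)) / 2)
      (fun j => hermiteCoeff (f j)) := by
  obtain ⟨C, hC0, hC⟩ := hf.exists_nonneg hh.le
  obtain ⟨D, hD⟩ := exists_norm_hermiteCoeff_le (ι := ι) hp hs hh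
  have bound (j : ℕ) := hD (f j) _ (hloc j) (div_nonneg hC0 (expWeight_pos d s r j).le) (hC j)
  refine ⟨fun j => (bound j).1, D * C, fun j α => ((bound j).2 α).trans_eq ?_⟩
  ring

/-! ### Products of Hermite series -/

variable {κ : Type*} [Fintype κ] {b : ℕ → (κ → ℕ) → ℂ} {l : ℕ → ℝ}

theorem exists_norm_mul_coeff_le (hl0 : ∀ j, 0 ≤ l j) {L : ℝ} (hL : ∀ j, l j ≤ L) (hr : 0 ≤ r)
    (ha : SeqCoeffBound d s r ρ a) (hb : SeqCoeffBound d s r ρ b) :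
    ∃ C : ℝ, 0 ≤ C ∧ ∀ j α β, ‖(l j : ℂ) * (a j α * b j β)‖ ≤
      C * (expDecay s ρ α * expDecay s ρ β) * (expWeight d s r j)⁻¹ := by
  obtain ⟨A, hA0, hA⟩ := ha.exists_nonneg
  obtain ⟨B, hB0, hB⟩ := hb.exists_nonneg
  have hL0 : 0 ≤ L := (hl0 0).trans (hL 0)
  refine ⟨L * (A * B), by positivity, fun j α β => ?_⟩
  have := expWeight_pos d s r j
  have := expDecay_pos s ρ α
  have := expDecay_pos s ρ β
  rw [norm_mul, norm_mul, Complex.norm_real, Real.norm_of_nonneg (hl0 j)]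
  calc l j * (‖a j α‖ * ‖b j β‖) ≤ L * ((A / expWeight d s r j * expDecay s ρ α) *
        (B / 1 * expDecay s ρ β)) := by
        gcongr
        · exact hL j
        · exact hA j α
        · refine (hB j β).trans ?_
          gcongr
          exact one_le_expWeight d s hr j
    _ = _ := by ring

theorem summable_mul_hermiteFun_mul_hermiteFun (hd : 0 < d) (hs : 0 < s) (hr : 0 < r) (hρ : 0 < ρ)
    (hl0 : ∀ j, 0 ≤ l j) {L : ℝ} (hL : ∀ j, l j ≤ L)
    (ha : SeqCoeffBound d s r ρ a) (hb : SeqCoeffBound d s r ρ b)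
    (x : EuclideanSpace ℝ ι) (y : EuclideanSpace ℝ κ) :
    Summable fun t : ℕ × ((κ → ℕ) × (ι → ℕ)) => ((l t.1 : ℂ) * (a t.1 t.2.2 * b t.1 t.2.1)) *
      ((hermiteFun t.2.1 y : ℂ) * (hermiteFun t.2.2 x : ℂ)) := by
  obtain ⟨C, hC0, hC⟩ := exists_norm_mul_coeff_le hl0 hL hr.le ha hb
  have summable_pair := (summable_expDecay_mul_hermiteBound (ι := κ) hs hρ).mul_of_nonneg
    (summable_expDecay_mul_hermiteBound (ι := ι) hs hρ)
    (expDecay_mul_hermiteBound_nonneg s ρ) (expDecay_mul_hermiteBound_nonneg s ρ)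
  have summable_triple := ((summable_inv_expWeight hd hs hr).mul_of_nonneg summable_pair
    (fun j => (inv_pos.2 (expWeight_pos d s r j)).le)
    (fun q => mul_nonneg (expDecay_mul_hermiteBound_nonneg s ρ _)
      (expDecay_mul_hermiteBound_nonneg s ρ _))).mul_left C
  refine Summable.of_norm_bounded summable_triple fun ⟨j, β, α⟩ => ?_
  have := expWeight_pos d s r j
  have := expDecay_pos s ρ α
  have := expDecay_pos s ρ β
  have := hermiteBound_pos β
  rw [norm_mul, norm_mul ((hermiteFun β y : ℝ) : ℂ), Complex.norm_real, Complex.norm_real,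
    Real.norm_eq_abs, Real.norm_eq_abs]
  calc _ ≤ (C * (expDecay s ρ α * expDecay s ρ β) * (expWeight d s r j)⁻¹) *
        (hermiteBound β * hermiteBound α) := by
        gcongr
        · exact hC j α β
        · exact abs_hermiteFun_le_hermiteBound β y
        · exact abs_hermiteFun_le_hermiteBound α x
    _ = _ := by ring

theorem hasSum_mul_prod {A B : Type*} {u : A → ℂ} {v : B → ℂ} {x y : ℂ} (hu : HasSum u x)
    (hv : HasSum v y) : HasSum (fun q : A × B => u q.1 * v q.2) (x * y) :=
  hu.mul hv (summable_mul_of_summable_norm hu.summable.norm hv.summable.norm)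

theorem exists_hasSum_mul_hermiteSeries (hd : 0 < d) (hs : 0 < s) (hr : 0 < r) (hρ : 0 < ρ)
    (hl0 : ∀ j, 0 ≤ l j) {L : ℝ} (hL : ∀ j, l j ≤ L)
    (ha : SeqCoeffBound d s r ρ a) (hb : SeqCoeffBound d s r ρ b)
    (x : EuclideanSpace ℝ ι) (y : EuclideanSpace ℝ κ) :
    ∃ S : ℂ, HasSum (fun j => (l j : ℂ) * (hermiteSeries (a j) x * hermiteSeries (b j) y)) S ∧
      HasSum (fun q : (κ → ℕ) × (ι → ℕ) => (∑' j, (l j : ℂ) * (a j q.2 * b j q.1)) *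
        ((hermiteFun q.1 y : ℂ) * (hermiteFun q.2 x : ℂ))) S := by
  obtain ⟨C, -, hC⟩ := exists_norm_mul_coeff_le hl0 hL hr.le ha hb
  have triple_summable := summable_mul_hermiteFun_mul_hermiteFun hd hs hr hρ hl0 hL ha hb x y
  have swapped_hasSum :=
    (Equiv.prodComm ℕ ((κ → ℕ) × (ι → ℕ))).symm.hasSum_iff.2 triple_summable.hasSum
  refine ⟨_, triple_summable.hasSum.prod_fiberwise fun j => ?_,
    swapped_hasSum.prod_fiberwise fun q => ?_⟩
  · have hx := (ha.rapidDecay hs hρ j).isHermiteSeries x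
    have hy := (hb.rapidDecay hs hρ j).isHermiteSeries y
    rw [mul_comm (hermiteSeries (a j) x)]
    refine ((hasSum_mul_prod hy hx).mul_left (l j : ℂ)).congr_fun fun q => ?_
    ring
  · have summable_coeff : Summable fun j => (l j : ℂ) * (a j q.2 * b j q.1) :=
      Summable.of_norm_bounded ((summable_inv_expWeight hd hs hr).mul_left _) fun j => hC j q.2 q.1
    exact (summable_coeff.hasSum.mul_right _).congr_fun fun _ => rfl

end CoefficientEstimates

section Expansions

variable {ι κ : Type*}

/-! ### From expansions to Hermite series -/

/-- The point of `ℝ^(κ ⊕ ι)` with components `x` and `y`, an inverse to the splitting that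
`onSum` is built on. -/
def joinSum (x : EuclideanSpace ℝ κ) (y : EuclideanSpace ℝ ι) : EuclideanSpace ℝ (κ ⊕ ι) :=
  WithLp.toLp 2 (Sum.elim x y)

theorem continuous_joinSum :
    Continuous fun z : EuclideanSpace ℝ κ × EuclideanSpace ℝ ι => joinSum z.1 z.2 := by
  refine (PiLp.continuous_toLp 2 _).comp (continuous_pi fun i => ?_)
  rcases i with i | i
  · exact (by fun_prop : Continuous fun z : EuclideanSpace ℝ κ × EuclideanSpace ℝ ι => z.1 i)
  · exact (by fun_prop : Continuous fun z : EuclideanSpace ℝ κ × EuclideanSpace ℝ ι => z.2 i)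

theorem joinSum_components (z : EuclideanSpace ℝ (κ ⊕ ι)) :
    joinSum (WithLp.toLp 2 fun i => z (Sum.inl i)) (WithLp.toLp 2 fun i => z (Sum.inr i)) = z := by
  ext i
  rcases i with i | i <;> rfl

variable [Fintype ι] [Fintype κ]

theorem onSum_joinSum {m n : ℕ} (K : EuclideanSpace ℝ (Fin m) × EuclideanSpace ℝ (Fin n) → ℂ)
    (x : EuclideanSpace ℝ (Fin m)) (y : EuclideanSpace ℝ (Fin n)) :
    onSum K (joinSum x y) = K (x, y) := rfl

theorem hermiteFun_joinSum (γ : κ ⊕ ι → ℕ) (x : EuclideanSpace ℝ κ) (y : EuclideanSpace ℝ ι) :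
    hermiteFun γ (joinSum x y) =
      hermiteFun (fun i => γ (Sum.inl i)) x * hermiteFun (fun i => γ (Sum.inr i)) y := by
  rw [hermiteFun, Fintype.prod_sum_type]
  rfl

theorem len_sum (γ : κ ⊕ ι → ℕ) :
    len γ = len (fun i => γ (Sum.inl i)) + len (fun i => γ (Sum.inr i)) := by
  rw [len, Fintype.sum_sum_type, Nat.cast_add]

theorem hasSum_hermiteFun_joinSum_iff {c : (κ ⊕ ι → ℕ) → ℂ} {x : EuclideanSpace ℝ κ}
    {y : EuclideanSpace ℝ ι} {S : ℂ} :
    HasSum (fun γ => c γ * (hermiteFun γ (joinSum x y) : ℂ)) S ↔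
      HasSum (fun q : (κ → ℕ) × (ι → ℕ) => c (Sum.elim q.1 q.2) *
        ((hermiteFun q.1 x : ℂ) * (hermiteFun q.2 y : ℂ))) S := by
  rw [← (Equiv.sumArrowEquivProdArrow κ ι ℕ).symm.hasSum_iff]
  refine iff_of_eq (congrArg (fun F => HasSum F S) (funext fun q => ?_))
  simp only [Function.comp_apply, hermiteFun_joinSum, Complex.ofReal_mul]
  rfl

/-- The Hermite coefficients of `∑_j l_j F_j ⊗ G_j` on the product, in terms of the coefficients
`a j` of `F_j` and `b j` of `G_j`. -/
def productCoeff (l : ℕ → ℝ) (a : ℕ → (ι → ℕ) → ℂ) (b : ℕ → (κ → ℕ) → ℂ) (γ : κ ⊕ ι → ℕ) : ℂ :=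
  ∑' j, (l j : ℂ) * (a j (fun i => γ (Sum.inr i)) * b j (fun i => γ (Sum.inl i)))

variable {d : ℕ} {s r ρ h : ℝ} {p : ℝ≥0∞} {a : ℕ → (ι → ℕ) → ℂ} {b : ℕ → (κ → ℕ) → ℂ} {l : ℕ → ℝ}

theorem expDecay_mul_expDecay_le (hs : 0 < s) (hρ : 0 ≤ ρ) (γ : κ ⊕ ι → ℕ) :
    expDecay s ρ (fun i => γ (Sum.inr i)) * expDecay s ρ (fun i => γ (Sum.inl i)) ≤
      expDecay s (ρ / 2 ^ (1 / (2 * s))) γ := by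
  rw [expDecay, expDecay, expDecay, ← Real.exp_add, Real.exp_le_exp, len_sum]
  set m := len fun i => γ (Sum.inl i)
  set n := len fun i => γ (Sum.inr i)
  suffices ρ / 2 ^ (1 / (2 * s)) * (m + n) ^ (1 / (2 * s)) ≤
      ρ * (m ^ (1 / (2 * s)) + n ^ (1 / (2 * s))) by linarith
  rw [div_mul_eq_mul_div, div_le_iff₀ (by positivity), mul_assoc, mul_comm _ (2 ^ (1 / (2 * s)))]
  exact mul_le_mul_of_nonneg_left
    (rpow_add_le_mul (len_nonneg _) (len_nonneg _) (by positivity)) hρ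

theorem coeffBound_productCoeff (hd : 0 < d) (hs : 0 < s) (hr : 0 < r) (hρ : 0 < ρ)
    (hl0 : ∀ j, 0 ≤ l j) {L : ℝ} (hL : ∀ j, l j ≤ L)
    (ha : SeqCoeffBound d s r ρ a) (hb : SeqCoeffBound d s r ρ b) :
    CoeffBound s (ρ / 2 ^ (1 / (2 * s))) (productCoeff l a b) := by
  obtain ⟨C, hC0, hC⟩ := exists_norm_mul_coeff_le hl0 hL hr.le ha hb
  have tsum_inv_nonneg : 0 ≤ ∑' j, (expWeight d s r j)⁻¹ :=
    tsum_nonneg fun j => (inv_pos.2 (expWeight_pos d s r j)).le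
  refine ⟨C * ∑' j, (expWeight d s r j)⁻¹, fun γ => ?_⟩
  calc ‖productCoeff l a b γ‖
      ≤ C * (expDecay s ρ (fun i => γ (Sum.inr i)) * expDecay s ρ fun i => γ (Sum.inl i)) *
        ∑' j, (expWeight d s r j)⁻¹ := by
        rw [← tsum_mul_left]
        exact tsum_of_norm_bounded ((summable_inv_expWeight hd hs hr).mul_left _).hasSum
          fun j => hC j _ _
    _ ≤ C * expDecay s (ρ / 2 ^ (1 / (2 * s))) γ * ∑' j, (expWeight d s r j)⁻¹ := by
        gcongr
        exact expDecay_mul_expDecay_le hs hρ.le γ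
    _ = C * (∑' j, (expWeight d s r j)⁻¹) * expDecay s (ρ / 2 ^ (1 / (2 * s))) γ :=
        mul_right_comm _ _ _

theorem hermiteSeries_productCoeff_joinSum (hd : 0 < d) (hs : 0 < s) (hr : 0 < r) (hρ : 0 < ρ)
    (hl0 : ∀ j, 0 ≤ l j) {L : ℝ} (hL : ∀ j, l j ≤ L)
    (ha : SeqCoeffBound d s r ρ a) (hb : SeqCoeffBound d s r ρ b)
    (x : EuclideanSpace ℝ κ) (y : EuclideanSpace ℝ ι) :
    HasSum (fun j => (l j : ℂ) * (hermiteSeries (a j) y * hermiteSeries (b j) x))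
      (hermiteSeries (productCoeff l a b) (joinSum x y)) := by
  have rapidDecay := rapidDecay_of_coeffBound hs (by positivity)
    (coeffBound_productCoeff hd hs hr hρ hl0 hL ha hb)
  obtain ⟨S, sum_over_j, sum_over_pairs⟩ :=
    exists_hasSum_mul_hermiteSeries hd hs hr hρ hl0 hL ha hb y x
  have joint_sum := hasSum_hermiteFun_joinSum_iff.1 (rapidDecay.isHermiteSeries (joinSum x y))
  rwa [joint_sum.unique sum_over_pairs]

theorem ScalarEstimate.exists_bound (hl : ScalarEstimate d s r l) (hl0 : ∀ j, 0 ≤ l j)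
    (hr : 0 ≤ r) : ∃ L, ∀ j, l j ≤ L := by
  obtain ⟨C, hC⟩ := hl
  exact ⟨C, fun j => (le_mul_of_one_le_left (hl0 j) (one_le_expWeight d s hr j)).trans (hC j)⟩

variable {d₁ d₂ : ℕ} {K : EuclideanSpace ℝ (Fin d₂) × EuclideanSpace ℝ (Fin d₁) → ℂ}
  {f₁ : ℕ → EuclideanSpace ℝ (Fin d₁) → ℂ} {f₂ : ℕ → EuclideanSpace ℝ (Fin d₂) → ℂ}

theorem coeffBound_of_expansionEstimates (hd₁ : 1 ≤ d₁) (hd₂ : 1 ≤ d₂) (hp : 1 ≤ p) (hs : 0 < s)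
    (hr : 0 < r) (hh : 0 < h) (hl0 : ∀ j, 0 ≤ l j)
    (hf₁ : ∀ j, LocallyIntegrable (f₁ j)) (hf₂ : ∀ j, LocallyIntegrable (f₂ j))
    (H : ExpansionEstimates p s r h l f₁ f₂) :
    CoeffBound s (s * h⁻¹ ^ (1 / (2 * s)) / 2 / 2 ^ (1 / (2 * s)))
      (productCoeff l (fun j => hermiteCoeff (f₁ j)) fun j => hermiteCoeff (f₂ j)) := by
  obtain ⟨scalarEstimate, estimate₁, estimate₂⟩ := H
  obtain ⟨L, hL⟩ := scalarEstimate.exists_bound hl0 hr.le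
  exact coeffBound_productCoeff (lt_min hd₁ hd₂) hs hr (by positivity) hl0 hL
    (estimate₁.seqCoeffBound hp hs hh hf₁).2 (estimate₂.seqCoeffBound hp hs hh hf₂).2

theorem ae_eq_hermiteSeries_productCoeff (hd₁ : 1 ≤ d₁) (hd₂ : 1 ≤ d₂)
    (hp : 1 ≤ p) (hs : 0 < s) (hr : 0 < r) (hh : 0 < h) (hl0 : ∀ j, 0 ≤ l j)
    (hf₁ : ∀ j, LocallyIntegrable (f₁ j)) (hf₂ : ∀ j, LocallyIntegrable (f₂ j))
    (hexp : ∀ᵐ z, ExpansionAt K l f₁ f₂ z) (H : ExpansionEstimates p s r h l f₁ f₂) :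
    K =ᵐ[volume] fun z => hermiteSeries
      (productCoeff l (fun j => hermiteCoeff (f₁ j)) fun j => hermiteCoeff (f₂ j))
      (joinSum z.1 z.2) := by
  obtain ⟨scalarEstimate, estimate₁, estimate₂⟩ := H
  obtain ⟨L, hL⟩ := scalarEstimate.exists_bound hl0 hr.le
  obtain ⟨weightIntegrable₁, bound₁⟩ := estimate₁.seqCoeffBound hp hs hh hf₁
  obtain ⟨weightIntegrable₂, bound₂⟩ := estimate₂.seqCoeffBound hp hs hh hf₂
  have hρ : 0 < s * h⁻¹ ^ (1 / (2 * s)) / 2 := by positivity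
  have ae_eq₁ : ∀ᵐ x, ∀ j, f₁ j x = hermiteSeries (hermiteCoeff (f₁ j)) x :=
    ae_all_iff.2 fun j => ae_eq_hermiteSeries (weightIntegrable₁ j) (bound₁.rapidDecay hs hρ j)
  have ae_eq₂ : ∀ᵐ x, ∀ j, f₂ j x = hermiteSeries (hermiteCoeff (f₂ j)) x :=
    ae_all_iff.2 fun j => ae_eq_hermiteSeries (weightIntegrable₂ j) (bound₂.rapidDecay hs hρ j)
  filter_upwards [hexp,
    (Measure.quasiMeasurePreserving_snd (μ := volume) (ν := volume)).ae ae_eq₁,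
    (Measure.quasiMeasurePreserving_fst (μ := volume) (ν := volume)).ae ae_eq₂]
    with z expansion eq₁ eq₂
  refine HasSum.unique expansion ((hermiteSeries_productCoeff_joinSum (lt_min hd₁ hd₂) hs hr hρ
    hl0 hL bound₁ bound₂ z.1 z.2).congr_fun fun j => ?_)
  rw [eq₁, eq₂]

theorem isHermiteSeries_of_expansionEstimates (hK : Continuous K) (hd₁ : 1 ≤ d₁) (hd₂ : 1 ≤ d₂)
    (hp : 1 ≤ p) (hs : 0 < s) (hr : 0 < r) (hh : 0 < h) (hl0 : ∀ j, 0 ≤ l j)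
    (hf₁ : ∀ j, LocallyIntegrable (f₁ j)) (hf₂ : ∀ j, LocallyIntegrable (f₂ j))
    (hexp : ∀ᵐ z, ExpansionAt K l f₁ f₂ z) (H : ExpansionEstimates p s r h l f₁ f₂) :
    IsHermiteSeries (productCoeff l (fun j => hermiteCoeff (f₁ j)) fun j => hermiteCoeff (f₂ j))
      (onSum K) := by
  have rapidDecay := rapidDecay_of_coeffBound hs (by positivity)
    (coeffBound_of_expansionEstimates hd₁ hd₂ hp hs hr hh hl0 hf₁ hf₂ H)
  have eq_everywhere := (Continuous.ae_eq_iff_eq volume hK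
    (rapidDecay.continuous_hermiteSeries.comp continuous_joinSum)).1
    (ae_eq_hermiteSeries_productCoeff hd₁ hd₂ hp hs hr hh hl0 hf₁ hf₂ hexp H)
  intro z
  convert rapidDecay.isHermiteSeries z using 1
  rw [← joinSum_components z, onSum_joinSum, eq_everywhere]
  rfl

theorem onSum_mem_roumieuSpace (hK : Continuous K) (hd₁ : 1 ≤ d₁) (hd₂ : 1 ≤ d₂)
    (hp : 1 ≤ p) (hs : 0 < s)
    (H : HasExpansion K fun l f₁ f₂ => ∃ r > 0, ∃ h > 0, ExpansionEstimates p s r h l f₁ f₂) :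
    onSum K ∈ roumieuSpace (Fin d₂ ⊕ Fin d₁) s := by
  obtain ⟨l, f₁, f₂, hl0, hf₁, hf₂, hexp, r, hr, h, hh, H⟩ := H
  exact ⟨_, ⟨_, by positivity, coeffBound_of_expansionEstimates hd₁ hd₂ hp hs hr hh hl0 hf₁ hf₂ H⟩,
    isHermiteSeries_of_expansionEstimates hK hd₁ hd₂ hp hs hr hh hl0 hf₁ hf₂ hexp H⟩

theorem onSum_mem_beurlingSpace (hK : Continuous K) (hd₁ : 1 ≤ d₁) (hd₂ : 1 ≤ d₂)
    (hp : 1 ≤ p) (hs : 0 < s)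
    (H : HasExpansion K fun l f₁ f₂ => ∀ r > 0, ∀ h > 0, ExpansionEstimates p s r h l f₁ f₂) :
    onSum K ∈ beurlingSpace (Fin d₂ ⊕ Fin d₁) s := by
  obtain ⟨l, f₁, f₂, hl0, hf₁, hf₂, hexp, H⟩ := H
  refine ⟨_, fun R hR => ?_, isHermiteSeries_of_expansionEstimates hK hd₁ hd₂ hp hs one_pos one_pos
    hl0 hf₁ hf₂ hexp (H 1 one_pos 1 one_pos)⟩
  -- `h = Q ^ (-2s)` is the parameter for which the decay rate of the coefficients is `R`.
  set Q : ℝ := 2 * 2 ^ (1 / (2 * s)) * R / s with hQ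
  have Q_pos : 0 < Q := by positivity
  have rate_eq : s * (Q ^ (2 * s))⁻¹⁻¹ ^ (1 / (2 * s)) / 2 / 2 ^ (1 / (2 * s)) = R := by
    rw [inv_inv, ← Real.rpow_mul Q_pos.le, mul_one_div_cancel (by positivity), Real.rpow_one, hQ]
    field_simp
  rw [← rate_eq]
  exact coeffBound_of_expansionEstimates hd₁ hd₂ hp hs one_pos (by positivity) hl0 hf₁ hf₂
    (H 1 one_pos _ (by positivity))

end Expansions

/-! ### Singular systems of compact operators -/

section SingularSystems

open scoped InnerProductSpace
open ContinuousLinearMap (adjoint)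

universe u v

theorem exists_hilbertBasis_mem {𝕜 : Type*} {E : Type u} {J : Type v} [RCLike 𝕜]
    [NormedAddCommGroup E] [InnerProductSpace 𝕜 E] [CompleteSpace E] {V : J → Submodule 𝕜 E}
    [∀ j, CompleteSpace (V j)] (hV : OrthogonalFamily 𝕜 (fun j => V j) fun j => (V j).subtypeₗᵢ)
    (hV' : (⨆ j, V j)ᗮ = ⊥) :
    ∃ (I : Type (max u v)) (b : HilbertBasis I 𝕜 E) (f : I → J), ∀ i, b i ∈ V (f i) := by
  choose w b _ using fun j => exists_hilbertBasis 𝕜 (V j)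
  have hv := hV.orthonormal_sigma_orthonormal fun j => (b j).orthonormal
  refine ⟨Σ j, w j, HilbertBasis.mkOfOrthogonalEqBot hv ?_, Sigma.fst, fun p => ?_⟩
  · refine eq_bot_iff.2 fun x hx => hV' ▸ ?_
    rw [← Submodule.iInf_orthogonal, Submodule.mem_iInf]
    intro j
    have hbx (i : w j) : ⟪(b j i : E), x⟫_𝕜 = 0 :=
      (Submodule.mem_orthogonal ..).1 hx _ (Submodule.subset_span ⟨⟨j, i⟩, rfl⟩)
    rw [← Submodule.orthogonalProjectionOnto_eq_zero_iff]
    refine ((b j).hasSum_orthogonalProjectionOnto x).unique ?_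
    simp only [hbx, zero_smul, hasSum_zero]
  · rw [HilbertBasis.coe_mkOfOrthogonalEqBot]
    exact (b p.1 p.2).2

theorem exists_hilbertBasis_eigenvectors {𝕜 : Type v} {E : Type u} [RCLike 𝕜]
    [NormedAddCommGroup E] [InnerProductSpace 𝕜 E] [CompleteSpace E] {S : E →L[𝕜] E}
    (hS : IsCompactOperator S) (hsym : S.toLinearMap.IsSymmetric) :
    ∃ (I : Type (max u v)) (b : HilbertBasis I 𝕜 E) (μ : I → 𝕜), ∀ i, S (b i) = μ i • b i := by
  have (μ : 𝕜) : CompleteSpace (Module.End.eigenspace S.toLinearMap μ) :=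
    (ContinuousLinearMap.isClosed_eigenspace S μ).completeSpace_coe
  obtain ⟨I, b, μ, hb⟩ := exists_hilbertBasis_mem hsym.orthogonalFamily_eigenspaces
    (ContinuousLinearMap.orthogonalComplement_iSup_eigenspaces_eq_bot hS hsym)
  exact ⟨I, b, μ, fun i => Module.End.mem_eigenspace_iff.1 (hb i)⟩

variable {E : Type u} {F : Type*} [NormedAddCommGroup E] [InnerProductSpace ℂ E]
  [NormedAddCommGroup F] [InnerProductSpace ℂ F] {I J : Type*}

theorem norm_sq_sum_smul {v : I → E} (hv : Orthonormal ℂ v) (c : I → ℂ)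
    (s : Finset I) : ‖∑ i ∈ s, c i • v i‖ ^ 2 = ∑ i ∈ s, ‖c i‖ ^ 2 := by
  simpa using hv.orthogonalFamily.norm_sum c s

theorem exists_sum_smul_eq_zero_of_finrank_lt {𝕜 W : Type*} [DivisionRing 𝕜] [AddCommGroup W]
    [Module 𝕜 W] [FiniteDimensional 𝕜 W] (w : I → W) {s : Finset I}
    (hs : Module.finrank 𝕜 W < s.card) :
    ∃ c : I → 𝕜, ∑ i ∈ s, c i • w i = 0 ∧ ∃ i ∈ s, c i ≠ 0 :=
  not_linearIndepOn_finset_iff.1 fun hw =>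
    hs.not_ge <| by simpa using LinearIndependent.fintype_card_le_finrank hw

/-- A singular value decomposition `T x = ∑ i, σ i ⟪v i, x⟫ u i`, stated weakly and with vanishing
singular values allowed, so that the index set can be enlarged to `ℕ`. -/
structure IsSingularSystem (T : E →L[ℂ] F) (σ : I → ℝ) (v : I → E) (u : I → F) : Prop where
  nonneg : ∀ i, 0 ≤ σ i
  orthonormal_right : Orthonormal ℂ v
  orthonormal_left : Orthonormal ℂ u
  hasSum_inner : ∀ x y, HasSum (fun i => (σ i : ℂ) * (⟪v i, x⟫_ℂ * ⟪y, u i⟫_ℂ)) ⟪y, T x⟫_ℂ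

namespace IsSingularSystem

variable {T : E →L[ℂ] F} {σ : I → ℝ} {v : I → E} {u : I → F} {ε : ℝ}

theorem apply_right (h : IsSingularSystem T σ v u) (i : I) : T (v i) = (σ i : ℂ) • u i := by
  refine ext_inner_left ℂ fun y => (h.hasSum_inner (v i) y).unique ?_
  convert hasSum_single i fun j hj => ?_ using 1
  · rw [inner_smul_right, inner_self_eq_norm_sq_to_K, h.orthonormal_right.1]
    simp
  · rw [h.orthonormal_right.2 hj, zero_mul, mul_zero]

theorem adjoint [CompleteSpace E] [CompleteSpace F] (h : IsSingularSystem T σ v u) :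
    IsSingularSystem (adjoint T) σ u v where
  nonneg := h.nonneg
  orthonormal_right := h.orthonormal_left
  orthonormal_left := h.orthonormal_right
  hasSum_inner y x := by
    rw [ContinuousLinearMap.adjoint_inner_right, ← inner_conj_symm]
    refine (h.hasSum_inner x y).star.congr_fun fun i => ?_
    rw [← starRingEnd_apply, map_mul, map_mul, Complex.conj_ofReal, inner_conj_symm,
      inner_conj_symm, mul_comm ⟪u i, y⟫_ℂ]

theorem comp_equiv (h : IsSingularSystem T σ v u) (e : J ≃ I) :
    IsSingularSystem T (σ ∘ e) (v ∘ e) (u ∘ e) where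
  nonneg i := h.nonneg (e i)
  orthonormal_right := h.orthonormal_right.comp e e.injective
  orthonormal_left := h.orthonormal_left.comp e e.injective
  hasSum_inner x y := e.hasSum_iff.2 (h.hasSum_inner x y)

theorem sumElim_zero (h : IsSingularSystem T σ v u) {v' : J → E} {u' : J → F}
    (hv : Orthonormal ℂ (Sum.elim v v')) (hu : Orthonormal ℂ (Sum.elim u u')) :
    IsSingularSystem T (Sum.elim σ 0) (Sum.elim v v') (Sum.elim u u') where
  nonneg := Sum.forall.2 ⟨h.nonneg, fun _ => le_rfl⟩
  orthonormal_right := hv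
  orthonormal_left := hu
  hasSum_inner x y := by
    refine (Sum.inl_injective.hasSum_iff ?_).1 (h.hasSum_inner x y)
    rintro (i | j) hi
    · exact absurd ⟨i, rfl⟩ hi
    · simp

theorem apply_sum (h : IsSingularSystem T σ v u) (c : I → ℂ) (s : Finset I) :
    T (∑ i ∈ s, c i • v i) = ∑ i ∈ s, (c i * σ i) • u i := by
  simp only [map_sum, map_smul, h.apply_right, smul_smul]

theorem mul_norm_lt_norm_apply_sum (h : IsSingularSystem T σ v u) (hε : 0 ≤ ε) {s : Finset I}
    (hs : ∀ i ∈ s, ε < σ i) {c : I → ℂ} (hc : ∃ i ∈ s, c i ≠ 0) :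
    ε * ‖∑ i ∈ s, c i • v i‖ < ‖T (∑ i ∈ s, c i • v i)‖ := by
  refine lt_of_pow_lt_pow_left₀ 2 (norm_nonneg _) ?_
  rw [h.apply_sum, mul_pow, norm_sq_sum_smul h.orthonormal_right,
    norm_sq_sum_smul h.orthonormal_left, Finset.mul_sum]
  have hterm (i : I) : ‖c i * σ i‖ ^ 2 = σ i ^ 2 * ‖c i‖ ^ 2 := by
    rw [norm_mul, Complex.norm_of_nonneg (h.nonneg i), mul_pow, mul_comm]
  simp only [hterm]
  obtain ⟨i, hi, hci⟩ := hc
  have := norm_pos_iff.2 hci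
  refine Finset.sum_lt_sum (fun j hj => ?_) ⟨i, hi, ?_⟩
  · have := (hs j hj).le
    gcongr
  · have := hs i hi
    gcongr

theorem card_le_finrank (h : IsSingularSystem T σ v u) {W : Type*} [AddCommGroup W] [Module ℂ W]
    [FiniteDimensional ℂ W] (L : E →ₗ[ℂ] W) (hε : 0 ≤ ε) (hL : ∀ x, L x = 0 → ‖T x‖ ≤ ε * ‖x‖)
    {s : Finset I} (hs : ∀ i ∈ s, ε < σ i) : s.card ≤ Module.finrank ℂ W := by
  by_contra! hlt
  obtain ⟨c, hLc, hc⟩ := exists_sum_smul_eq_zero_of_finrank_lt (fun i => L (v i)) hlt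
  refine (h.mul_norm_lt_norm_apply_sum hε hs hc).not_ge (hL _ ?_)
  simpa only [map_sum, map_smul] using hLc

end IsSingularSystem

variable [CompleteSpace E] [CompleteSpace F]

theorem exists_isSingularSystem {T : E →L[ℂ] F} (hT : IsCompactOperator T) :
    ∃ (I : Type u) (σ : I → ℝ) (v : I → E) (u : I → F),
      IsSingularSystem T σ v u ∧ ∀ i, 0 < σ i := by
  have hsym : (adjoint T ∘L T).toLinearMap.IsSymmetric := fun x y => by
    simp [ContinuousLinearMap.adjoint_inner_left, ContinuousLinearMap.adjoint_inner_right]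
  obtain ⟨I, b, μ, hb⟩ := exists_hilbertBasis_eigenvectors (hT.clm_comp (adjoint T)) hsym
  have horth {i j : I} (hij : i ≠ j) : ⟪T (b i), T (b j)⟫_ℂ = 0 := by
    rw [← ContinuousLinearMap.adjoint_inner_right, ← ContinuousLinearMap.comp_apply, hb,
      inner_smul_right, b.orthonormal.2 hij, mul_zero]
  let J := {i : I // T (b i) ≠ 0}
  have hpos (i : J) : 0 < ‖T (b i)‖ := norm_pos_iff.2 i.2
  have hne (i : J) : (‖T (b i)‖ : ℂ) ≠ 0 := by exact_mod_cast (hpos i).ne'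
  refine ⟨J, fun i => ‖T (b i)‖, fun i => b i, fun i => (‖T (b i)‖ : ℂ)⁻¹ • T (b i),
    ⟨fun i => (hpos i).le, b.orthonormal.comp _ Subtype.val_injective,
      ⟨fun i => norm_smul_inv_norm i.2, fun i j hij => ?_⟩, fun x y => ?_⟩, hpos⟩
  · beta_reduce
    rw [inner_smul_left, inner_smul_right, horth (Subtype.val_injective.ne hij), mul_zero, mul_zero]
  · have hsum : HasSum (fun i => ⟪b i, x⟫_ℂ * ⟪y, T (b i)⟫_ℂ) ⟪y, T x⟫_ℂ := by
      refine (((b.hasSum_repr x).mapL T).mapL (innerSL ℂ y)).congr_fun fun i => ?_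
      simp [b.repr_apply_apply]
    have hsub : Function.support (fun i => ⟪b i, x⟫_ℂ * ⟪y, T (b i)⟫_ℂ) ⊆ {i | T (b i) ≠ 0} :=
      fun i hi h0 => hi (by simp [h0])
    refine ((hasSum_subtype_iff_of_support_subset hsub).2 hsum).congr_fun fun i => ?_
    rw [inner_smul_right, mul_left_comm, mul_inv_cancel_left₀ (hne i)]
    rfl

end SingularSystems

/-! ### Singular systems of operators on `ℓ²` -/

local notation "ℓ²(" A ")" => lp (fun _ : A => ℂ) 2

section Enumeration

theorem nonempty_orderIso_nat {α : Type*} [LinearOrder α] [Infinite α]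
    (h : ∀ a : α, (Set.Iio a).Finite) : Nonempty (ℕ ≃o α) := by
  have hmono : StrictMono fun a : α => (Set.Iio a).ncard := fun a b hab =>
    Set.ncard_lt_ncard ⟨Set.Iio_subset_Iio hab.le, fun hba => lt_irrefl a (hba hab)⟩ (h b)
  have := (Set.infinite_range_of_injective hmono.injective).to_subtype
  classical
  exact ⟨(Nat.Subtype.orderIsoOfNat _).trans (hmono.orderIso _).symm⟩

theorem exists_antitone_enumeration {J β : Type*} [Infinite J] [LinearOrder β] (g : J → β)
    (hg : ∀ i, {j | g i ≤ g j}.Finite) : ∃ e : ℕ ≃ J, Antitone (g ∘ e) := by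
  -- Order `J` by decreasing `g`, breaking ties by an arbitrary linear order.
  obtain ⟨_, -⟩ := exists_wellFoundedLT J
  let key : J → βᵒᵈ ×ₗ J := fun i => toLex (OrderDual.toDual (g i), i)
  have hkey : Function.Injective key := fun i j hij => congrArg (fun q => (ofLex q).2) hij
  have hle {i j : J} (hij : key i ≤ key j) : g j ≤ g i :=
    Prod.Lex.monotone_fst (key i) (key j) hij
  let : LinearOrder J := LinearOrder.lift' key hkey
  obtain ⟨e⟩ := nonempty_orderIso_nat fun i : J => (hg i).subset fun j hj => hle (le_of_lt hj)
  exact ⟨e.toEquiv, fun m n hmn => hle (e.monotone hmn)⟩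

end Enumeration

section UnitVectors

open scoped InnerProductSpace

variable {A : Type*}

/-- The `a`-th unit vector of `ℓ²`. -/
def unitVec (a : A) : ℓ²(A) :=
  haveI := Classical.decEq A
  lp.single 2 a (1 : ℂ)

theorem inner_unitVec_left (a : A) (x : ℓ²(A)) : ⟪unitVec a, x⟫_ℂ = x a := by
  classical
  rw [unitVec, lp.inner_single_left]
  simp

theorem inner_unitVec_right (a : A) (x : ℓ²(A)) : ⟪x, unitVec a⟫_ℂ = starRingEnd ℂ (x a) := by
  rw [← inner_conj_symm, inner_unitVec_left]

theorem unitVec_apply_self (a : A) : (unitVec a : ℓ²(A)) a = 1 := by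
  classical exact lp.single_apply_self ..

theorem unitVec_apply_ne {a b : A} (h : b ≠ a) : (unitVec a : ℓ²(A)) b = 0 := by
  classical exact lp.single_apply_ne _ _ _ h

theorem orthonormal_unitVec : Orthonormal ℂ (unitVec : A → ℓ²(A)) := by
  classical
  refine ⟨fun a => (lp.norm_single two_pos _ _).trans norm_one, fun a b hab => ?_⟩
  beta_reduce
  rw [inner_unitVec_left, unitVec_apply_ne hab]

theorem exists_finite_support_orthogonal [Infinite A] (G : Finset ℓ²(A)) :
    ∃ x : ℓ²(A), (Function.support ⇑x).Finite ∧ ‖x‖ = 1 ∧ ∀ g ∈ G, ⟪g, x⟫_ℂ = 0 := by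
  obtain ⟨t, ht⟩ := Infinite.exists_subset_card_eq A (G.card + 1)
  obtain ⟨c, hcG, b, hb, hcb⟩ := exists_sum_smul_eq_zero_of_finrank_lt (𝕜 := ℂ)
    (fun a (g : G) => ⟪(g : ℓ²(A)), unitVec a⟫_ℂ) (s := t) (by simp [ht])
  set x : ℓ²(A) := ∑ a ∈ t, c a • unitVec a with hx
  have hx0 : x ≠ 0 := fun h0 => by
    have hnorm := norm_sq_sum_smul orthonormal_unitVec c t
    rw [← hx, h0, norm_zero, zero_pow two_ne_zero, eq_comm,
      Finset.sum_eq_zero_iff_of_nonneg fun _ _ => by positivity] at hnorm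
    exact hcb (by simpa using hnorm b hb)
  refine ⟨(‖x‖ : ℂ)⁻¹ • x, t.finite_toSet.subset fun a ha => ?_, norm_smul_inv_norm hx0,
    fun g hg => ?_⟩
  · by_contra hat
    refine ha ?_
    have hxa : ⟪unitVec a, x⟫_ℂ = 0 := by
      rw [hx, inner_sum]
      refine Finset.sum_eq_zero fun b hb => ?_
      rw [inner_smul_right, orthonormal_unitVec.2 (ne_of_mem_of_not_mem hb hat).symm, mul_zero]
    rw [← inner_unitVec_left, inner_smul_right, hxa, mul_zero]
  · have hgx : ⟪g, x⟫_ℂ = 0 := by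
      have := congrFun hcG ⟨g, hg⟩
      simpa only [hx, inner_sum, inner_smul_right, Finset.sum_apply, Pi.smul_apply, smul_eq_mul,
        Pi.zero_apply] using this
    rw [inner_smul_right, hgx, mul_zero]

theorem exists_orthonormal_extension [Infinite A] {I : Type*} [Finite I] {v : I → ℓ²(A)}
    (hv : Orthonormal ℂ v) :
    ∃ w : ℕ → ℓ²(A), (∀ n, (Function.support ⇑(w n)).Finite) ∧
      Orthonormal ℂ (Sum.elim v w) := by
  classical
  obtain ⟨w, hw, hww⟩ := exists_seq_of_forall_finset_exists
    (fun y : ℓ²(A) => (Function.support ⇑y).Finite ∧ ‖y‖ = 1 ∧ ∀ i, ⟪v i, y⟫_ℂ = 0)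
    (fun x y => ⟪x, y⟫_ℂ = 0) fun S _ => by
      obtain ⟨y, hfin, hnorm, horth⟩ :=
        exists_finite_support_orthogonal ((Set.finite_range v).toFinset ∪ S)
      exact ⟨y, ⟨hfin, hnorm, fun i => horth _ (by simp)⟩, fun x hx => horth _ (by simp [hx])⟩
  refine ⟨w, fun n => (hw n).1, Sum.forall.2 ⟨hv.1, fun n => (hw n).2.1⟩, ?_⟩
  rintro (i | n) (j | m) hij
  · exact hv.2 fun h => hij (h ▸ rfl)
  · exact (hw m).2.2 i
  · exact inner_eq_zero_symm.1 ((hw n).2.2 j)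
  · rcases lt_or_gt_of_ne fun h => hij (congrArg Sum.inr h) with h | h
    · exact hww _ _ h
    · exact inner_eq_zero_symm.1 (hww _ _ h)

end UnitVectors

section InfiniteSingularSystems

open scoped InnerProductSpace

theorem IsSingularSystem.finite_setOf_le {E F I : Type*} [NormedAddCommGroup E]
    [InnerProductSpace ℂ E] [NormedAddCommGroup F] [InnerProductSpace ℂ F] {T : E →L[ℂ] F}
    {σ : I → ℝ} {v : I → E} {u : I → F} (h : IsSingularSystem T σ v u) (hT : IsCompactOperator T)
    {ε : ℝ} (hε : 0 < ε) : {i | ε ≤ σ i}.Finite := by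
  have hsep {i j : I} (hij : i ≠ j) : σ i ≤ ‖T (v i) - T (v j)‖ := by
    have hinner : ⟪u i, T (v i) - T (v j)⟫_ℂ = σ i := by
      rw [h.apply_right, h.apply_right, inner_sub_right, inner_smul_right, inner_smul_right,
        h.orthonormal_left.2 hij, inner_self_eq_norm_sq_to_K, h.orthonormal_left.1]
      simp
    calc σ i = ‖⟪u i, T (v i) - T (v j)⟫_ℂ‖ := by
          rw [hinner, Complex.norm_of_nonneg (h.nonneg i)]
      _ ≤ ‖u i‖ * ‖T (v i) - T (v j)‖ := norm_inner_le_norm _ _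
      _ = ‖T (v i) - T (v j)‖ := by rw [h.orthonormal_left.1, one_mul]
  obtain ⟨t, ht, hcover⟩ := Metric.totallyBounded_iff.1
    (hT.isCompact_closure_image_closedBall 1).totallyBounded (ε / 2) (half_pos hε)
  have hmem (i : I) : ∃ y ∈ t, dist (T (v i)) y < ε / 2 := by
    have : T (v i) ∈ closure (T '' Metric.closedBall 0 1) :=
      subset_closure ⟨v i, by simp [h.orthonormal_right.1], rfl⟩
    simpa using hcover this
  choose center hcenter hdist using hmem
  by_contra hinf
  obtain ⟨i, hi, j, -, hij, hc⟩ := Set.Infinite.exists_ne_map_eq_of_mapsTo hinf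
    (fun i _ => hcenter i) ht
  have hlt : ‖T (v i) - T (v j)‖ < ε / 2 + ε / 2 := by
    rw [← dist_eq_norm]
    exact (dist_triangle_right _ _ _).trans_lt (add_lt_add (hdist i) (hc ▸ hdist j))
  rw [add_halves] at hlt
  exact (hi.trans (hsep hij)).not_gt hlt

variable {A B : Type*} [Infinite A] [Infinite B] {T : ℓ²(A) →L[ℂ] ℓ²(B)}

theorem IsSingularSystem.exists_nat_of_finite {I : Type*} [Finite I] {σ : I → ℝ}
    {v : I → ℓ²(A)} {u : I → ℓ²(B)} (h : IsSingularSystem T σ v u) (hσ : ∀ i, 0 < σ i) :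
    ∃ (σ' : ℕ → ℝ) (v' : ℕ → ℓ²(A)) (u' : ℕ → ℓ²(B)),
      IsSingularSystem T σ' v' u' ∧ Antitone σ' ∧ ∀ j, σ' j = 0 →
        (Function.support ⇑(v' j)).Finite ∧ (Function.support ⇑(u' j)).Finite := by
  obtain ⟨w, hw, hvw⟩ := exists_orthonormal_extension h.orthonormal_right
  obtain ⟨z, hz, huz⟩ := exists_orthonormal_extension h.orthonormal_left
  -- Spreading the zero singular values over `0, -1, -2, …` makes all superlevel sets finite.
  let key : I ⊕ ℕ → ℝ := Sum.elim σ fun n => -(n : ℝ)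
  have hkey : Sum.elim σ 0 = fun i => max (key i) 0 := by
    ext (i | n)
    · exact (max_eq_left (hσ i).le).symm
    · exact (max_eq_right (by simp [key])).symm
  have hlevel (i : I ⊕ ℕ) : {j | key i ≤ key j}.Finite := by
    obtain ⟨N, hN⟩ := exists_nat_gt (-key i)
    refine ((Set.finite_range Sum.inl).union ((Set.finite_Iio N).image Sum.inr)).subset ?_
    rintro (j | n) (hj : key i ≤ _)
    · exact Or.inl ⟨j, rfl⟩
    · have : (n : ℝ) < N := (le_neg.1 hj).trans_lt hN
      exact Or.inr ⟨n, by exact_mod_cast this, rfl⟩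
  obtain ⟨e, he⟩ := exists_antitone_enumeration key hlevel
  refine ⟨_, _, _, (h.sumElim_zero hvw huz).comp_equiv e, ?_, fun j => ?_⟩
  · rw [hkey]
    exact fun m n hmn => max_le_max_right 0 (he hmn)
  · simp only [Function.comp_apply]
    rcases e j with i | n
    · exact fun h0 => absurd h0 (hσ i).ne'
    · exact fun _ => ⟨hw n, hz n⟩

theorem exists_isSingularSystem_nat (hT : IsCompactOperator T) :
    ∃ (σ : ℕ → ℝ) (v : ℕ → ℓ²(A)) (u : ℕ → ℓ²(B)),
      IsSingularSystem T σ v u ∧ Antitone σ ∧ ∀ j, σ j = 0 →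
        (Function.support ⇑(v j)).Finite ∧ (Function.support ⇑(u j)).Finite := by
  obtain ⟨I, σ, v, u, h, hσ⟩ := exists_isSingularSystem hT
  rcases finite_or_infinite I with _ | _
  · exact h.exists_nat_of_finite hσ
  · obtain ⟨e, he⟩ := exists_antitone_enumeration σ fun i => h.finite_setOf_le hT (hσ i)
    exact ⟨_, _, _, h.comp_equiv e, he, fun j hj => absurd hj (hσ (e j)).ne'⟩

end InfiniteSingularSystems

/-! ### Operators given by decaying matrices -/

section MatrixOperator

open scoped InnerProductSpace
open ContinuousLinearMap (adjoint)

theorem isCompactOperator_rankOne {E F : Type*} [NormedAddCommGroup E] [InnerProductSpace ℂ E]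
    [NormedAddCommGroup F] [InnerProductSpace ℂ F] (x : E) (y : F) :
    IsCompactOperator (InnerProductSpace.rankOne ℂ x y) :=
  (isCompactOperator_of_locallyCompactSpace_dom (innerSL ℂ y)).clm_comp
    (ContinuousLinearMap.toSpanSingleton ℂ x)

variable {A B : Type*} {c : B × A → ℂ}

/-- The operator on `ℓ²` with a matrix of absolutely summable entries. -/
def matrixOp (c : B × A → ℂ) : ℓ²(A) →L[ℂ] ℓ²(B) :=
  ∑' q, c q • InnerProductSpace.rankOne ℂ (unitVec q.1) (unitVec q.2)

/-- The conjugate transpose of a matrix whose entries are indexed by pairs. -/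
def conjSwap (c : B × A → ℂ) (q : A × B) : ℂ := starRingEnd ℂ (c q.swap)

theorem norm_conjSwap (c : B × A → ℂ) (q : A × B) : ‖conjSwap c q‖ = ‖c q.swap‖ :=
  RCLike.norm_conj _

theorem hasSum_matrixOp (hc : Summable fun q => ‖c q‖) :
    HasSum (fun q => c q • InnerProductSpace.rankOne ℂ (unitVec q.1) (unitVec q.2))
      (matrixOp c) := by
  refine (Summable.of_norm_bounded hc fun q => ?_).hasSum
  rw [norm_smul, InnerProductSpace.norm_rankOne, orthonormal_unitVec.1, orthonormal_unitVec.1,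
    mul_one, mul_one]

theorem hasSum_matrixOp_apply (hc : Summable fun q => ‖c q‖) (x : ℓ²(A)) :
    HasSum (fun q => (c q * x q.2) • unitVec q.1) (matrixOp c x) := by
  refine ((hasSum_matrixOp hc).mapL (ContinuousLinearMap.apply ℂ _ x)).congr_fun fun q => ?_
  simp [inner_unitVec_left, smul_smul]

theorem isCompactOperator_matrixOp (hc : Summable fun q => ‖c q‖) :
    IsCompactOperator (matrixOp c) := by
  refine isCompactOperator_of_tendsto (hasSum_matrixOp hc) (Filter.Eventually.of_forall fun s => ?_)
  have partialSum_mem : ∑ q ∈ s, c q • InnerProductSpace.rankOne ℂ (unitVec q.1) (unitVec q.2) ∈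
      compactOperator (RingHom.id ℂ) ℓ²(A) ℓ²(B) := by
    exact Submodule.sum_mem _ fun q _ =>
      Submodule.smul_mem _ _ (isCompactOperator_rankOne (unitVec q.1) (unitVec q.2))
  exact partialSum_mem

theorem inner_matrixOp (hc : Summable fun q => ‖c q‖) (a : A) (b : B) :
    ⟪unitVec b, matrixOp c (unitVec a)⟫_ℂ = c (b, a) := by
  refine ((hasSum_matrixOp_apply hc (unitVec a)).mapL (innerSL ℂ (unitVec b))).unique ?_
  convert hasSum_single (b, a) fun q hq => ?_
  · simp [unitVec_apply_self, orthonormal_unitVec.1]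
  · rw [innerSL_apply_apply, inner_smul_right]
    by_cases ha : q.2 = a
    · have hb : b ≠ q.1 := fun hb => hq (Prod.ext hb.symm ha)
      rw [orthonormal_unitVec.2 hb, mul_zero]
    · rw [unitVec_apply_ne ha, mul_zero, zero_mul]

theorem adjoint_matrixOp (hc : Summable fun q => ‖c q‖) :
    adjoint (matrixOp c) = matrixOp (conjSwap c) := by
  have adjoint_sum := (hasSum_matrixOp hc).map
    (adjoint (𝕜 := ℂ) (E := ℓ²(A)) (F := ℓ²(B))) adjoint.continuous
  have hc' : Summable fun q => ‖conjSwap c q‖ := by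
    simp only [norm_conjSwap]
    exact (Equiv.prodComm A B).summable_iff.2 hc
  have transposed_sum := (Equiv.prodComm B A).hasSum_iff.2 (hasSum_matrixOp hc')
  refine adjoint_sum.unique (transposed_sum.congr_fun fun q => ?_)
  simp [conjSwap, map_smulₛₗ]

theorem norm_matrixOp_apply_le {w₁ : A → ℝ} {w₂ : B → ℝ} {C : ℝ} (hw₁ : Summable w₁)
    (hw₂ : Summable w₂) (h₁ : ∀ a, 0 ≤ w₁ a) (h₂ : ∀ b, 0 ≤ w₂ b)
    (hcw : ∀ q, ‖c q‖ ≤ C * (w₂ q.1 * w₁ q.2)) (x : ℓ²(A)) :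
    ‖matrixOp c x‖ ≤ C * (∑' b, w₂ b) * ∑' a, w₁ a * ‖x a‖ := by
  have hc : Summable fun q => ‖c q‖ := Summable.of_nonneg_of_le (fun _ => norm_nonneg _) hcw
    ((hw₂.mul_of_nonneg hw₁ h₂ h₁).mul_left C)
  have hx : Summable fun a => w₁ a * ‖x a‖ := Summable.of_nonneg_of_le
    (fun a => mul_nonneg (h₁ a) (norm_nonneg _))
    (fun a => mul_le_mul_of_nonneg_left (lp.norm_apply_le_norm two_ne_zero x a) (h₁ a))
    (hw₁.mul_right _)
  have hx0 (a : A) : 0 ≤ w₁ a * ‖x a‖ := mul_nonneg (h₁ a) (norm_nonneg _)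
  have majorant_sum := (hw₂.hasSum.mul hx.hasSum (hw₂.mul_of_nonneg hx h₂ hx0)).mul_left C
  rw [mul_assoc, ← (hasSum_matrixOp_apply hc x).tsum_eq]
  refine tsum_of_norm_bounded majorant_sum fun q => ?_
  calc ‖(c q * x q.2) • (unitVec q.1 : ℓ²(B))‖ = ‖c q‖ * ‖x q.2‖ := by
        rw [norm_smul, orthonormal_unitVec.1, mul_one, norm_mul]
    _ ≤ C * (w₂ q.1 * w₁ q.2) * ‖x q.2‖ := mul_le_mul_of_nonneg_right (hcw q) (norm_nonneg _)
    _ = C * (w₂ q.1 * (w₁ q.2 * ‖x q.2‖)) := by ring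

theorem IsSingularSystem.singularValue_le_of_vanishing {T : ℓ²(A) →L[ℂ] ℓ²(B)} {σ : ℕ → ℝ}
    {v : ℕ → ℓ²(A)} {u : ℕ → ℓ²(B)} (h : IsSingularSystem T σ v u) (hσ : Antitone σ)
    (t : Finset A) {ε : ℝ} (hε : 0 ≤ ε)
    (hT : ∀ x : ℓ²(A), (∀ a ∈ t, x a = 0) → ‖T x‖ ≤ ε * ‖x‖) {j : ℕ} (hj : t.card ≤ j) :
    σ j ≤ ε := by
  by_contra! hlt
  let restrict : ℓ²(A) →ₗ[ℂ] t → ℂ :=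
    LinearMap.pi fun a => (innerSL ℂ (unitVec (a : A))).toLinearMap
  have hrestrict (x : ℓ²(A)) (hx : restrict x = 0) : ‖T x‖ ≤ ε * ‖x‖ := hT x fun a ha => by
    rw [← inner_unitVec_left]
    exact congrFun hx ⟨a, ha⟩
  have hcard := h.card_le_finrank restrict hε hrestrict (s := Finset.range (j + 1)) fun i hi =>
    hlt.trans_le (hσ (Finset.mem_range_succ_iff.1 hi))
  rw [Finset.card_range, Module.finrank_fintype_fun_eq_card, Fintype.card_coe] at hcard
  lia

end MatrixOperator

section SingularValueDecay

open scoped InnerProductSpace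

variable {ι κ : Type*} [Fintype ι] [Fintype κ] {s ρ r : ℝ} {c : (κ → ℕ) × (ι → ℕ) → ℂ}

/-- Matrix entries `c (α, β)` that decay as `exp(-ρ (|α|^(1/(2s)) + |β|^(1/(2s))))`. -/
def MatrixDecay (s ρ : ℝ) (c : (κ → ℕ) × (ι → ℕ) → ℂ) : Prop :=
  ∃ C : ℝ, 0 ≤ C ∧ ∀ q, ‖c q‖ ≤ C * (expDecay s ρ q.1 * expDecay s ρ q.2)

theorem CoeffBound.matrixDecay {c : (κ ⊕ ι → ℕ) → ℂ} (hc : CoeffBound s r c) (hs : 0 < s)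
    (hr : 0 ≤ r) :
    MatrixDecay s (r / 2) fun q : (κ → ℕ) × (ι → ℕ) => c (Sum.elim q.1 q.2) := by
  obtain ⟨C, hC⟩ := hc
  refine ⟨|C|, abs_nonneg C, fun q => (hC _).trans ?_⟩
  have hlen : ((∑ i, Sum.elim q.1 q.2 i : ℕ) : ℝ) = len q.1 + len q.2 :=
    len_sum (Sum.elim q.1 q.2)
  have := rpow_add_rpow_le (len_nonneg q.1) (len_nonneg q.2) (show 0 ≤ 1 / (2 * s) by positivity)
  rw [hlen, expDecay, expDecay, ← Real.exp_add]
  refine mul_le_mul (le_abs_self C) (Real.exp_le_exp.2 ?_) (Real.exp_pos _).le (abs_nonneg C)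
  nlinarith

theorem summable_expDecay (hs : 0 < s) (hρ : 0 < ρ) :
    Summable fun α : ι → ℕ => expDecay s ρ α := by
  simpa only [expDecay, pow_zero, one_mul] using
    summable_pow_mul_exp_neg_len (ι := ι) hρ (show 0 < 1 / (2 * s) by positivity) 0

theorem tsum_expDecay_mul_norm_le (hs : 0 < s) (hρ : 0 < ρ) (n : ℕ) (x : ℓ²(ι → ℕ))
    (hx : ∀ α : ι → ℕ, (∀ i, α i < n) → x α = 0) :
    ∑' α : ι → ℕ, expDecay s ρ α * ‖x α‖ ≤
      Real.exp (-(ρ / 2) * (n : ℝ) ^ (1 / (2 * s))) *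
        (∑' α : ι → ℕ, expDecay s (ρ / 2) α) * ‖x‖ := by
  have majorant_summable := ((summable_expDecay (ι := ι) hs (half_pos hρ)).mul_left
    (Real.exp (-(ρ / 2) * (n : ℝ) ^ (1 / (2 * s))))).mul_right ‖x‖
  rw [← tsum_mul_left, ← tsum_mul_right]
  have hle (α : ι → ℕ) : expDecay s ρ α * ‖x α‖ ≤
      Real.exp (-(ρ / 2) * (n : ℝ) ^ (1 / (2 * s))) * expDecay s (ρ / 2) α * ‖x‖ := by
    have := expDecay_pos s (ρ / 2) α
    by_cases hα : ∀ i, α i < n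
    · rw [hx α hα, norm_zero, mul_zero]
      positivity
    · push Not at hα
      obtain ⟨i, hi⟩ := hα
      have hn : (n : ℝ) ^ (1 / (2 * s)) ≤ len α ^ (1 / (2 * s)) :=
        Real.rpow_le_rpow (by positivity) ((Nat.cast_le.2 hi).trans (coord_le_len α i))
          (by positivity)
      have hhalf : expDecay s (ρ / 2) α ≤ Real.exp (-(ρ / 2) * (n : ℝ) ^ (1 / (2 * s))) :=
        Real.exp_le_exp.2 (by nlinarith)
      rw [← expDecay_half_mul_self]
      gcongr
      exact lp.norm_apply_le_norm two_ne_zero x α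
  exact Summable.tsum_le_tsum hle
    (Summable.of_nonneg_of_le (fun α => mul_nonneg (expDecay_pos s ρ α).le (norm_nonneg _)) hle
      majorant_summable) majorant_summable

theorem exp_neg_mul_nthRoot_le {d : ℕ} {τ : ℝ} (hd : 0 < d) (hs : 0 < s) (hτ : 0 ≤ τ) (j : ℕ) :
    Real.exp (-τ * (Nat.nthRoot d j : ℝ) ^ (1 / (2 * s))) ≤
      Real.exp τ / expWeight d s (τ / 2 ^ (1 / (2 * s))) j := by
  rw [expWeight, ← Real.exp_sub, Real.exp_le_exp]
  set n := Nat.nthRoot d j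
  set a := 1 / (2 * s) with ha
  have : (0 : ℝ) < d := by exact_mod_cast hd
  have hj : ((j : ℝ) + 1) ≤ ((n : ℝ) + 1) ^ d := by
    exact_mod_cast Nat.lt_pow_nthRoot_add_one hd.ne' j
  have hroot : ((j : ℝ) + 1) ^ (1 / (2 * d * s)) ≤ 2 ^ a * ((n : ℝ) ^ a + 1) := by
    calc ((j : ℝ) + 1) ^ (1 / (2 * d * s))
        ≤ (((n : ℝ) + 1) ^ d) ^ (1 / (2 * d * s)) := by gcongr
      _ = ((n : ℝ) + 1) ^ a := by
          rw [← Real.rpow_natCast, ← Real.rpow_mul (by positivity), ha]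
          congr 1
          field_simp
      _ ≤ 2 ^ a * ((n : ℝ) ^ a + 1 ^ a) :=
          rpow_add_le_mul n.cast_nonneg zero_le_one (by positivity)
      _ = 2 ^ a * ((n : ℝ) ^ a + 1) := by rw [Real.one_rpow]
  have : τ / 2 ^ a * ((j : ℝ) + 1) ^ (1 / (2 * d * s)) ≤ τ * ((n : ℝ) ^ a + 1) := by
    rw [div_mul_eq_mul_div, div_le_iff₀ (by positivity)]
    exact (mul_le_mul_of_nonneg_left hroot hτ).trans_eq (by ring)
  linarith

namespace MatrixDecay

theorem conjSwap (hc : MatrixDecay s ρ c) : MatrixDecay s ρ (conjSwap c) := by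
  obtain ⟨C, hC0, hC⟩ := hc
  refine ⟨C, hC0, fun q => ?_⟩
  rw [norm_conjSwap, mul_comm (expDecay s ρ q.1)]
  exact hC q.swap

theorem summable_norm (hc : MatrixDecay s ρ c) (hs : 0 < s) (hρ : 0 < ρ) :
    Summable fun q => ‖c q‖ := by
  obtain ⟨C, -, hC⟩ := hc
  exact Summable.of_nonneg_of_le (fun _ => norm_nonneg _) hC
    (((summable_expDecay hs hρ).mul_of_nonneg (summable_expDecay hs hρ)
      (fun _ => (expDecay_pos ..).le) fun _ => (expDecay_pos ..).le).mul_left C)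

theorem exists_norm_matrixOp_apply_le (hc : MatrixDecay s ρ c) (hs : 0 < s) (hρ : 0 < ρ) :
    ∃ D : ℝ, 0 ≤ D ∧ ∀ x : ℓ²(ι → ℕ),
      ‖matrixOp c x‖ ≤ D * ∑' α, expDecay s ρ α * ‖x α‖ := by
  obtain ⟨C, hC0, hC⟩ := hc
  exact ⟨_, mul_nonneg hC0 (tsum_nonneg fun _ => (expDecay_pos ..).le),
    norm_matrixOp_apply_le (summable_expDecay hs hρ) (summable_expDecay hs hρ)
      (fun _ => (expDecay_pos ..).le) (fun _ => (expDecay_pos ..).le) hC⟩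

theorem exists_singularValue_le [Nonempty ι] (hc : MatrixDecay s ρ c) (hs : 0 < s) (hρ : 0 < ρ)
    {σ : ℕ → ℝ} {v : ℕ → ℓ²(ι → ℕ)} {u : ℕ → ℓ²(κ → ℕ)} (h : IsSingularSystem (matrixOp c) σ v u)
    (hσ : Antitone σ) :
    ∃ D : ℝ, 0 ≤ D ∧
      ∀ j, σ j ≤ D / expWeight (Fintype.card ι) s (ρ / 2 / 2 ^ (1 / (2 * s))) j := by
  obtain ⟨D, hD0, hD⟩ := hc.exists_norm_matrixOp_apply_le hs hρ
  set W := D * ∑' α : ι → ℕ, expDecay s (ρ / 2) α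
  have hW0 : 0 ≤ W := mul_nonneg hD0 (tsum_nonneg fun _ => (expDecay_pos ..).le)
  refine ⟨W * Real.exp (ρ / 2), by positivity, fun j => ?_⟩
  set n := Nat.nthRoot (Fintype.card ι) j
  classical
  -- `matrixOp c` is small on the vectors vanishing on this box of `n ^ card ι ≤ j` indices.
  let box : Finset (ι → ℕ) := Fintype.piFinset fun _ => Finset.range n
  have hcard : box.card ≤ j := by
    rw [show box.card = n ^ Fintype.card ι by simp [box]]
    exact Nat.pow_nthRoot_le (.inl Fintype.card_ne_zero)
  have hbox (x : ℓ²(ι → ℕ)) (hx : ∀ α ∈ box, x α = 0) :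
      ‖matrixOp c x‖ ≤ W * Real.exp (-(ρ / 2) * (n : ℝ) ^ (1 / (2 * s))) * ‖x‖ := by
    have := tsum_expDecay_mul_norm_le hs hρ n x fun α hα => hx α (by simpa [box] using hα)
    refine (hD x).trans ((mul_le_mul_of_nonneg_left this hD0).trans_eq ?_)
    ring
  calc σ j ≤ W * Real.exp (-(ρ / 2) * (n : ℝ) ^ (1 / (2 * s))) :=
        h.singularValue_le_of_vanishing hσ box (by positivity) hbox hcard
    _ ≤ W * (Real.exp (ρ / 2) / expWeight _ s (ρ / 2 / 2 ^ (1 / (2 * s))) j) := by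
        gcongr
        exact exp_neg_mul_nthRoot_le Fintype.card_pos hs (half_pos hρ).le j
    _ = _ := (mul_div_assoc ..).symm

theorem exists_mul_norm_singularVector_le (hc : MatrixDecay s ρ c) (hs : 0 < s) (hρ : 0 < ρ)
    {σ : ℕ → ℝ} {v : ℕ → ℓ²(ι → ℕ)} {u : ℕ → ℓ²(κ → ℕ)}
    (h : IsSingularSystem (matrixOp c) σ v u) :
    ∃ D : ℝ, 0 ≤ D ∧ ∀ j β, σ j * ‖v j β‖ ≤ D * expDecay s ρ β := by
  obtain ⟨D, hD0, hD⟩ := hc.exists_norm_matrixOp_apply_le hs hρ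
  refine ⟨D, hD0, fun j β => ?_⟩
  have hcoord : ((σ j : ℂ) • v j) β = starRingEnd ℂ ⟪u j, matrixOp c (unitVec β)⟫_ℂ := by
    rw [← h.adjoint.apply_right, ← inner_unitVec_left, ContinuousLinearMap.adjoint_inner_right,
      inner_conj_symm]
  calc σ j * ‖v j β‖ = ‖((σ j : ℂ) • v j) β‖ := by
        rw [lp.coeFn_smul, Pi.smul_apply, norm_smul, Complex.norm_of_nonneg (h.nonneg j)]
    _ = ‖⟪u j, matrixOp c (unitVec β)⟫_ℂ‖ := by rw [hcoord, RCLike.norm_conj]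
    _ ≤ ‖u j‖ * ‖matrixOp c (unitVec β)‖ := norm_inner_le_norm _ _
    _ = ‖matrixOp c (unitVec β)‖ := by rw [h.orthonormal_left.1, one_mul]
    _ ≤ D * ∑' α, expDecay s ρ α * ‖(unitVec β : ℓ²(ι → ℕ)) α‖ := hD _
    _ = D * expDecay s ρ β := by
        rw [tsum_eq_single β fun α hα => by rw [unitVec_apply_ne hα, norm_zero, mul_zero],
          unitVec_apply_self, norm_one, mul_one]

end MatrixDecay

end SingularValueDecay

/-! ### Distributing the singular values -/

section Scaling

variable {ι κ : Type*} [Fintype ι] [Fintype κ] {d : ℕ} {s r ρ : ℝ}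

theorem exists_pos_le_mul_exp (Q : ℕ → ℝ) (hQ : ∀ j, 0 ≤ Q j) :
    ∃ ε : ℕ → ℝ, (∀ j, 0 < ε j) ∧
      ∀ R : ℝ, 0 ≤ R → ∃ C : ℝ, 0 ≤ C ∧ ∀ j, ε j ≤ C * Real.exp (-R * Q j) := by
  refine ⟨fun j => Real.exp (-(j : ℝ) * Q j), fun j => Real.exp_pos _, fun R hR =>
    ⟨Real.exp (R * ∑ i ∈ Finset.range ⌈R⌉₊, Q i), (Real.exp_pos _).le, fun j => ?_⟩⟩
  have sum_nonneg : 0 ≤ ∑ i ∈ Finset.range ⌈R⌉₊, Q i := Finset.sum_nonneg fun i _ => hQ i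
  have := hQ j
  rw [← Real.exp_add, Real.exp_le_exp]
  rcases lt_or_ge j ⌈R⌉₊ with hj | hj
  · have : Q j ≤ ∑ i ∈ Finset.range ⌈R⌉₊, Q i :=
      Finset.single_le_sum (fun i _ => hQ i) (Finset.mem_range.2 hj)
    have : 0 ≤ (j : ℝ) * Q j := by positivity
    nlinarith
  · have : R ≤ j := Nat.ceil_le.1 hj
    nlinarith [mul_nonneg hR sum_nonneg]

theorem exists_scaling_of_finite_support (d : ℕ) (hs : 0 < s) {P : ℕ → Prop}
    {v : ℕ → (ι → ℕ) → ℂ} (hv : ∀ j, P j → (Function.support (v j)).Finite) :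
    ∃ ε : ℕ → ℝ, (∀ j, 0 < ε j) ∧ ∀ R : ℝ, 0 ≤ R → ∃ C : ℝ, ∀ j, P j →
      ∀ α ∈ Function.support (v j), ε j ≤ C / expWeight d s R j * expDecay s R α := by
  have hlen (j : ℕ) : ∃ M : ℝ, 0 ≤ M ∧ (P j → ∀ α ∈ Function.support (v j), len α ≤ M) := by
    by_cases hj : P j
    · obtain ⟨M, hM⟩ := ((hv j hj).image len).bddAbove
      exact ⟨max M 0, le_max_right _ _, fun _ α hα =>
        (hM (Set.mem_image_of_mem _ hα)).trans (le_max_left _ _)⟩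
    · exact ⟨0, le_rfl, fun hj' => absurd hj' hj⟩
  choose M hM0 hM using hlen
  obtain ⟨ε, hε, hεR⟩ := exists_pos_le_mul_exp
    (fun j => M j ^ (1 / (2 * s)) + ((j : ℝ) + 1) ^ (1 / (2 * d * s)))
    fun j => add_nonneg (Real.rpow_nonneg (hM0 j) _) (by positivity)
  refine ⟨ε, hε, fun R hR => ?_⟩
  obtain ⟨C, hC0, hC⟩ := hεR R hR
  refine ⟨C, fun j hj α hα => (hC j).trans ?_⟩
  have := Real.rpow_le_rpow (len_nonneg α) (hM j hj α hα) (show 0 ≤ 1 / (2 * s) by positivity)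
  rw [div_mul_eq_mul_div, mul_div_assoc, expDecay, expWeight, ← Real.exp_sub]
  gcongr
  nlinarith

/-- Positive factors `θ j` by which the singular vectors `v j` of singular values `σ j` are to be
multiplied: with `θ j = (σ j)^(1/4)`, a quarter of the singular value goes to each of the two
singular vectors and half of it to the scalar factor of the expansion. Where `σ j = 0`, the factor
only has to be so small that no decay is lost. -/
structure IsSingularScaling (d : ℕ) (s : ℝ) (σ θ : ℕ → ℝ) (v : ℕ → (ι → ℕ) → ℂ) : Prop where
  pos : ∀ j, 0 < θ j
  eq_rpow : ∀ j, σ j ≠ 0 → θ j = σ j ^ (1 / 4 : ℝ)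
  le_of_eq_zero : ∀ R : ℝ, 0 ≤ R → ∃ C : ℝ, ∀ j, σ j = 0 →
    ∀ α ∈ Function.support (v j), θ j ≤ C / expWeight d s R j * expDecay s R α

theorem exists_isSingularScaling (d : ℕ) (hs : 0 < s) {σ : ℕ → ℝ} (hσ : ∀ j, 0 ≤ σ j)
    {v : ℕ → (ι → ℕ) → ℂ} {u : ℕ → (κ → ℕ) → ℂ}
    (hfin : ∀ j, σ j = 0 → (Function.support (v j)).Finite ∧ (Function.support (u j)).Finite) :
    ∃ θ : ℕ → ℝ, IsSingularScaling d s σ θ v ∧ IsSingularScaling d s σ θ u := by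
  obtain ⟨εv, hεv0, hεv⟩ := exists_scaling_of_finite_support d hs fun j hj => (hfin j hj).1
  obtain ⟨εu, hεu0, hεu⟩ := exists_scaling_of_finite_support d hs fun j hj => (hfin j hj).2
  let θ : ℕ → ℝ := fun j => if σ j = 0 then min (εv j) (εu j) else σ j ^ (1 / 4 : ℝ)
  have hθ0 (j : ℕ) : 0 < θ j := by
    by_cases hj : σ j = 0
    · simpa [θ, hj] using ⟨hεv0 j, hεu0 j⟩
    · simpa [θ, hj] using Real.rpow_pos_of_pos ((hσ j).lt_of_ne' hj) _
  have hθσ (j : ℕ) (hj : σ j ≠ 0) : θ j = σ j ^ (1 / 4 : ℝ) := if_neg hj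
  have hθε (j : ℕ) (hj : σ j = 0) : θ j = min (εv j) (εu j) := if_pos hj
  refine ⟨θ, ⟨hθ0, hθσ, fun R hR => ?_⟩, ⟨hθ0, hθσ, fun R hR => ?_⟩⟩
  · obtain ⟨C, hC⟩ := hεv R hR
    exact ⟨C, fun j hj α hα =>
      (hθε j hj).trans_le ((min_le_left _ _).trans (hC j hj α hα))⟩
  · obtain ⟨C, hC⟩ := hεu R hR
    exact ⟨C, fun j hj α hα =>
      (hθε j hj).trans_le ((min_le_right _ _).trans (hC j hj α hα))⟩

theorem IsSingularScaling.sqrt_mul_mul_self {σ θ : ℕ → ℝ} {v : ℕ → (ι → ℕ) → ℂ}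
    (hθ : IsSingularScaling d s σ θ v) {j : ℕ} (hσ : 0 ≤ σ j) :
    σ j ^ (1 / 2 : ℝ) * (θ j * θ j) = σ j := by
  by_cases hj : σ j = 0
  · rw [hj, Real.zero_rpow (by norm_num), zero_mul]
  · rw [hθ.eq_rpow j hj, ← Real.rpow_add_of_nonneg hσ (by norm_num) (by norm_num),
      ← Real.rpow_add_of_nonneg hσ (by norm_num) (by norm_num)]
    norm_num

theorem expWeight_rpow (d : ℕ) (s r a : ℝ) (j : ℕ) :
    expWeight d s r j ^ a = expWeight d s (r * a) j := by
  rw [expWeight, expWeight, ← Real.exp_mul]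
  ring_nf

theorem expDecay_rpow (s ρ a : ℝ) (α : ι → ℕ) : expDecay s ρ α ^ a = expDecay s (ρ * a) α := by
  rw [expDecay, expDecay, ← Real.exp_mul]
  ring_nf

theorem expDecay_anti (s : ℝ) {ρ ρ' : ℝ} (hρ : ρ ≤ ρ') (α : ι → ℕ) :
    expDecay s ρ' α ≤ expDecay s ρ α := by
  have := Real.rpow_nonneg (len_nonneg α) (1 / (2 * s))
  unfold expDecay
  gcongr

theorem rpow_le_div_expWeight {σ D a : ℝ} {j : ℕ} (hσ : 0 ≤ σ) (hD : 0 ≤ D)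
    (h : σ ≤ D / expWeight d s ρ j) (ha : 0 ≤ a) (hr : r ≤ ρ * a) :
    σ ^ a ≤ D ^ a / expWeight d s r j := by
  calc σ ^ a ≤ (D / expWeight d s ρ j) ^ a := Real.rpow_le_rpow hσ h ha
    _ = D ^ a / expWeight d s (ρ * a) j := by
        rw [Real.div_rpow hD (expWeight_pos ..).le, expWeight_rpow]
    _ ≤ D ^ a / expWeight d s r j := by
        have := expWeight_pos d s r j
        have := expWeight_mono d s hr j
        gcongr

theorem rpow_quarter_mul_le {σ x : ℝ} (hσ : 0 ≤ σ) (hx0 : 0 ≤ x) (hx1 : x ≤ 1) :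
    σ ^ (1 / 4 : ℝ) * x ≤ σ ^ (1 / 8 : ℝ) * (σ * x) ^ (1 / 8 : ℝ) := by
  have hx : x ≤ x ^ (1 / 8 : ℝ) := by
    conv_lhs => rw [← Real.rpow_one x]
    exact Real.rpow_le_rpow_of_exponent_ge' hx0 hx1 (by norm_num) (by norm_num)
  calc σ ^ (1 / 4 : ℝ) * x ≤ σ ^ (1 / 4 : ℝ) * x ^ (1 / 8 : ℝ) := by gcongr
    _ = σ ^ (1 / 8 : ℝ) * σ ^ (1 / 8 : ℝ) * x ^ (1 / 8 : ℝ) := by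
        rw [← Real.rpow_add_of_nonneg hσ (by norm_num) (by norm_num)]
        norm_num
    _ = σ ^ (1 / 8 : ℝ) * (σ * x) ^ (1 / 8 : ℝ) := by rw [Real.mul_rpow hσ hx0, mul_assoc]

theorem IsSingularScaling.seqCoeffBound {σ θ : ℕ → ℝ} {v : ℕ → (ι → ℕ) → ℂ} {r' D D' : ℝ}
    (hθ : IsSingularScaling d s σ θ v) (hσ : ∀ j, 0 ≤ σ j) (hv : ∀ j β, ‖v j β‖ ≤ 1)
    (hD : 0 ≤ D) (hσD : ∀ j, σ j ≤ D / expWeight d s r' j)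
    (hD' : 0 ≤ D') (hσv : ∀ j β, σ j * ‖v j β‖ ≤ D' * expDecay s ρ β)
    (hr : 0 ≤ r) (hrρ : r ≤ ρ * (1 / 8)) (hrr : r ≤ r' * (1 / 8)) :
    SeqCoeffBound d s r r fun j β => (θ j : ℂ) * v j β := by
  obtain ⟨C, hC⟩ := hθ.le_of_eq_zero r hr
  refine ⟨max (D ^ (1 / 8 : ℝ) * D' ^ (1 / 8 : ℝ)) C, fun j β => ?_⟩
  have := expWeight_pos d s r j
  have := expDecay_pos s r β
  rw [norm_mul, Complex.norm_of_nonneg (hθ.pos j).le]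
  by_cases hj : σ j = 0
  · by_cases hβ : v j β = 0
    · rw [hβ, norm_zero, mul_zero]
      positivity
    · calc θ j * ‖v j β‖ ≤ θ j := mul_le_of_le_one_right (hθ.pos j).le (hv j β)
        _ ≤ C / expWeight d s r j * expDecay s r β := hC j hj β hβ
        _ ≤ _ := by
            gcongr
            exact le_max_right _ _
  · have hσv' : (σ j * ‖v j β‖) ^ (1 / 8 : ℝ) ≤ D' ^ (1 / 8 : ℝ) * expDecay s r β := by
      calc (σ j * ‖v j β‖) ^ (1 / 8 : ℝ) ≤ (D' * expDecay s ρ β) ^ (1 / 8 : ℝ) :=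
            Real.rpow_le_rpow (mul_nonneg (hσ j) (norm_nonneg _)) (hσv j β) (by norm_num)
        _ = D' ^ (1 / 8 : ℝ) * expDecay s (ρ * (1 / 8)) β := by
            rw [Real.mul_rpow hD' (expDecay_pos ..).le, expDecay_rpow]
        _ ≤ D' ^ (1 / 8 : ℝ) * expDecay s r β := by
            gcongr
            exact expDecay_anti s hrρ β
    calc θ j * ‖v j β‖ = σ j ^ (1 / 4 : ℝ) * ‖v j β‖ := by rw [hθ.eq_rpow j hj]
      _ ≤ σ j ^ (1 / 8 : ℝ) * (σ j * ‖v j β‖) ^ (1 / 8 : ℝ) :=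
          rpow_quarter_mul_le (hσ j) (norm_nonneg _) (hv j β)
      _ ≤ D ^ (1 / 8 : ℝ) / expWeight d s r j * (D' ^ (1 / 8 : ℝ) * expDecay s r β) := by
          exact mul_le_mul (rpow_le_div_expWeight (hσ j) hD (hσD j) (by norm_num) hrr) hσv'
            (Real.rpow_nonneg (mul_nonneg (hσ j) (norm_nonneg _)) _) (by positivity)
      _ = D ^ (1 / 8 : ℝ) * D' ^ (1 / 8 : ℝ) / expWeight d s r j * expDecay s r β := by ring
      _ ≤ _ := by
          gcongr
          exact le_max_left _ _

theorem SeqCoeffBound.conj {a : ℕ → (ι → ℕ) → ℂ} (ha : SeqCoeffBound d s r ρ a) :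
    SeqCoeffBound d s r ρ fun j β => starRingEnd ℂ (a j β) := by
  obtain ⟨C, hC⟩ := ha
  exact ⟨C, fun j β => (RCLike.norm_conj _).trans_le (hC j β)⟩

end Scaling

/-- Coefficient sequences of nonzero, mutually orthogonal functions. -/
def OrthogonalCoeffs {A : Type*} (a : ℕ → A → ℂ) : Prop :=
  (∀ j, a j ≠ 0) ∧ ∀ i j, i ≠ j → HasSum (fun β => a i β * starRingEnd ℂ (a j β)) 0

section OrthogonalCoeffs

variable {A : Type*}

theorem OrthogonalCoeffs.conj {a : ℕ → A → ℂ} (ha : OrthogonalCoeffs a) :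
    OrthogonalCoeffs fun j β => starRingEnd ℂ (a j β) := by
  refine ⟨fun j hj => ha.1 j (funext fun β => ?_), fun i j hij => ?_⟩
  · exact (map_eq_zero _).1 (congrFun hj β)
  · refine (ha.2 j i hij.symm).congr_fun fun β => ?_
    rw [Complex.conj_conj, mul_comm]

theorem orthogonalCoeffs_ofReal_mul {v : ℕ → ℓ²(A)} (hv : Orthonormal ℂ v) {θ : ℕ → ℝ}
    (hθ : ∀ j, θ j ≠ 0) : OrthogonalCoeffs fun j β => (θ j : ℂ) * v j β := by
  refine ⟨fun j hj => hv.ne_zero j (lp.ext (funext fun β => ?_)), fun i j hij => ?_⟩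
  · exact (mul_eq_zero.1 (congrFun hj β)).resolve_left (Complex.ofReal_ne_zero.2 (hθ j))
  · have scaled_inner := (lp.hasSum_inner (v j) (v i)).mul_left ((θ i : ℂ) * θ j)
    rw [hv.2 hij.symm, mul_zero] at scaled_inner
    refine scaled_inner.congr_fun fun β => ?_
    rw [RCLike.inner_apply, map_mul, Complex.conj_ofReal]
    ring

end OrthogonalCoeffs

section BilinearExpansion

variable {ι κ : Type*} [Fintype ι] [Fintype κ] {s ρ : ℝ} {c : (κ → ℕ) × (ι → ℕ) → ℂ}
  {σ θ : ℕ → ℝ} {v : ℕ → ℓ²(ι → ℕ)} {u : ℕ → ℓ²(κ → ℕ)}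

/-- The exponential rate at which the factors of the bilinear expansion of a matrix decay, given the
rate `ρ` of the matrix. The singular values `σ` decay at the rate `8 * factorRate s ρ`, the weighted
singular vectors `σ * v` at least at this rate, and the factors are bounded by products of powers
of `σ` and `σ * v` with exponents at least `1 / 8`. -/
def factorRate (s ρ : ℝ) : ℝ :=
  ρ / 2 / 2 ^ (1 / (2 * s)) / 8

theorem factorRate_pos (s : ℝ) (hρ : 0 < ρ) : 0 < factorRate s ρ := by
  unfold factorRate
  positivity

theorem exists_factorRate_eq (s : ℝ) {r : ℝ} (hr : 0 < r) : ∃ ρ > 0, factorRate s ρ = r :=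
  ⟨r * 8 * 2 ^ (1 / (2 * s)) * 2, by positivity, by unfold factorRate; field_simp⟩

theorem MatrixDecay.isSingularSystem_conjSwap (hc : MatrixDecay s ρ c) (hs : 0 < s) (hρ : 0 < ρ)
    (h : IsSingularSystem (matrixOp c) σ v u) :
    IsSingularSystem (matrixOp (Pilipovic.conjSwap c)) σ u v := by
  rw [← adjoint_matrixOp (hc.summable_norm hs hρ)]
  exact h.adjoint

theorem MatrixDecay.exists_singularValue_le_min [Nonempty ι] [Nonempty κ] (hc : MatrixDecay s ρ c)
    (hs : 0 < s) (hρ : 0 < ρ) (h : IsSingularSystem (matrixOp c) σ v u) (hσ : Antitone σ) :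
    ∃ D : ℝ, 0 ≤ D ∧ ∀ j, σ j ≤
      D / expWeight (min (Fintype.card ι) (Fintype.card κ)) s (ρ / 2 / 2 ^ (1 / (2 * s))) j := by
  rcases min_choice (Fintype.card ι) (Fintype.card κ) with hmin | hmin <;> rw [hmin]
  · exact hc.exists_singularValue_le hs hρ h hσ
  · exact hc.conjSwap.exists_singularValue_le hs hρ (hc.isSingularSystem_conjSwap hs hρ h) hσ

theorem MatrixDecay.scalarEstimate_sqrt [Nonempty ι] [Nonempty κ] (hc : MatrixDecay s ρ c)
    (hs : 0 < s) (hρ : 0 < ρ) (h : IsSingularSystem (matrixOp c) σ v u) (hσ : Antitone σ) :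
    ScalarEstimate (min (Fintype.card ι) (Fintype.card κ)) s (factorRate s ρ)
      fun j => σ j ^ (1 / 2 : ℝ) := by
  obtain ⟨D, hD0, hD⟩ := hc.exists_singularValue_le_min hs hρ h hσ
  have : 0 < ρ / 2 / 2 ^ (1 / (2 * s)) := by positivity
  refine ⟨D ^ (1 / 2 : ℝ), fun j => ?_⟩
  rw [mul_comm, ← le_div_iff₀ (expWeight_pos ..)]
  exact rpow_le_div_expWeight (h.nonneg j) hD0 (hD j) (by norm_num)
    (by unfold factorRate; linarith)

theorem MatrixDecay.seqCoeffBound_singularVector [Nonempty ι] [Nonempty κ]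
    (hc : MatrixDecay s ρ c) (hs : 0 < s) (hρ : 0 < ρ) (h : IsSingularSystem (matrixOp c) σ v u)
    (hσ : Antitone σ)
    (hθ : IsSingularScaling (min (Fintype.card ι) (Fintype.card κ)) s σ θ fun j => v j) :
    SeqCoeffBound (min (Fintype.card ι) (Fintype.card κ)) s (factorRate s ρ)
      (factorRate s ρ) fun j β => (θ j : ℂ) * v j β := by
  obtain ⟨D, hD0, hD⟩ := hc.exists_singularValue_le_min hs hρ h hσ
  obtain ⟨D', hD'0, hD'⟩ := hc.exists_mul_norm_singularVector_le hs hρ h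
  have hv (j : ℕ) (β : ι → ℕ) : ‖v j β‖ ≤ 1 :=
    (lp.norm_apply_le_norm two_ne_zero _ _).trans_eq (h.orthonormal_right.1 j)
  have hrate : ρ / 2 / 2 ^ (1 / (2 * s)) ≤ ρ := by
    have : (1 : ℝ) ≤ 2 ^ (1 / (2 * s)) := Real.one_le_rpow one_le_two (by positivity)
    exact (div_le_self (by positivity) this).trans (half_le_self hρ.le)
  exact hθ.seqCoeffBound h.nonneg hv hD0 hD hD'0 hD' (factorRate_pos s hρ).le
    (by unfold factorRate; linarith) (by unfold factorRate; linarith)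

theorem MatrixDecay.exists_bilinear_expansion [Nonempty ι] [Nonempty κ] (hs : 0 < s) (hρ : 0 < ρ)
    (hc : MatrixDecay s ρ c) :
    ∃ (l : ℕ → ℝ) (a : ℕ → (ι → ℕ) → ℂ) (b : ℕ → (κ → ℕ) → ℂ), (∀ j, 0 ≤ l j) ∧
      OrthogonalCoeffs a ∧ OrthogonalCoeffs b ∧
      (∀ α β, HasSum (fun j => (l j : ℂ) * (a j β * b j α)) (c (α, β))) ∧
      ∀ ρ' > 0, MatrixDecay s ρ' c →
        ScalarEstimate (min (Fintype.card ι) (Fintype.card κ)) s (factorRate s ρ') l ∧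
        SeqCoeffBound (min (Fintype.card ι) (Fintype.card κ)) s (factorRate s ρ')
          (factorRate s ρ') a ∧
        SeqCoeffBound (min (Fintype.card ι) (Fintype.card κ)) s (factorRate s ρ')
          (factorRate s ρ') b := by
  have hsum := hc.summable_norm hs hρ
  obtain ⟨σ, v, u, h, hσ, hfin⟩ := exists_isSingularSystem_nat (isCompactOperator_matrixOp hsum)
  obtain ⟨θ, hθv, hθu⟩ := exists_isSingularScaling
    (min (Fintype.card ι) (Fintype.card κ)) hs h.nonneg hfin
  have hθ (j : ℕ) : θ j ≠ 0 := (hθv.pos j).ne'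
  refine ⟨fun j => σ j ^ (1 / 2 : ℝ), fun j β => starRingEnd ℂ ((θ j : ℂ) * v j β),
    fun j α => (θ j : ℂ) * u j α, fun j => Real.rpow_nonneg (h.nonneg j) _,
    (orthogonalCoeffs_ofReal_mul h.orthonormal_right hθ).conj,
    orthogonalCoeffs_ofReal_mul h.orthonormal_left hθ, fun α β => ?_, fun ρ' hρ' hc' =>
    ⟨hc'.scalarEstimate_sqrt hs hρ' h hσ,
      (hc'.seqCoeffBound_singularVector hs hρ' h hσ hθv).conj, ?_⟩⟩
  · have entry_expansion := h.hasSum_inner (unitVec β) (unitVec α)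
    rw [inner_matrixOp hsum] at entry_expansion
    refine entry_expansion.congr_fun fun j => ?_
    beta_reduce
    rw [inner_unitVec_left, inner_unitVec_right, map_mul, Complex.conj_ofReal]
    conv_rhs => rw [← hθv.sqrt_mul_mul_self (h.nonneg j)]
    push_cast
    ring
  · rw [min_comm] at hθu ⊢
    exact hc'.conjSwap.seqCoeffBound_singularVector hs hρ'
      (hc'.isSingularSystem_conjSwap hs hρ' h) hσ hθu

end BilinearExpansion

/-! ### Orthogonal expansions of kernels -/

section OrthogonalExpansion

variable {ι : Type*} [Fintype ι] {d d₁ d₂ : ℕ} {s r r' ρ h : ℝ} {p : ℝ≥0∞} {l : ℕ → ℝ}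
  {a : ℕ → (Fin d₁ → ℕ) → ℂ} {b : ℕ → (Fin d₂ → ℕ) → ℂ} {c : (Fin d₂ ⊕ Fin d₁ → ℕ) → ℂ}
  {K : EuclideanSpace ℝ (Fin d₂) × EuclideanSpace ℝ (Fin d₁) → ℂ}

theorem ScalarEstimate.mono (hl : ScalarEstimate d s r l) (hl0 : ∀ j, 0 ≤ l j) (hr : r' ≤ r) :
    ScalarEstimate d s r' l := by
  obtain ⟨C, hC⟩ := hl
  exact ⟨C, fun j => (mul_le_mul_of_nonneg_right (expWeight_mono d s hr j) (hl0 j)).trans (hC j)⟩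

theorem SeqCoeffBound.mono {a : ℕ → (ι → ℕ) → ℂ} (ha : SeqCoeffBound d s r ρ a) (hr : r' ≤ r) :
    SeqCoeffBound d s r' ρ a := by
  obtain ⟨C, hC0, hC⟩ := ha.exists_nonneg
  refine ⟨C, fun j α => (hC j α).trans ?_⟩
  have := expWeight_pos d s r' j
  have := expWeight_mono d s hr j
  have := expDecay_pos s ρ α
  gcongr

theorem OrthogonalCoeffs.isOG_hermiteSeries {a : ℕ → (ι → ℕ) → ℂ} (ha : OrthogonalCoeffs a)
    (hdecay : ∀ j, RapidDecay (a j)) : IsOG fun j => hermiteSeries (a j) := by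
  refine ⟨fun j => (hdecay j).memLp one_le_two, fun j hj => ha.1 j (funext fun β => ?_),
    fun i j hij => ((hdecay i).hasSum_mul_conj (hdecay j)).unique (ha.2 i j hij)⟩
  rw [← (hdecay j).hermiteCoeff_hermiteSeries]
  refine integral_eq_zero_of_ae (hj.mono fun x hx => ?_)
  simp only [Pi.zero_apply] at hx ⊢
  rw [hx, zero_mul]

theorem HasOrthogonalExpansion.imp {P Q : (ℕ → ℝ) → (ℕ → EuclideanSpace ℝ (Fin d₁) → ℂ) →
    (ℕ → EuclideanSpace ℝ (Fin d₂) → ℂ) → Prop} (hP : HasOrthogonalExpansion K P)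
    (hPQ : ∀ l f₁ f₂, P l f₁ f₂ → Q l f₁ f₂) : HasOrthogonalExpansion K Q :=
  let ⟨l, f₁, f₂, hl, hOG₁, hOG₂, hf₁, hf₂, hK, h⟩ := hP
  ⟨l, f₁, f₂, hl, hOG₁, hOG₂, hf₁, hf₂, hK, hPQ l f₁ f₂ h⟩

theorem expansionAt_hermiteSeries (hd : 0 < d) (hs : 0 < s) (hr : 0 < r) (hρ : 0 < ρ)
    (hl0 : ∀ j, 0 ≤ l j) (hl : ScalarEstimate d s r l) (ha : SeqCoeffBound d s r ρ a)
    (hb : SeqCoeffBound d s r ρ b)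
    (hab : ∀ α β, HasSum (fun j => (l j : ℂ) * (a j β * b j α)) (c (Sum.elim α β)))
    (hK : IsHermiteSeries c (onSum K))
    (z : EuclideanSpace ℝ (Fin d₂) × EuclideanSpace ℝ (Fin d₁)) :
    ExpansionAt K l (fun j => hermiteSeries (a j)) (fun j => hermiteSeries (b j)) z := by
  obtain ⟨L, hL⟩ := hl.exists_bound hl0 hr.le
  obtain ⟨S, sum_over_indices, sum_over_pairs⟩ :=
    exists_hasSum_mul_hermiteSeries hd hs hr hρ hl0 hL ha hb z.2 z.1
  have kernel_sum := hasSum_hermiteFun_joinSum_iff.1 (hK (joinSum z.1 z.2))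
  have S_eq : S = onSum K (joinSum z.1 z.2) := by
    refine (sum_over_pairs.congr_fun fun q => ?_).unique kernel_sum
    rw [(hab q.1 q.2).tsum_eq]
  rw [onSum_joinSum] at S_eq
  rw [ExpansionAt, ← S_eq]
  exact sum_over_indices

theorem expansionEstimates_hermiteSeries (hp : 1 ≤ p) (hs : 0 < s) (hρ : 0 < ρ)
    (hl : ScalarEstimate (min d₁ d₂) s r l) (ha : SeqCoeffBound (min d₁ d₂) s r ρ a)
    (hb : SeqCoeffBound (min d₁ d₂) s r ρ b)
    (hh : 2 * (2 + (max d₁ d₂ : ℕ)) * (2 * s / (ρ / 2)) ^ (2 * s) ≤ h) :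
    ExpansionEstimates p s r h l (fun j => hermiteSeries (a j)) fun j => hermiteSeries (b j) := by
  have le_h {n : ℕ} (hn : n ≤ max d₁ d₂) :
      2 * (2 + (Fintype.card (Fin n) : ℝ)) * (2 * s / (ρ / 2)) ^ (2 * s) ≤ h := by
    refine le_trans ?_ hh
    rw [Fintype.card_fin]
    gcongr
  exact ⟨hl, ha.functionEstimate hp hs hρ (le_h (le_max_left _ _)),
    hb.functionEstimate hp hs hρ (le_h (le_max_right _ _))⟩

theorem CoeffBound.hasOrthogonalExpansion (hd₁ : 1 ≤ d₁) (hd₂ : 1 ≤ d₂) (hp : 1 ≤ p) (hs : 0 < s)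
    (hr : 0 < r) (hc : CoeffBound s r c) (hK : IsHermiteSeries c (onSum K)) :
    HasOrthogonalExpansion K fun l f₁ f₂ => ∀ R > 0, CoeffBound s R c →
      ∀ r' ≤ factorRate s (R / 2),
      ∀ h, 2 * (2 + (max d₁ d₂ : ℕ)) * (2 * s / (factorRate s (R / 2) / 2)) ^ (2 * s) ≤ h →
        ExpansionEstimates p s r' h l f₁ f₂ := by
  have : Nonempty (Fin d₁) := ⟨⟨0, hd₁⟩⟩
  have : Nonempty (Fin d₂) := ⟨⟨0, hd₂⟩⟩
  obtain ⟨l, a, b, hl0, ha, hb, hab, estimates⟩ :=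
    (hc.matrixDecay hs hr.le).exists_bilinear_expansion hs (half_pos hr)
  simp only [Fintype.card_fin] at estimates
  obtain ⟨hl, ha_bound, hb_bound⟩ := estimates _ (half_pos hr) (hc.matrixDecay hs hr.le)
  have hrate := factorRate_pos s (half_pos hr)
  have ha_decay := ha_bound.rapidDecay hs hrate
  have hb_decay := hb_bound.rapidDecay hs hrate
  refine ⟨l, fun j => hermiteSeries (a j), fun j => hermiteSeries (b j), hl0,
    ha.isOG_hermiteSeries ha_decay, hb.isOG_hermiteSeries hb_decay,
    fun j => (ha_decay j).contDiff_hermiteSeries, fun j => (hb_decay j).contDiff_hermiteSeries,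
    expansionAt_hermiteSeries (lt_min hd₁ hd₂) hs hrate hrate hl0 hl ha_bound hb_bound hab hK,
    fun R hR hcR r' hr' h hh => ?_⟩
  obtain ⟨hl, ha_bound, hb_bound⟩ := estimates _ (half_pos hR) (hcR.matrixDecay hs hR.le)
  exact expansionEstimates_hermiteSeries hp hs (factorRate_pos s (half_pos hR)) (hl.mono hl0 hr')
    (ha_bound.mono hr') (hb_bound.mono hr') hh

theorem hasOrthogonalExpansion_of_mem_roumieuSpace (hd₁ : 1 ≤ d₁) (hd₂ : 1 ≤ d₂) (hp : 1 ≤ p)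
    (hs : 0 < s) (hK : onSum K ∈ roumieuSpace (Fin d₂ ⊕ Fin d₁) s) :
    HasOrthogonalExpansion K fun l f₁ f₂ =>
      ∃ r > 0, ∃ h > 0, ExpansionEstimates p s r h l f₁ f₂ := by
  obtain ⟨c, ⟨r, hr, hc⟩, hcK⟩ := hK
  have hrate := factorRate_pos s (half_pos hr)
  exact (hc.hasOrthogonalExpansion hd₁ hd₂ hp hs hr hcK).imp fun l f₁ f₂ estimates =>
    ⟨_, hrate, _, by positivity, estimates r hr hc _ le_rfl _ le_rfl⟩

theorem exists_ge_mul_rpow_le (hs : 0 < s) (r : ℝ) (hh : 0 < h) {q : ℝ} (hq : 0 < q) :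
    ∃ ρ > 0, r ≤ ρ ∧ q * (2 * s / (ρ / 2)) ^ (2 * s) ≤ h := by
  set t : ℝ := (h / q) ^ (1 / (2 * s)) with ht
  have ht0 : 0 < t := by positivity
  have hρ : 4 * s / t ≤ max r (4 * s / t) := le_max_right _ _
  have hρ0 : 0 < max r (4 * s / t) := lt_of_lt_of_le (by positivity) hρ
  refine ⟨max r (4 * s / t), hρ0, le_max_left _ _, ?_⟩
  have hbase : 2 * s / (max r (4 * s / t) / 2) ≤ t := by
    rw [div_le_iff₀ (half_pos hρ0)]
    linarith [(div_le_iff₀ ht0).1 hρ]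
  calc q * (2 * s / (max r (4 * s / t) / 2)) ^ (2 * s) ≤ q * t ^ (2 * s) := by gcongr
    _ = q * (h / q) := by
        rw [ht, ← Real.rpow_mul (by positivity), one_div_mul_cancel (by positivity), Real.rpow_one]
    _ = h := by field_simp

theorem hasOrthogonalExpansion_of_mem_beurlingSpace (hd₁ : 1 ≤ d₁) (hd₂ : 1 ≤ d₂) (hp : 1 ≤ p)
    (hs : 0 < s) (hK : onSum K ∈ beurlingSpace (Fin d₂ ⊕ Fin d₁) s) :
    HasOrthogonalExpansion K fun l f₁ f₂ =>
      ∀ r > 0, ∀ h > 0, ExpansionEstimates p s r h l f₁ f₂ := by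
  obtain ⟨c, hc, hcK⟩ := hK
  refine ((hc 1 one_pos).hasOrthogonalExpansion hd₁ hd₂ hp hs one_pos hcK).imp
    fun l f₁ f₂ estimates r _ h hh => ?_
  obtain ⟨ρ, hρ0, hrρ, hρh⟩ := exists_ge_mul_rpow_le (q := 2 * (2 + (max d₁ d₂ : ℕ))) hs r hh
    (by positivity)
  obtain ⟨R, hR, rfl⟩ := exists_factorRate_eq s hρ0
  rw [← mul_div_cancel_left₀ R two_ne_zero] at hrρ hρh
  exact estimates (2 * R) (by positivity) (hc _ (by positivity)) r hrρ h hρh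

end OrthogonalExpansion

end Pilipovic

end

theorem theorem5p2_general {d₁ d₂ : ℕ} (hd₁ : 1 ≤ d₁) (hd₂ : 1 ≤ d₂) {p : ℝ≥0∞} (hp : 1 ≤ p)
    {s : ℝ} (hs : 0 < s)
    {K : EuclideanSpace ℝ (Fin d₂) × EuclideanSpace ℝ (Fin d₁) → ℂ} (hK : Continuous K) :
    (Pilipovic.onSum K ∈ Pilipovic.roumieuSpace (Fin d₂ ⊕ Fin d₁) s →
      Pilipovic.HasOrthogonalExpansion K fun l f₁ f₂ =>
        ∃ r > 0, ∃ h > 0, Pilipovic.ExpansionEstimates p s r h l f₁ f₂) ∧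
    (Pilipovic.onSum K ∈ Pilipovic.beurlingSpace (Fin d₂ ⊕ Fin d₁) s →
      Pilipovic.HasOrthogonalExpansion K fun l f₁ f₂ =>
        ∀ r > 0, ∀ h > 0, Pilipovic.ExpansionEstimates p s r h l f₁ f₂) ∧
    ((Pilipovic.HasExpansion K fun l f₁ f₂ =>
        ∃ r > 0, ∃ h > 0, Pilipovic.ExpansionEstimates p s r h l f₁ f₂) →
      Pilipovic.onSum K ∈ Pilipovic.roumieuSpace (Fin d₂ ⊕ Fin d₁) s) ∧
    ((Pilipovic.HasExpansion K fun l f₁ f₂ =>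
        ∀ r > 0, ∀ h > 0, Pilipovic.ExpansionEstimates p s r h l f₁ f₂) →
      Pilipovic.onSum K ∈ Pilipovic.beurlingSpace (Fin d₂ ⊕ Fin d₁) s) :=
  ⟨Pilipovic.hasOrthogonalExpansion_of_mem_roumieuSpace hd₁ hd₂ hp hs,
    Pilipovic.hasOrthogonalExpansion_of_mem_beurlingSpace hd₁ hd₂ hp hs,
    Pilipovic.onSum_mem_roumieuSpace hK hd₁ hd₂ hp hs,
    Pilipovic.onSum_mem_beurlingSpace hK hd₁ hd₂ hp hs⟩

theorem theorem5p2 (d₁ d₂ : ℕ) (hd₁ : 1 ≤ d₁) (hd₂ : 1 ≤ d₂) (p : ℝ≥0∞) (hp : 1 ≤ p)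
    (s : ℝ) (hs : 0 < s)
    (K : EuclideanSpace ℝ (Fin d₂) × EuclideanSpace ℝ (Fin d₁) → ℂ) (hK : ContDiff ℝ ∞ K) :
    (Pilipovic.onSum K ∈ Pilipovic.roumieuSpace (Fin d₂ ⊕ Fin d₁) s →
      Pilipovic.HasOrthogonalExpansion K fun l f₁ f₂ =>
        ∃ r > 0, ∃ h > 0, Pilipovic.ExpansionEstimates p s r h l f₁ f₂) ∧
    (Pilipovic.onSum K ∈ Pilipovic.beurlingSpace (Fin d₂ ⊕ Fin d₁) s →
      Pilipovic.HasOrthogonalExpansion K fun l f₁ f₂ =>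
        ∀ r > 0, ∀ h > 0, Pilipovic.ExpansionEstimates p s r h l f₁ f₂) ∧
    ((Pilipovic.HasExpansion K fun l f₁ f₂ =>
        ∃ r > 0, ∃ h > 0, Pilipovic.ExpansionEstimates p s r h l f₁ f₂) →
      Pilipovic.onSum K ∈ Pilipovic.roumieuSpace (Fin d₂ ⊕ Fin d₁) s) ∧
    ((Pilipovic.HasExpansion K fun l f₁ f₂ =>
        ∀ r > 0, ∀ h > 0, Pilipovic.ExpansionEstimates p s r h l f₁ f₂) →
      Pilipovic.onSum K ∈ Pilipovic.beurlingSpace (Fin d₂ ⊕ Fin d₁) s) :=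
  theorem5p2_general hd₁ hd₂ hp hs hK.continuous
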